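/- **Setting.** Let $(E,G,\tau,\mu)$ be a crossed module of finite dimensional Lie groups, with Lie algebras $\mathfrak e,\mathfrak g$ and derived maps $\dot\tau:\mathfrak e\to\mathfrak g$, $\mu\dot{}(a,\cdot)=T_1\mu(a,\cdot):\mathfrak e\to\mathfrak e$, ${}\dot{}\mu(x,A)=\frac{d}{dt}\big|_{t=0}\mu(e^{tx},A)A^{-1}\in\mathfrak e$ and ${}\dot{}\mu\dot{}(x,X)=\frac{d}{dt}\big|_{t=0}\mu\dot{}(e^{tx},X)$. Let $\hat P\rightrightarrows P_0$ be a principal 2-bundle over a manifold $M$ whose structure 2-group is the strict Lie 2-group of the crossed module: a Lie groupoid with a projection $\pi$ to $M$, a right action of the 2-group, and local trivializations that are equivariant, projection preserving and weakly invertible. Its synthetic morphism manifold is the orbit $P=P_0\cdot(\mathfrak e[1]\rtimes G)\cong P_0\times\mathfrak e[1]$, with the induced projection $\pi:P\to M$ and right action of $\mathfrak e[1]\rtimes G$. *Internal functions* on $T[1]X$ are smooth functions of the indicated degree on the graded manifold $T[1]X$, with coefficients depending on auxiliary graded parameters (the functor of points of the internal mapping space); $d$ is the de Rham vector field of $T[1]X$.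 A function on $T[1]\pi^{-1}(U)$ is *basic* if it is annihilated by the contractions and Lie derivatives $j_Z,l_Z$ along all vertical vector fields, $Z\in\mathfrak e[1]\rtimes\mathfrak g$, $Z=x+X$. A *2-connection* consists of internal functions $\omega,\Omega,\theta,\Theta$ on $T[1]P$ valued in $\mathfrak g[1],\mathfrak e[2],\mathfrak g[2],\mathfrak e[3]$ with $$d\omega=-\tfrac12[\omega,\omega]+\dot\tau(\Omega)+\theta,\quad d\Omega=-{}\dot{}\mu\dot{}(\omega,\Omega)+\Theta,\quad d\theta=-[\omega,\theta]-\dot\tau(\Theta),\quad d\Theta=-{}\dot{}\mu\dot{}(\omega,\Theta)+{}\dot{}\mu\dot{}(\theta,\Omega),$$ $$j_Z\omega=x,\quad j_Z\Omega=X,\quad j_Z\theta=0,\quad j_Z\Theta=0,\quad l_Z\omega=-[x,\omega]+\dot\tau(X),\quad l_Z\Omega=-{}\dot{}\mu\dot{}(x,\Omega)+{}\dot{}\mu\dot{}(\omega,X),$$ $$l_Z\theta=-[x,\theta],\qquad l_Z\Theta=-{}\dot{}\mu\dot{}(x,\Theta)+{}\dot{}\mu\dot{}(\theta,X).$$ It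 is *fake flat* if $\theta=0$. *Adapted coordinates* over a trivializing set $U$ are internal functions $\gamma,\Gamma,\sigma,\Sigma$ on $T[1]\pi^{-1}(U)$ valued in $G,\mathfrak e[1],\mathfrak g[1],\mathfrak e[2]$ such that $$\gamma^{-1}d\gamma=\sigma-\dot\tau(\mu\dot{}(\gamma^{-1},\Gamma)),\qquad \mu\dot{}(\gamma^{-1},d\Gamma)=\Sigma-\tfrac12\mu\dot{}(\gamma^{-1},[\Gamma,\Gamma]),$$ $$\gamma^{-1}j_Z\gamma=0,\quad \mu\dot{}(\gamma^{-1},j_Z\Gamma)=0,\quad \gamma^{-1}l_Z\gamma=x,\quad \mu\dot{}(\gamma^{-1},l_Z\Gamma)=X,$$ such that $\sigma,\Sigma$ obey the relations of $\omega,\Omega$ for $d,j_Z,l_Z$ with $\theta=\Theta=0$, and such that $\gamma,\Gamma$ restrict on the zero section $\pi^{-1}(U)\subset T[1]\pi^{-1}(U)$ to the ordinary functions given by the trivialization. Fix a trivializing open covering $\{U_i\}$ of $M$ and adapted coordinates $\gamma_i,\Gamma_i,\sigma_i,\Sigma_i$ over each $U_i$, and set $$\omega_{\mathrm b i}=\mathrm{Ad}\,\gamma_i(\omega-\sigma_i),\qquad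 \Omega_{\mathrm b i}=\mu\dot{}(\gamma_i,\Omega-\Sigma_i)-{}\dot{}\mu\dot{}(\omega_{\mathrm b i},\Gamma_i),$$ $$f_{\mathrm b ij}=\gamma_i\gamma_j^{-1},\qquad F_{\mathrm b ij}=\Gamma_i-\mu\dot{}(f_{\mathrm b ij},\Gamma_j).$$ A *differential paracocycle* $\{\omega_{\mathrm b i},\Omega_{\mathrm b i},T_{\mathrm b ij}\}$ is a fake flat 2-connection together with basic $E$-valued internal functions $T_{\mathrm b ij}$ on $T[1]\pi^{-1}(U_i\cap U_j)$ for which there are internal functions $\bar\omega_i,\bar\Omega_i$ on $T[1]U_i$, valued in $\mathfrak g[1],\mathfrak e[2]$, $\bar f_{ij},\bar F_{ij}$ on $T[1](U_i\cap U_j)$, valued in $G,\mathfrak e[1]$, and $\bar T_{ijk}$ on $T[1](U_i\cap U_j\cap U_k)$, valued in $E$, with $$\omega_{\mathrm b i}=\pi^*\bar\omega_i,\qquad \Omega_{\mathrm b i}=\pi^*\bar\Omega_i,\qquad f_{\mathrm b ij}=\tau(T_{\mathrm b ij})\,\pi^*\bar f_{ij},$$ $$F_{\mathrm b ij}=\mathrm{Ad}\,T_{\mathrm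 b ij}(\pi^*\bar F_{ij})-{}\dot{}\mu(\pi^*\bar\omega_i,T_{\mathrm b ij})-dT_{\mathrm b ij}\,T_{\mathrm b ij}^{-1},\qquad T_{\mathrm b ik}^{-1}\,\mu(f_{\mathrm b ij},T_{\mathrm b jk})\,T_{\mathrm b ij}=\pi^*\bar T_{ijk}.$$ These $\{\bar\omega_i,\bar\Omega_i,\bar f_{ij},\bar F_{ij},\bar T_{ijk}\}$ are its associated differential cocycle. Two differential paracocycles (with respect to the same covering and adapted coordinates) are *equivalent* if $\tilde\omega_{\mathrm b i}=\omega_{\mathrm b i}$, $\tilde\Omega_{\mathrm b i}=\Omega_{\mathrm b i}$ for all $i$ and there are $E$-valued internal functions $\bar T_{ij}$ on $T[1](U_i\cap U_j)$ with $\tilde T_{\mathrm b ij}=T_{\mathrm b ij}\,\pi^*\bar T_{ij}^{-1}$. **Proposition.** If two differential paracocycles $\{\omega_{\mathrm b i},\Omega_{\mathrm b i},T_{\mathrm b ij}\}$ and $\{\tilde\omega_{\mathrm b i},\tilde\Omega_{\mathrm b i},\tilde T_{\mathrm b ij}\}$ are equivalent, then their associated differential cocycles are equivalent. Explicitly, for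 all functions $\bar T_{ij}$ that realize the equivalence of the paracocycles, $$\bar{\tilde\omega}_i=\bar\omega_i,\qquad \bar{\tilde\Omega}_i=\bar\Omega_i\qquad\text{on each } U_i,$$ $$\bar{\tilde f}_{ij}=\tau(\bar T_{ij})\,\bar f_{ij},\qquad \bar{\tilde F}_{ij}=\mathrm{Ad}\,\bar T_{ij}(\bar F_{ij})-{}\dot{}\mu(\bar{\tilde\omega}_i,\bar T_{ij})-d\bar T_{ij}\,\bar T_{ij}^{-1}\qquad\text{on each } U_i\cap U_j,$$ $$\bar{\tilde T}_{ijk}=\bar T_{ik}\,\bar T_{ijk}\,\mu(\bar f_{ij},\bar T_{jk}^{-1})\,\bar T_{ij}^{-1}\qquad\text{on each } U_i\cap U_j\cap U_k .$$ -/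

import Mathlib

open scoped Manifold ContDiff TensorProduct

noncomputable section

namespace TwoBundle

/-! ## Internal functions

The graded manifold `X × F[1]` (`X` an ordinary manifold modelled on `EX`, `F` a vector space) has
the shifted tangent bundle `T[1](X × F[1])`, with coordinates: points of `X` (degree 0), the
covectors of `X` (degree 1), the linear coordinates `Y` of `F[1]` (degree 1) and their differentials
`η = dY` (degree 2).  Internal functions moreover have coefficients depending on auxiliary graded
parameters; these are `N` free odd generators, the `j`-th one of odd degree `deg j ∈ ℤ`, with `N`
and `deg` arbitrary (the functor of points of the internal mapping space).

An internal function is thus a function of `x ∈ X` and `η ∈ F` with values in the exterior algebra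
on the odd generators: covectors of `X` at `x`, linear coordinates of `F[1]`, parameters.  The fiber
of the cotangent space at `x` is read in the preferred chart at `x`, as Mathlib does for
`TangentSpace`.  An ordinary manifold `X` is the case `F = PUnit`. -/

/-- The fiber algebra: exterior algebra on covectors of `X`, coordinates of `F[1]`, parameters. -/
abbrev Gr (EX F : Type*) [NormedAddCommGroup EX] [NormedSpace ℝ EX]
    [NormedAddCommGroup F] [NormedSpace ℝ F] (N : ℕ) : Type _ :=
  ExteriorAlgebra ℝ (Module.Dual ℝ EX × Module.Dual ℝ F × (Fin N → ℝ))

section Fiber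

variable {EX F EX' F' : Type*} [NormedAddCommGroup EX] [NormedSpace ℝ EX]
  [NormedAddCommGroup F] [NormedSpace ℝ F] [NormedAddCommGroup EX'] [NormedSpace ℝ EX']
  [NormedAddCommGroup F'] [NormedSpace ℝ F'] {N : ℕ}

/-- Substitution of odd generators along linear maps `EX → EX'` and `F → F'`. -/
def Gr.pull (A : EX →ₗ[ℝ] EX') (B : F →ₗ[ℝ] F') : Gr EX' F' N →ₐ[ℝ] Gr EX F N :=
  ExteriorAlgebra.map (A.dualMap.prodMap (B.dualMap.prodMap LinearMap.id))

/-- Scaling of the odd generators by `t ^ degree`. -/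
def Gr.scale (deg : Fin N → ℤ) (t : ℝ) : Gr EX F N →ₐ[ℝ] Gr EX F N :=
  ExteriorAlgebra.map ((t • LinearMap.id).prodMap ((t • LinearMap.id).prodMap
    (LinearMap.pi fun j => (t ^ deg j) • LinearMap.proj j)))

/-- The odd generator given by a covector of `X`. -/
def Gr.dx (a : Module.Dual ℝ EX) : Gr EX F N := ExteriorAlgebra.ι ℝ (a, 0, 0)

/-- The odd generator given by a linear coordinate of `F[1]`. -/
def Gr.y (ξ : Module.Dual ℝ F) : Gr EX F N := ExteriorAlgebra.ι ℝ (0, ξ, 0)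

/-- The odd derivation of the fiber algebra which on generators is the linear form `c`. -/
def Gr.contract (c : Module.Dual ℝ (Module.Dual ℝ EX × Module.Dual ℝ F × (Fin N → ℝ))) :
    Gr EX F N →ₗ[ℝ] Gr EX F N :=
  CliffordAlgebra.contractLeft (Q := (0 : QuadraticForm ℝ _)) c

end Fiber

section Coefficients

variable {V V' V'' A : Type*} [AddCommGroup V] [Module ℝ V] [AddCommGroup V'] [Module ℝ V']
  [AddCommGroup V''] [Module ℝ V''] [Ring A] [Algebra ℝ A]

/-- Extension of a bilinear map to `A`-valued elements: `(v ⊗ a, v' ⊗ a') ↦ β v v' ⊗ a a'`. -/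
def bil (β : V →ₗ[ℝ] V' →ₗ[ℝ] V'') (s : V ⊗[ℝ] A) (s' : V' ⊗[ℝ] A) : V'' ⊗[ℝ] A :=
  TensorProduct.map₂ β (LinearMap.mul ℝ A) s s'

/-- Extension of a linear map to `A`-valued elements. -/
def lin (L : V →ₗ[ℝ] V') (s : V ⊗[ℝ] A) : V' ⊗[ℝ] A := LinearMap.rTensor A L s

/-- The derivative at `0` of a curve in a real vector space, tested on linear forms. -/
def wderiv (c : ℝ → V) : V :=
  open Classical in
  if h : ∃ v, ∀ l : Module.Dual ℝ V, HasDerivAt (fun t => l (c t)) (l v) 0 then h.choose else 0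

end Coefficients

section Evaluation

variable {Y W A : Type*} [NormedAddCommGroup Y] [NormedSpace ℝ Y] [FiniteDimensional ℝ Y]
  [NormedAddCommGroup W] [NormedSpace ℝ W] [Ring A] [Algebra ℝ A]

/-- Application of an `A`-valued linear map to an `A`-valued vector. -/
def app {V : Type*} [NormedAddCommGroup V] [NormedSpace ℝ V]
    (L : (V →L[ℝ] W) ⊗[ℝ] A) (v : V ⊗[ℝ] A) : W ⊗[ℝ] A :=
  bil (ContinuousLinearMap.coeLM ℝ) L v

/-- The value of a smooth function `φ` at `y + ξ`, where `ξ` has commuting nilpotent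
components, products of more than `D` of which vanish: the finite Taylor expansion
`∑ₖ (1/k!) Dᵏφ(y)(ξ, …, ξ)`. -/
def taylor (D : ℕ) (φ : Y → W) (y : Y) (ξ : Y ⊗[ℝ] A) : W ⊗[ℝ] A :=
  ∑ k ∈ Finset.range (D + 1), ((k.factorial : ℝ)⁻¹) •
    ∑ i : Fin k → Fin (Module.finrank ℝ Y),
      (iteratedFDeriv ℝ k φ y fun j => Module.finBasis ℝ Y (i j)) ⊗ₜ[ℝ]
        (List.ofFn fun j =>
          TensorProduct.lid ℝ A (lin ((Module.finBasis ℝ Y).coord (i j)) ξ)).prod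

end Evaluation

section Points

variable {EX F : Type*} [NormedAddCommGroup EX] [NormedSpace ℝ EX]
  [NormedAddCommGroup F] [NormedSpace ℝ F] {N : ℕ}

/-- Values of internal functions into a manifold `K`: a point of `K` (the body) and a nilpotent
displacement (the soul), read in the preferred chart at the body. -/
abbrev Pt (K EK EX F : Type*) [NormedAddCommGroup EK] [NormedSpace ℝ EK]
    [NormedAddCommGroup EX] [NormedSpace ℝ EX] [NormedAddCommGroup F] [NormedSpace ℝ F]
    (N : ℕ) : Type _ := K × (EK ⊗[ℝ] Gr EX F N)

variable (EX F N) in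
/-- Number of odd generators of the fiber algebra. -/
def oddDim : ℕ := Module.finrank ℝ (Module.Dual ℝ EX × Module.Dual ℝ F × (Fin N → ℝ))

variable {EK K EK' K' EL L W : Type*}
  [NormedAddCommGroup EK] [NormedSpace ℝ EK] [FiniteDimensional ℝ EK]
  [TopologicalSpace K] [ChartedSpace EK K]
  [NormedAddCommGroup EK'] [NormedSpace ℝ EK'] [FiniteDimensional ℝ EK']
  [TopologicalSpace K'] [ChartedSpace EK' K']
  [NormedAddCommGroup EL] [NormedSpace ℝ EL]
  [TopologicalSpace L] [ChartedSpace EL L]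
  [NormedAddCommGroup W] [NormedSpace ℝ W]

/-- The chart of `K` used at `k`. -/
abbrev ch (k : K) : PartialEquiv K EK := extChartAt 𝓘(ℝ, EK) k

/-- The value of a vector valued function of one variable. -/
def Pt.eval (φ : K → W) (p : Pt K EK EX F N) : W ⊗[ℝ] Gr EX F N :=
  taylor (oddDim EX F N) (fun z => φ ((ch (EK := EK) p.1).symm z)) (ch p.1 p.1) p.2

/-- The value of a vector valued function of two variables. -/
def Pt.eval₂ (φ : K → K' → W) (p : Pt K EK EX F N) (q : Pt K' EK' EX F N) :
    W ⊗[ℝ] Gr EX F N :=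
  taylor (oddDim EX F N)
    (fun z : EK × EK' => φ ((ch (EK := EK) p.1).symm z.1) ((ch (EK := EK') q.1).symm z.2))
    (ch p.1 p.1, ch q.1 q.1)
    (lin (LinearMap.inl ℝ EK EK') p.2 + lin (LinearMap.inr ℝ EK EK') q.2)

/-- The value of a map into a manifold. -/
def Pt.map (φ : K → L) (p : Pt K EK EX F N) : Pt L EL EX F N :=
  (φ p.1, Pt.eval (fun k => ch (EK := EL) (φ p.1) (φ k)) p - ch (φ p.1) (φ p.1) ⊗ₜ 1)

/-- The value of a map of two variables into a manifold. -/
def Pt.map₂ (φ : K → K' → L) (p : Pt K EK EX F N) (q : Pt K' EK' EX F N) : Pt L EL EX F N :=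
  (φ p.1 q.1, Pt.eval₂ (fun k k' => ch (EK := EL) (φ p.1 q.1) (φ k k')) p q
    - ch (φ p.1 q.1) (φ p.1 q.1) ⊗ₜ 1)

/-- Product of group valued elements. -/
def Pt.mul [Group K] (p q : Pt K EK EX F N) : Pt K EK EX F N := Pt.map₂ (fun a b => a * b) p q

/-- Inverse of a group valued element. -/
def Pt.inv [Group K] (p : Pt K EK EX F N) : Pt K EK EX F N := Pt.map (fun a => a⁻¹) p

end Points

section Fields

/-- Functions on `T[1](X × F[1])` with values in a vector space `W`. -/
abbrev VField (X EX F : Type*) [NormedAddCommGroup EX] [NormedSpace ℝ EX]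
    [NormedAddCommGroup F] [NormedSpace ℝ F] (N : ℕ)
    (W : Type*) [AddCommGroup W] [Module ℝ W] : Type _ := X → F → W ⊗[ℝ] Gr EX F N

/-- Functions on `T[1](X × F[1])` with values in a manifold `K`. -/
abbrev MField (X EX F : Type*) [NormedAddCommGroup EX] [NormedSpace ℝ EX]
    [NormedAddCommGroup F] [NormedSpace ℝ F] (N : ℕ)
    (K EK : Type*) [NormedAddCommGroup EK] [NormedSpace ℝ EK] : Type _ :=
  X → F → Pt K EK EX F N

variable {EX X F W : Type*} [NormedAddCommGroup EX] [NormedSpace ℝ EX] [FiniteDimensional ℝ EX]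
  [TopologicalSpace X] [ChartedSpace EX X] [IsManifold 𝓘(ℝ, EX) ∞ X]
  [NormedAddCommGroup F] [NormedSpace ℝ F] {N : ℕ}
  [AddCommGroup W] [Module ℝ W]

/-- The expression of `s` in the chart at `x₀`. -/
def localRep (s : VField X EX F N W) (x₀ : X) (z : EX) (η : F) : W ⊗[ℝ] Gr EX F N :=
  let x := (ch (EK := EX) x₀).symm z
  LinearMap.lTensor W
    (Gr.pull (tangentCoordChange 𝓘(ℝ, EX) x₀ x x : EX →ₗ[ℝ] EX) LinearMap.id).toLinearMap (s x η)

/-- Smoothness near `(x₀, η₀)`, tested on linear forms. -/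
def SmoothAt (s : VField X EX F N W) (x₀ : X) (η₀ : F) : Prop :=
  ∀ l : Module.Dual ℝ (W ⊗[ℝ] Gr EX F N),
    ContDiffAt ℝ ∞ (fun z : EX × F => l (localRep s x₀ z.1 z.2)) (ch x₀ x₀, η₀)

/-- The derivative along `η` in direction `v`. -/
def dEta (v : F) (s : VField X EX F N W) : VField X EX F N W :=
  fun x η => wderiv fun t : ℝ => s x (η + t • v)

/-- The de Rham vector field of `T[1](X × F[1])`: exterior derivative along `X`, `Y ↦ η`, `η ↦ 0`
and the parameters are constant. -/
def extD (s : VField X EX F N W) : VField X EX F N W := fun x η =>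
  (∑ i, LinearMap.lTensor W
      (LinearMap.mulLeft ℝ (Gr.dx (F := F) (N := N) ((Module.finBasis ℝ EX).coord i)))
      (wderiv fun t : ℝ => localRep s x (ch x x + t • Module.finBasis ℝ EX i) η))
  + LinearMap.lTensor W (Gr.contract (EX := EX) (N := N)
      ((Module.Dual.eval ℝ F η) ∘ₗ LinearMap.fst ℝ _ _ ∘ₗ LinearMap.snd ℝ _ _)) (s x η)

/-- `s` is an internal function over `U` with values in `W[n]`.  The total degree is `n` if the
rescaling of all coordinates by `t ^ degree` multiplies `s` by `t ^ n`; by smoothness this makes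
`s` polynomial in `η`. -/
def IsVField (deg : Fin N → ℤ) (n : ℤ) (U : Set X) (s : VField X EX F N W) : Prop :=
  (∀ x ∈ U, ∀ η, SmoothAt s x η) ∧
  ∀ t : ℝ, t ≠ 0 → ∀ x ∈ U, ∀ η,
    LinearMap.lTensor W (Gr.scale deg t).toLinearMap (s x (t ^ 2 • η)) = t ^ n • s x η

variable {EK K : Type*} [NormedAddCommGroup EK] [NormedSpace ℝ EK] [FiniteDimensional ℝ EK]
  [TopologicalSpace K] [ChartedSpace EK K]

/-- `s` is an internal function over `U` with values in the manifold `K` (of degree 0): the soul is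
nilpotent, the body is smooth, the coordinates are smooth, and everything is of degree 0. -/
def IsMField (deg : Fin N → ℤ) (U : Set X) (s : MField X EX F N K EK) : Prop :=
  (∀ x ∈ U, ∀ η,
    LinearMap.lTensor EK (ExteriorAlgebra.algebraMapInv
      (R := ℝ) (M := Module.Dual ℝ EX × Module.Dual ℝ F × (Fin N → ℝ))).toLinearMap (s x η).2 = 0) ∧
  ContMDiffOn (𝓘(ℝ, EX).prod 𝓘(ℝ, F)) 𝓘(ℝ, EK) ∞
    (fun z : X × F => (s z.1 z.2).1) (U ×ˢ Set.univ) ∧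
  (∀ x ∈ U, ∀ η, SmoothAt (fun x' η' => Pt.eval (ch (EK := EK) (s x η).1) (s x' η')) x η) ∧
  ∀ t : ℝ, t ≠ 0 → ∀ x ∈ U, ∀ η, (s x (t ^ 2 • η)).1 = (s x η).1 ∧
    LinearMap.lTensor EK (Gr.scale deg t).toLinearMap (s x (t ^ 2 • η)).2 = (s x η).2

section LieGroup

variable [Group K]

/-- The derivative at `h` of right translation by `h⁻¹`, in the charts at `c` and `1`. -/
def rightMC (c h : K) : EK →L[ℝ] EK :=
  fderiv ℝ (fun z => ch (EK := EK) (1 : K) ((ch (EK := EK) c).symm z * h⁻¹)) (ch c h)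

/-- The derivative at `h` of left translation by `h⁻¹`, in the charts at `c` and `1`. -/
def leftMC (c h : K) : EK →L[ℝ] EK :=
  fderiv ℝ (fun z => ch (EK := EK) (1 : K) (h⁻¹ * (ch (EK := EK) c).symm z)) (ch c h)

/-- `(D s) s⁻¹` for a derivation `D` of internal functions. -/
def logR (D : VField X EX F N EK → VField X EX F N EK) (s : MField X EX F N K EK) :
    VField X EX F N EK := fun x η =>
  app (Pt.eval (rightMC (EK := EK) (s x η).1) (s x η))
    (D (fun x' η' => Pt.eval (ch (EK := EK) (s x η).1) (s x' η')) x η)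

/-- `s⁻¹ (D s)` for a derivation `D` of internal functions. -/
def logL (D : VField X EX F N EK → VField X EX F N EK) (s : MField X EX F N K EK) :
    VField X EX F N EK := fun x η =>
  app (Pt.eval (leftMC (EK := EK) (s x η).1) (s x η))
    (D (fun x' η' => Pt.eval (ch (EK := EK) (s x η).1) (s x' η')) x η)

variable (EK) in
/-- The adjoint action of a Lie group on its Lie algebra. -/
def adj (a : K) : EK →L[ℝ] EK := mfderiv 𝓘(ℝ, EK) 𝓘(ℝ, EK) (fun b : K => a * b * a⁻¹) 1

/-- `Ad s (v)`. -/
def Pt.Ad (p : Pt K EK EX F N) (v : EK ⊗[ℝ] Gr EX F N) : EK ⊗[ℝ] Gr EX F N :=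
  app (Pt.eval (adj EK) p) v

variable (K EK) in
/-- The Lie bracket of the Lie algebra of a Lie group, as a bilinear map. -/
def brk [LieGroup 𝓘(ℝ, EK) ∞ K] : EK →ₗ[ℝ] EK →ₗ[ℝ] EK :=
  haveI : LieGroup 𝓘(ℝ, EK) (minSmoothness ℝ 3) K := by
    simpa using (inferInstance : LieGroup 𝓘(ℝ, EK) 3 K)
  haveI : CompleteSpace EK := FiniteDimensional.complete ℝ EK
  let b : GroupLieAlgebra 𝓘(ℝ, EK) K →ₗ[ℝ]
      GroupLieAlgebra 𝓘(ℝ, EK) K →ₗ[ℝ] GroupLieAlgebra 𝓘(ℝ, EK) K :=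
    LinearMap.mk₂ ℝ (fun x y => ⁅x, y⁆) add_lie smul_lie lie_add lie_smul
  b

end LieGroup

end Fields

section Crossed

/-- A Lie group crossed module `(E, G, τ, μ)`.  The model spaces `𝔢`, `𝔤` of `E`, `G` are also their
Lie algebras, as tangent spaces at `1`. -/
structure LieCrossedModule (𝔢 E 𝔤 G : Type*)
    [NormedAddCommGroup 𝔢] [NormedSpace ℝ 𝔢] [TopologicalSpace E] [ChartedSpace 𝔢 E] [Group E]
    [NormedAddCommGroup 𝔤] [NormedSpace ℝ 𝔤] [TopologicalSpace G] [ChartedSpace 𝔤 G] [Group G]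
    where
  τ : E →* G
  μ : G →* MulAut E
  smooth_τ : ContMDiff 𝓘(ℝ, 𝔢) 𝓘(ℝ, 𝔤) ∞ τ
  smooth_μ : ContMDiff (𝓘(ℝ, 𝔤).prod 𝓘(ℝ, 𝔢)) 𝓘(ℝ, 𝔢) ∞ (fun p : G × E => μ p.1 p.2)
  equivariance : ∀ a A, τ (μ a A) = a * τ A * a⁻¹
  peiffer : ∀ A B, μ (τ A) B = A * B * A⁻¹

variable {𝔢 E 𝔤 G : Type*}
  [NormedAddCommGroup 𝔢] [NormedSpace ℝ 𝔢] [FiniteDimensional ℝ 𝔢]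
  [TopologicalSpace E] [ChartedSpace 𝔢 E] [Group E]
  [NormedAddCommGroup 𝔤] [NormedSpace ℝ 𝔤] [FiniteDimensional ℝ 𝔤]
  [TopologicalSpace G] [ChartedSpace 𝔤 G] [Group G]
  (cm : LieCrossedModule 𝔢 E 𝔤 G)

namespace LieCrossedModule

/-! The strict Lie 2-group of the crossed module: objects `G`, morphisms `E ⋊ G`, where `(A, a)` is
a morphism from `a` to `τ(A) a`. -/

/-- Target of a morphism. -/
def tgt (k : E × G) : G := cm.τ k.1 * k.2

/-- Product of morphisms. -/
def kmul (k l : E × G) : E × G := (k.1 * cm.μ k.2 l.1, k.2 * l.2)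

/-- Composition of morphisms, `l` after `k`, meaningful when `l.2 = tgt k`. -/
def kcomp (_ : LieCrossedModule 𝔢 E 𝔤 G) (l k : E × G) : E × G := (l.1 * k.1, k.2)

/-! The derived maps of the crossed module. -/

/-- `τ̇ : 𝔢 → 𝔤`. -/
def dτ : 𝔢 →L[ℝ] 𝔤 := mfderiv 𝓘(ℝ, 𝔢) 𝓘(ℝ, 𝔤) cm.τ 1

/-- `μ˙(a, ·) : 𝔢 → 𝔢`, the derivative of `μ(a, ·)` at `1`. -/
def μd (a : G) : 𝔢 →L[ℝ] 𝔢 := mfderiv 𝓘(ℝ, 𝔢) 𝓘(ℝ, 𝔢) (fun A => cm.μ a A) 1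

/-- `˙μ(·, A) : 𝔤 → 𝔢`, `x ↦ d/dt μ(exp (t x), A) A⁻¹` at `t = 0`. -/
def dμ (A : E) : 𝔤 →L[ℝ] 𝔢 := mfderiv 𝓘(ℝ, 𝔤) 𝓘(ℝ, 𝔢) (fun a => cm.μ a A * A⁻¹) 1

/-- `˙μ˙ : 𝔤 × 𝔢 → 𝔢`, the derivative of `a ↦ μ˙(a, ·)` at `1`. -/
def dμd : 𝔤 →L[ℝ] (𝔢 →L[ℝ] 𝔢) := mfderiv 𝓘(ℝ, 𝔤) 𝓘(ℝ, 𝔢 →L[ℝ] 𝔢) cm.μd 1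

/-! The same maps on values of internal functions. -/

variable {EX F : Type*} [NormedAddCommGroup EX] [NormedSpace ℝ EX]
  [NormedAddCommGroup F] [NormedSpace ℝ F] {N : ℕ}

/-- `τ(T)`. -/
def pτ (T : Pt E 𝔢 EX F N) : Pt G 𝔤 EX F N := Pt.map cm.τ T

/-- `μ(g, T)`. -/
def pμ (g : Pt G 𝔤 EX F N) (T : Pt E 𝔢 EX F N) : Pt E 𝔢 EX F N :=
  Pt.map₂ (fun a A => cm.μ a A) g T

/-- `μ˙(g, v)`. -/
def pμd (g : Pt G 𝔤 EX F N) (v : 𝔢 ⊗[ℝ] Gr EX F N) : 𝔢 ⊗[ℝ] Gr EX F N :=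
  app (Pt.eval cm.μd g) v

/-- `˙μ(u, T)`: the linear map `˙μ(·, T)`, of degree 0, applied to `u`. -/
def pdμ (u : 𝔤 ⊗[ℝ] Gr EX F N) (T : Pt E 𝔢 EX F N) : 𝔢 ⊗[ℝ] Gr EX F N :=
  app (Pt.eval cm.dμ T) u

/-- `˙μ˙(u, v)`. -/
def pdμd (u : 𝔤 ⊗[ℝ] Gr EX F N) (v : 𝔢 ⊗[ℝ] Gr EX F N) : 𝔢 ⊗[ℝ] Gr EX F N :=
  bil (ContinuousLinearMap.coeLM ℝ ∘ₗ (cm.dμd : 𝔤 →ₗ[ℝ] (𝔢 →L[ℝ] 𝔢))) u v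

end LieCrossedModule

end Crossed

section Bundle

/-- Data of a groupoid `P1 ⇉ P0` of smooth manifolds with projections to `M` and right actions of
the strict Lie 2-group of `cm`, satisfying all conditions of a principal 2-bundle except local
triviality.  `comp b a` is `b` after `a`, meaningful when `s b = t a`. -/
structure PreTwoBundle {𝔢 E 𝔤 G : Type*}
    [NormedAddCommGroup 𝔢] [NormedSpace ℝ 𝔢] [TopologicalSpace E] [ChartedSpace 𝔢 E] [Group E]
    [NormedAddCommGroup 𝔤] [NormedSpace ℝ 𝔤] [TopologicalSpace G] [ChartedSpace 𝔤 G] [Group G]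
    (cm : LieCrossedModule 𝔢 E 𝔤 G) (EM M EP P0 EQ P1 : Type*)
    [NormedAddCommGroup EM] [NormedSpace ℝ EM] [TopologicalSpace M] [ChartedSpace EM M]
    [NormedAddCommGroup EP] [NormedSpace ℝ EP] [TopologicalSpace P0] [ChartedSpace EP P0]
    [NormedAddCommGroup EQ] [NormedSpace ℝ EQ] [TopologicalSpace P1] [ChartedSpace EQ P1]
    where
  s : P1 → P0
  t : P1 → P0
  one : P0 → P1
  comp : P1 → P1 → P1
  inv : P1 → P1
  smooth_s : ContMDiff 𝓘(ℝ, EQ) 𝓘(ℝ, EP) ∞ s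
  smooth_t : ContMDiff 𝓘(ℝ, EQ) 𝓘(ℝ, EP) ∞ t
  submersion_s : ∀ a, Function.Surjective (mfderiv 𝓘(ℝ, EQ) 𝓘(ℝ, EP) s a)
  submersion_t : ∀ a, Function.Surjective (mfderiv 𝓘(ℝ, EQ) 𝓘(ℝ, EP) t a)
  smooth_one : ContMDiff 𝓘(ℝ, EP) 𝓘(ℝ, EQ) ∞ one
  smooth_inv : ContMDiff 𝓘(ℝ, EQ) 𝓘(ℝ, EQ) ∞ inv
  smooth_comp : ContMDiffOn (𝓘(ℝ, EQ).prod 𝓘(ℝ, EQ)) 𝓘(ℝ, EQ) ∞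
    (fun z : P1 × P1 => comp z.1 z.2) {z | s z.1 = t z.2}
  s_one : ∀ p, s (one p) = p
  t_one : ∀ p, t (one p) = p
  s_comp : ∀ b a, s b = t a → s (comp b a) = s a
  t_comp : ∀ b a, s b = t a → t (comp b a) = t b
  comp_assoc : ∀ c b a, s c = t b → s b = t a → comp (comp c b) a = comp c (comp b a)
  comp_one : ∀ a, comp a (one (s a)) = a
  one_comp : ∀ a, comp (one (t a)) a = a
  s_inv : ∀ a, s (inv a) = t a
  t_inv : ∀ a, t (inv a) = s a
  inv_comp : ∀ a, comp (inv a) a = one (s a)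
  comp_inv : ∀ a, comp a (inv a) = one (t a)
  /-- The projection of objects; the projection of morphisms is `π ∘ s = π ∘ t`. -/
  π : P0 → M
  smooth_π : ContMDiff 𝓘(ℝ, EP) 𝓘(ℝ, EM) ∞ π
  π_s_t : ∀ a, π (s a) = π (t a)
  act0 : P0 → G → P0
  act1 : P1 → E × G → P1
  smooth_act0 : ContMDiff (𝓘(ℝ, EP).prod 𝓘(ℝ, 𝔤)) 𝓘(ℝ, EP) ∞ (fun z : P0 × G => act0 z.1 z.2)
  smooth_act1 : ContMDiff (𝓘(ℝ, EQ).prod (𝓘(ℝ, 𝔢).prod 𝓘(ℝ, 𝔤))) 𝓘(ℝ, EQ) ∞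
    (fun z : P1 × (E × G) => act1 z.1 z.2)
  act0_one : ∀ p, act0 p 1 = p
  act0_mul : ∀ p g h, act0 p (g * h) = act0 (act0 p g) h
  act1_one : ∀ a, act1 a (1, 1) = a
  act1_mul : ∀ a k l, act1 a (cm.kmul k l) = act1 (act1 a k) l
  s_act : ∀ a k, s (act1 a k) = act0 (s a) k.2
  t_act : ∀ a k, t (act1 a k) = act0 (t a) (cm.tgt k)
  one_act : ∀ p g, one (act0 p g) = act1 (one p) (1, g)
  comp_act : ∀ b a l k, s b = t a → l.2 = cm.tgt k →
    act1 (comp b a) (cm.kcomp l k) = comp (act1 b l) (act1 a k)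
  π_act : ∀ p g, π (act0 p g) = π p

variable {𝔢 E 𝔤 G EM M EP P0 EQ P1 : Type*}
  [NormedAddCommGroup 𝔢] [NormedSpace ℝ 𝔢] [FiniteDimensional ℝ 𝔢]
  [TopologicalSpace E] [ChartedSpace 𝔢 E] [Group E] [LieGroup 𝓘(ℝ, 𝔢) ∞ E]
  [NormedAddCommGroup 𝔤] [NormedSpace ℝ 𝔤] [FiniteDimensional ℝ 𝔤]
  [TopologicalSpace G] [ChartedSpace 𝔤 G] [Group G] [LieGroup 𝓘(ℝ, 𝔤) ∞ G]
  {cm : LieCrossedModule 𝔢 E 𝔤 G}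
  [NormedAddCommGroup EM] [NormedSpace ℝ EM] [FiniteDimensional ℝ EM]
  [TopologicalSpace M] [ChartedSpace EM M] [IsManifold 𝓘(ℝ, EM) ∞ M]
  [NormedAddCommGroup EP] [NormedSpace ℝ EP] [FiniteDimensional ℝ EP]
  [TopologicalSpace P0] [ChartedSpace EP P0] [IsManifold 𝓘(ℝ, EP) ∞ P0]
  [NormedAddCommGroup EQ] [NormedSpace ℝ EQ] [FiniteDimensional ℝ EQ]
  [TopologicalSpace P1] [ChartedSpace EQ P1] [IsManifold 𝓘(ℝ, EQ) ∞ P1]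

/-- A trivialization over `U`: an equivariant projection preserving functor `Φ` from the restriction
of the bundle to `U` to `U ×` the 2-group, with a weak inverse `Ψ` of the same kind and equivariant
natural isomorphisms `η : 1 ⇒ Ψ Φ` and `ε : Φ Ψ ⇒ 1`.  Only the 2-group components of `Φ` and of
`ε` are recorded. -/
structure LocalTriv (P : PreTwoBundle cm EM M EP P0 EQ P1) (U : Set M) where
  Φ0 : P0 → G
  Φ1 : P1 → E × G
  Ψ0 : M → G → P0
  Ψ1 : M → E × G → P1
  η : P0 → P1
  ε : M → G → E × G
  smooth_Φ0 : ContMDiffOn 𝓘(ℝ, EP) 𝓘(ℝ, 𝔤) ∞ Φ0 (P.π ⁻¹' U)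
  smooth_Φ1 : ContMDiffOn 𝓘(ℝ, EQ) (𝓘(ℝ, 𝔢).prod 𝓘(ℝ, 𝔤)) ∞ Φ1 ((P.π ∘ P.s) ⁻¹' U)
  smooth_Ψ0 : ContMDiffOn (𝓘(ℝ, EM).prod 𝓘(ℝ, 𝔤)) 𝓘(ℝ, EP) ∞
    (fun z : M × G => Ψ0 z.1 z.2) (U ×ˢ Set.univ)
  smooth_Ψ1 : ContMDiffOn (𝓘(ℝ, EM).prod (𝓘(ℝ, 𝔢).prod 𝓘(ℝ, 𝔤))) 𝓘(ℝ, EQ) ∞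
    (fun z : M × (E × G) => Ψ1 z.1 z.2) (U ×ˢ Set.univ)
  smooth_η : ContMDiffOn 𝓘(ℝ, EP) 𝓘(ℝ, EQ) ∞ η (P.π ⁻¹' U)
  smooth_ε : ContMDiffOn (𝓘(ℝ, EM).prod 𝓘(ℝ, 𝔤)) (𝓘(ℝ, 𝔢).prod 𝓘(ℝ, 𝔤)) ∞
    (fun z : M × G => ε z.1 z.2) (U ×ˢ Set.univ)
  Φ_s : ∀ a, P.π (P.s a) ∈ U → (Φ1 a).2 = Φ0 (P.s a)
  Φ_t : ∀ a, P.π (P.s a) ∈ U → cm.tgt (Φ1 a) = Φ0 (P.t a)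
  Φ_one : ∀ p, P.π p ∈ U → Φ1 (P.one p) = (1, Φ0 p)
  Φ_comp : ∀ b a, P.π (P.s a) ∈ U → P.s b = P.t a → Φ1 (P.comp b a) = cm.kcomp (Φ1 b) (Φ1 a)
  Φ_act0 : ∀ p g, P.π p ∈ U → Φ0 (P.act0 p g) = Φ0 p * g
  Φ_act1 : ∀ a k, P.π (P.s a) ∈ U → Φ1 (P.act1 a k) = cm.kmul (Φ1 a) k
  π_Ψ : ∀ x ∈ U, ∀ g, P.π (Ψ0 x g) = x
  Ψ_s : ∀ x ∈ U, ∀ k, P.s (Ψ1 x k) = Ψ0 x k.2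
  Ψ_t : ∀ x ∈ U, ∀ k, P.t (Ψ1 x k) = Ψ0 x (cm.tgt k)
  Ψ_one : ∀ x ∈ U, ∀ g, Ψ1 x (1, g) = P.one (Ψ0 x g)
  Ψ_comp : ∀ x ∈ U, ∀ l k, l.2 = cm.tgt k → Ψ1 x (cm.kcomp l k) = P.comp (Ψ1 x l) (Ψ1 x k)
  Ψ_act0 : ∀ x ∈ U, ∀ g h, Ψ0 x (g * h) = P.act0 (Ψ0 x g) h
  Ψ_act1 : ∀ x ∈ U, ∀ k l, Ψ1 x (cm.kmul k l) = P.act1 (Ψ1 x k) l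
  η_s : ∀ p, P.π p ∈ U → P.s (η p) = p
  η_t : ∀ p, P.π p ∈ U → P.t (η p) = Ψ0 (P.π p) (Φ0 p)
  η_natural : ∀ a, P.π (P.s a) ∈ U →
    P.comp (Ψ1 (P.π (P.s a)) (Φ1 a)) (η (P.s a)) = P.comp (η (P.t a)) a
  η_act : ∀ p g, P.π p ∈ U → η (P.act0 p g) = P.act1 (η p) (1, g)
  ε_s : ∀ x ∈ U, ∀ g, (ε x g).2 = Φ0 (Ψ0 x g)
  ε_t : ∀ x ∈ U, ∀ g, cm.tgt (ε x g) = g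
  ε_natural : ∀ x ∈ U, ∀ k,
    cm.kcomp k (ε x k.2) = cm.kcomp (ε x (cm.tgt k)) (Φ1 (Ψ1 x k))
  ε_act : ∀ x ∈ U, ∀ g h, ε x (g * h) = cm.kmul (ε x g) (1, h)

variable (cm EM M EP P0 EQ P1) in
/-- A principal 2-bundle with structure 2-group that of `cm`. -/
structure PrincipalTwoBundle extends PreTwoBundle cm EM M EP P0 EQ P1 where
  locally_trivial : ∀ x : M, ∃ U : Set M, IsOpen U ∧ x ∈ U ∧
    Nonempty (LocalTriv toPreTwoBundle U)

/-! ### The synthetic morphism manifold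

The synthetic morphism manifold `P` is the orbit of the units of `P0` under the group
`DM = 𝔢[1] ⋊ G` of the functions `ᾱ ↦ exp (ᾱ X) a` on `ℝ[-1]`, acting through the formal extension
of the right action on `P1`.  As that action is free, the points `p · exp (ᾱ Y)` with `p ∈ P0` and
`Y ∈ 𝔢[1]` describe `P` without repetition, so `P = P0 × 𝔢[1]`, with projection `(p, Y) ↦ π p`.
Since `exp (ᾱ Y) exp (ᾱ X) a = a exp (ᾱ μ˙(a⁻¹, Y + X))`, the right action of `(X, a)` on `P` is
`(p, Y) ↦ (p a, μ˙(a⁻¹, Y + X))`. -/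

variable {N : ℕ} {W : Type*} [AddCommGroup W] [Module ℝ W]

/-- Vector valued functions on `T[1]P`. -/
abbrev PV (P0 EP 𝔢 : Type*) [NormedAddCommGroup EP] [NormedSpace ℝ EP]
    [NormedAddCommGroup 𝔢] [NormedSpace ℝ 𝔢] (N : ℕ) (W : Type*) [AddCommGroup W] [Module ℝ W] :
    Type _ := VField P0 EP 𝔢 N W

namespace PreTwoBundle

variable (P : PreTwoBundle cm EM M EP P0 EQ P1)

/-- The fundamental vector field of `x ∈ 𝔤` on `P0`. -/
def fund (x : 𝔤) (p : P0) : EP := mfderiv 𝓘(ℝ, 𝔤) 𝓘(ℝ, EP) (fun a => P.act0 p a) 1 x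

/-! The derivations of the operation of `P`: contractions `jG x`, `jE X` and Lie derivatives
`lG x`, `lE X` along the vertical vector fields of `x ∈ 𝔤` and `X ∈ 𝔢[1]`.  Here `jE X`, `lE X`, of
degrees `-2`, `-1`, are the coefficients of a formal parameter `λ` of degree 1 in the contraction
and the Lie derivative along `λ X`: `j_(λ X) = λ jE X` and `l_(λ X) = λ lE X`. -/

/-- `jG x` is the odd derivation which contracts covectors of `P0` with the fundamental vector
field of `x` and maps `Y ↦ 0`, `η ↦ -˙μ˙(x, Y)`. -/
def jG (x : 𝔤) (s : PV P0 EP 𝔢 N W) : PV P0 EP 𝔢 N W := fun p η =>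
  LinearMap.lTensor W (Gr.contract (F := 𝔢) (N := N)
    ((Module.Dual.eval ℝ EP (P.fund x p)) ∘ₗ LinearMap.fst ℝ _ _)) (s p η)
  - ∑ a, LinearMap.lTensor W (LinearMap.mulLeft ℝ (Gr.y (EX := EP) (N := N)
      ((Module.finBasis ℝ 𝔢).coord a ∘ₗ (cm.dμd x : 𝔢 →ₗ[ℝ] 𝔢))))
      (dEta (Module.finBasis ℝ 𝔢 a) s p η)

/-- `jE X` is the derivation with `η ↦ X` and all other coordinates mapped to `0`. -/
def jE (_ : PreTwoBundle cm EM M EP P0 EQ P1) (X : 𝔢) (s : PV P0 EP 𝔢 N W) : PV P0 EP 𝔢 N W :=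
  dEta X s

/-- `lG x = [d, jG x]`. -/
def lG (x : 𝔤) (s : PV P0 EP 𝔢 N W) : PV P0 EP 𝔢 N W :=
  extD (P.jG x s) + P.jG x (extD s)

/-- `lE X`: from `λ lE X = [d, λ jE X] = d λ jE X + λ jE X d`. -/
def lE (X : 𝔢) (s : PV P0 EP 𝔢 N W) : PV P0 EP 𝔢 N W :=
  P.jE X (extD s) - extD (P.jE X s)

/-- The derivative of the projection. -/
def dπ (p : P0) : EP →L[ℝ] EM := mfderiv 𝓘(ℝ, EP) 𝓘(ℝ, EM) P.π p

/-- Pull-back by the projection of functions on `T[1]M`. -/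
def pullV (s : VField M EM PUnit.{1} N W) : PV P0 EP 𝔢 N W := fun p _ =>
  LinearMap.lTensor W (Gr.pull (P.dπ p : EP →ₗ[ℝ] EM)
    (0 : 𝔢 →ₗ[ℝ] PUnit.{1})).toLinearMap (s (P.π p) 0)

/-- Pull-back by the projection of manifold valued functions on `T[1]M`. -/
def pullM {K EK : Type*} [NormedAddCommGroup EK] [NormedSpace ℝ EK]
    (s : MField M EM PUnit.{1} N K EK) : MField P0 EP 𝔢 N K EK := fun p η =>
  ((s (P.π p) 0).1, P.pullV (fun x w => (s x w).2) p η)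

/-- The restriction at `p` to the zero section `P` of `T[1]P`. -/
def zeroSec (s : PV P0 EP 𝔢 N W) (p : P0) : W ⊗[ℝ] Gr EP 𝔢 N :=
  LinearMap.lTensor W (Gr.pull (0 : EP →ₗ[ℝ] EP) (LinearMap.id : 𝔢 →ₗ[ℝ] 𝔢)).toLinearMap (s p 0)

/-- A Lie group valued function is basic over `U`. -/
def IsBasic {K EK : Type*} [NormedAddCommGroup EK] [NormedSpace ℝ EK] [FiniteDimensional ℝ EK]
    [TopologicalSpace K] [ChartedSpace EK K] [Group K] (U : Set M)
    (T : MField P0 EP 𝔢 N K EK) : Prop :=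
  ∀ p, P.π p ∈ U → ∀ η,
    (∀ x, logL (P.jG x) T p η = 0) ∧ (∀ X, logL (P.jE X) T p η = 0) ∧
    (∀ x, logL (P.lG x) T p η = 0) ∧ (∀ X, logL (P.lE X) T p η = 0)

end PreTwoBundle

/-! ### 2-connections and adapted coordinates

In the relations for `lE X`, moving the parameter `λ` to the left past an odd function changes the
sign: `l_(λ X) Ω = ˙μ˙(ω, λ X)` reads `lE X Ω = -˙μ˙(ω, X)`. -/

/-- A 2-connection of `P`, through its projected connection components `om`, `Om` (`ω`, `Ω`) and
curvature components `th`, `Th` (`θ`, `Θ`), with the action of the operation derivations. -/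
structure TwoConnection (P : PreTwoBundle cm EM M EP P0 EQ P1) (N : ℕ) (deg : Fin N → ℤ) where
  om : PV P0 EP 𝔢 N 𝔤
  Om : PV P0 EP 𝔢 N 𝔢
  th : PV P0 EP 𝔢 N 𝔤
  Th : PV P0 EP 𝔢 N 𝔢
  int_om : IsVField deg 1 Set.univ om
  int_Om : IsVField deg 2 Set.univ Om
  int_th : IsVField deg 2 Set.univ th
  int_Th : IsVField deg 3 Set.univ Th
  d_om : ∀ p η, extD om p η =
    -((1 / 2 : ℝ) • bil (brk 𝔤 G) (om p η) (om p η)) + lin cm.dτ (Om p η) + th p η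
  d_Om : ∀ p η, extD Om p η = -cm.pdμd (om p η) (Om p η) + Th p η
  d_th : ∀ p η, extD th p η = -bil (brk 𝔤 G) (om p η) (th p η) - lin cm.dτ (Th p η)
  d_Th : ∀ p η, extD Th p η = -cm.pdμd (om p η) (Th p η) + cm.pdμd (th p η) (Om p η)
  jG_om : ∀ x p η, P.jG x om p η = x ⊗ₜ 1
  jE_om : ∀ X p η, P.jE X om p η = 0
  jG_Om : ∀ x p η, P.jG x Om p η = 0
  jE_Om : ∀ X p η, P.jE X Om p η = X ⊗ₜ 1
  jG_th : ∀ x p η, P.jG x th p η = 0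
  jE_th : ∀ X p η, P.jE X th p η = 0
  jG_Th : ∀ x p η, P.jG x Th p η = 0
  jE_Th : ∀ X p η, P.jE X Th p η = 0
  lG_om : ∀ x p η, P.lG x om p η = -bil (brk 𝔤 G) (x ⊗ₜ 1) (om p η)
  lE_om : ∀ X p η, P.lE X om p η = cm.dτ X ⊗ₜ 1
  lG_Om : ∀ x p η, P.lG x Om p η = -cm.pdμd (x ⊗ₜ 1) (Om p η)
  lE_Om : ∀ X p η, P.lE X Om p η = -cm.pdμd (om p η) (X ⊗ₜ 1)
  lG_th : ∀ x p η, P.lG x th p η = -bil (brk 𝔤 G) (x ⊗ₜ 1) (th p η)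
  lE_th : ∀ X p η, P.lE X th p η = 0
  lG_Th : ∀ x p η, P.lG x Th p η = -cm.pdμd (x ⊗ₜ 1) (Th p η)
  lE_Th : ∀ X p η, P.lE X Th p η = cm.pdμd (th p η) (X ⊗ₜ 1)

/-- A 2-connection is fake flat if `θ = 0`. -/
def TwoConnection.IsFakeFlat {P : PreTwoBundle cm EM M EP P0 EQ P1} {deg : Fin N → ℤ}
    (A : TwoConnection P N deg) : Prop := ∀ p η, A.th p η = 0

/-- Internal adapted coordinates of `P` over `U` modelled on `DM`, in projected form, subordinate to
a trivialization over `U`.  On `P`, the trivialization is `p · exp (ᾱ Y) ↦ Φ0 p exp (ᾱ Y)`, which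
equals `exp (ᾱ μ˙(Φ0 p, Y)) Φ0 p`. -/
structure AdaptedCoordinates (P : PreTwoBundle cm EM M EP P0 EQ P1) {U : Set M}
    (triv : LocalTriv P U) (N : ℕ) (deg : Fin N → ℤ) where
  γ : MField P0 EP 𝔢 N G 𝔤
  Γ : PV P0 EP 𝔢 N 𝔢
  σ : PV P0 EP 𝔢 N 𝔤
  Sg : PV P0 EP 𝔢 N 𝔢
  int_γ : IsMField deg (P.π ⁻¹' U) γ
  int_Γ : IsVField deg 1 (P.π ⁻¹' U) Γ
  int_σ : IsVField deg 1 (P.π ⁻¹' U) σ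
  int_Sg : IsVField deg 2 (P.π ⁻¹' U) Sg
  d_γ : ∀ p, P.π p ∈ U → ∀ η, logL extD γ p η =
    σ p η - lin cm.dτ (cm.pμd (γ p η).inv (Γ p η))
  d_Γ : ∀ p, P.π p ∈ U → ∀ η, cm.pμd (γ p η).inv (extD Γ p η) =
    Sg p η - (1 / 2 : ℝ) • cm.pμd (γ p η).inv (bil (brk 𝔢 E) (Γ p η) (Γ p η))
  d_σ : ∀ p, P.π p ∈ U → ∀ η, extD σ p η =
    -((1 / 2 : ℝ) • bil (brk 𝔤 G) (σ p η) (σ p η)) + lin cm.dτ (Sg p η)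
  d_Sg : ∀ p, P.π p ∈ U → ∀ η, extD Sg p η = -cm.pdμd (σ p η) (Sg p η)
  jG_γ : ∀ x p, P.π p ∈ U → ∀ η, logL (P.jG x) γ p η = 0
  jE_γ : ∀ X p, P.π p ∈ U → ∀ η, logL (P.jE X) γ p η = 0
  jG_Γ : ∀ x p, P.π p ∈ U → ∀ η, cm.pμd (γ p η).inv (P.jG x Γ p η) = 0
  jE_Γ : ∀ X p, P.π p ∈ U → ∀ η, cm.pμd (γ p η).inv (P.jE X Γ p η) = 0
  jG_σ : ∀ x p, P.π p ∈ U → ∀ η, P.jG x σ p η = x ⊗ₜ 1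
  jE_σ : ∀ X p, P.π p ∈ U → ∀ η, P.jE X σ p η = 0
  jG_Sg : ∀ x p, P.π p ∈ U → ∀ η, P.jG x Sg p η = 0
  jE_Sg : ∀ X p, P.π p ∈ U → ∀ η, P.jE X Sg p η = X ⊗ₜ 1
  lG_γ : ∀ x p, P.π p ∈ U → ∀ η, logL (P.lG x) γ p η = x ⊗ₜ 1
  lE_γ : ∀ X p, P.π p ∈ U → ∀ η, logL (P.lE X) γ p η = 0
  lG_Γ : ∀ x p, P.π p ∈ U → ∀ η, cm.pμd (γ p η).inv (P.lG x Γ p η) = 0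
  lE_Γ : ∀ X p, P.π p ∈ U → ∀ η, cm.pμd (γ p η).inv (P.lE X Γ p η) = X ⊗ₜ 1
  lG_σ : ∀ x p, P.π p ∈ U → ∀ η, P.lG x σ p η = -bil (brk 𝔤 G) (x ⊗ₜ 1) (σ p η)
  lE_σ : ∀ X p, P.π p ∈ U → ∀ η, P.lE X σ p η = cm.dτ X ⊗ₜ 1
  lG_Sg : ∀ x p, P.π p ∈ U → ∀ η, P.lG x Sg p η = -cm.pdμd (x ⊗ₜ 1) (Sg p η)
  lE_Sg : ∀ X p, P.π p ∈ U → ∀ η, P.lE X Sg p η = -cm.pdμd (σ p η) (X ⊗ₜ 1)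
  zero_γ : ∀ p, P.π p ∈ U → (γ p 0).1 = triv.Φ0 p ∧
    PreTwoBundle.zeroSec (fun p η => (γ p η).2) p = 0
  zero_Γ : ∀ p, P.π p ∈ U → PreTwoBundle.zeroSec Γ p =
    ∑ a, cm.μd (triv.Φ0 p) (Module.finBasis ℝ 𝔢 a) ⊗ₜ
      Gr.y (EX := EP) (N := N) ((Module.finBasis ℝ 𝔢).coord a)

section Basic

variable {P : PreTwoBundle cm EM M EP P0 EQ P1} {U U' : Set M} {triv : LocalTriv P U}
  {triv' : LocalTriv P U'} {deg : Fin N → ℤ}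

/-- The local basic component `ω_b = Ad γ (ω - σ)`. -/
def TwoConnection.omb (A : TwoConnection P N deg) (c : AdaptedCoordinates P triv N deg) :
    PV P0 EP 𝔢 N 𝔤 := fun p η => (c.γ p η).Ad (A.om p η - c.σ p η)

/-- The local basic component `Ω_b = μ˙(γ, Ω - Σ) - ˙μ˙(Ad γ (ω - σ), Γ)`. -/
def TwoConnection.Omb (A : TwoConnection P N deg) (c : AdaptedCoordinates P triv N deg) :
    PV P0 EP 𝔢 N 𝔢 := fun p η =>
  cm.pμd (c.γ p η) (A.Om p η - c.Sg p η) - cm.pdμd (A.omb c p η) (c.Γ p η)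

/-- The basic transition function `f_b = γ' γ⁻¹`. -/
def fb (c' : AdaptedCoordinates P triv' N deg) (c : AdaptedCoordinates P triv N deg) :
    MField P0 EP 𝔢 N G 𝔤 := fun p η => (c'.γ p η).mul (c.γ p η).inv

/-- The basic transition function `F_b = Γ' - μ˙(γ' γ⁻¹, Γ)`. -/
def Fb (c' : AdaptedCoordinates P triv' N deg) (c : AdaptedCoordinates P triv N deg) :
    PV P0 EP 𝔢 N 𝔢 := fun p η => c'.Γ p η - cm.pμd (fb c' c p η) (c.Γ p η)

end Basic

/-! ### Differential paracocycles -/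

/-- A trivializing covering of the base, with adapted coordinates over each of its sets. -/
structure TrivializingCover (P : PreTwoBundle cm EM M EP P0 EQ P1) (ι : Type*)
    (N : ℕ) (deg : Fin N → ℤ) where
  U : ι → Set M
  isOpen : ∀ i, IsOpen (U i)
  cover : ∀ x, ∃ i, x ∈ U i
  triv : ∀ i, LocalTriv P (U i)
  coord : ∀ i, AdaptedCoordinates P (triv i) N deg

variable (M EM 𝔢 E 𝔤 G) in
/-- The data on `M` of a differential cocycle: `om i`, `Om i` (`ω_i`, `Ω_i`) on `U i`, `f i j`, `F i j` on
`U i ∩ U j` and `T i j k` on `U i ∩ U j ∩ U k`.  Values elsewhere have no meaning. -/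
structure CocycleData (ι : Type*) (N : ℕ) where
  om : ι → VField M EM PUnit.{1} N 𝔤
  Om : ι → VField M EM PUnit.{1} N 𝔢
  f : ι → ι → MField M EM PUnit.{1} N G 𝔤
  F : ι → ι → VField M EM PUnit.{1} N 𝔢
  T : ι → ι → ι → MField M EM PUnit.{1} N E 𝔢

variable {P : PreTwoBundle cm EM M EP P0 EQ P1} {ι : Type*} {deg : Fin N → ℤ}

/-- `T` is a quasi trivializer: basic `E`-valued internal functions over the `U i ∩ U j`. -/
def IsQuasiTrivializer (C : TrivializingCover P ι N deg)
    (T : ι → ι → MField P0 EP 𝔢 N E 𝔢) : Prop :=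
  ∀ i j, IsMField deg (P.π ⁻¹' (C.U i ∩ C.U j)) (T i j) ∧ P.IsBasic (C.U i ∩ C.U j) (T i j)

/-- `c` are local data on `M` expressing the 2-connection `A` and the quasi trivializer `T`, as
demanded in the definition of a differential paracocycle. -/
structure IsAssociated (C : TrivializingCover P ι N deg) (A : TwoConnection P N deg)
    (T : ι → ι → MField P0 EP 𝔢 N E 𝔢) (c : CocycleData 𝔢 E 𝔤 G EM M ι N) : Prop where
  int_om : ∀ i, IsVField deg 1 (C.U i) (c.om i)
  int_Om : ∀ i, IsVField deg 2 (C.U i) (c.Om i)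
  int_f : ∀ i j, IsMField deg (C.U i ∩ C.U j) (c.f i j)
  int_F : ∀ i j, IsVField deg 1 (C.U i ∩ C.U j) (c.F i j)
  int_T : ∀ i j k, IsMField deg (C.U i ∩ C.U j ∩ C.U k) (c.T i j k)
  eq_om : ∀ i p, P.π p ∈ C.U i → ∀ η, A.omb (C.coord i) p η = P.pullV (c.om i) p η
  eq_Om : ∀ i p, P.π p ∈ C.U i → ∀ η, A.Omb (C.coord i) p η = P.pullV (c.Om i) p η
  eq_f : ∀ i j p, P.π p ∈ C.U i ∩ C.U j → ∀ η,
    fb (C.coord i) (C.coord j) p η = (cm.pτ (T i j p η)).mul (P.pullM (c.f i j) p η)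
  eq_F : ∀ i j p, P.π p ∈ C.U i ∩ C.U j → ∀ η,
    Fb (C.coord i) (C.coord j) p η =
      (T i j p η).Ad (P.pullV (c.F i j) p η)
        - cm.pdμ (P.pullV (c.om i) p η) (T i j p η) - logR extD (T i j) p η
  eq_T : ∀ i j k p, P.π p ∈ C.U i ∩ C.U j ∩ C.U k → ∀ η,
    ((T i k p η).inv.mul (cm.pμ (fb (C.coord i) (C.coord j) p η) (T j k p η))).mul (T i j p η)
      = P.pullM (c.T i j k) p η

/-- A differential paracocycle: a fake flat 2-connection and a quasi trivializer for which
local data on the base exist. -/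
structure IsParacocycle (C : TrivializingCover P ι N deg) (A : TwoConnection P N deg)
    (T : ι → ι → MField P0 EP 𝔢 N E 𝔢) : Prop where
  fakeFlat : A.IsFakeFlat
  quasiTrivializer : IsQuasiTrivializer C T
  exists_data : ∃ c : CocycleData 𝔢 E 𝔤 G EM M ι N, IsAssociated C A T c

/-- The internal functions `t i j` on `U i ∩ U j` realize an equivalence of the paracocycles
`(A, T)` and `(A', T')`: the local basic components of `A`, `A'` agree and `T' = T π^* t⁻¹`. -/
structure ParaEquivVia (C : TrivializingCover P ι N deg) (A : TwoConnection P N deg)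
    (T : ι → ι → MField P0 EP 𝔢 N E 𝔢) (A' : TwoConnection P N deg)
    (T' : ι → ι → MField P0 EP 𝔢 N E 𝔢) (t : ι → ι → MField M EM PUnit.{1} N E 𝔢) : Prop where
  eq_om : ∀ i p, P.π p ∈ C.U i → ∀ η, A'.omb (C.coord i) p η = A.omb (C.coord i) p η
  eq_Om : ∀ i p, P.π p ∈ C.U i → ∀ η, A'.Omb (C.coord i) p η = A.Omb (C.coord i) p η
  int_t : ∀ i j, IsMField deg (C.U i ∩ C.U j) (t i j)
  eq_T : ∀ i j p, P.π p ∈ C.U i ∩ C.U j → ∀ η,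
    T' i j p η = (T i j p η).mul (P.pullM (t i j) p η).inv

/-- Equivalence of differential paracocycles. -/
def ParaEquiv (C : TrivializingCover P ι N deg) (A : TwoConnection P N deg)
    (T : ι → ι → MField P0 EP 𝔢 N E 𝔢) (A' : TwoConnection P N deg)
    (T' : ι → ι → MField P0 EP 𝔢 N E 𝔢) : Prop := ∃ t, ParaEquivVia C A T A' T' t

/-- The internal functions `t i j` on `U i ∩ U j` realize an equivalence of the differential
cocycles with data `c` and `c'`. -/
structure CocycleEquivVia (C : TrivializingCover P ι N deg)
    (c c' : CocycleData 𝔢 E 𝔤 G EM M ι N) (t : ι → ι → MField M EM PUnit.{1} N E 𝔢) : Prop where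
  int_t : ∀ i j, IsMField deg (C.U i ∩ C.U j) (t i j)
  eq_om : ∀ i, ∀ x ∈ C.U i, ∀ w, c'.om i x w = c.om i x w
  eq_Om : ∀ i, ∀ x ∈ C.U i, ∀ w, c'.Om i x w = c.Om i x w
  eq_f : ∀ i j, ∀ x ∈ C.U i ∩ C.U j, ∀ w,
    c'.f i j x w = (cm.pτ (t i j x w)).mul (c.f i j x w)
  eq_F : ∀ i j, ∀ x ∈ C.U i ∩ C.U j, ∀ w,
    c'.F i j x w = (t i j x w).Ad (c.F i j x w)
      - cm.pdμ (c'.om i x w) (t i j x w) - logR extD (t i j) x w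
  eq_T : ∀ i j k, ∀ x ∈ C.U i ∩ C.U j ∩ C.U k, ∀ w,
    c'.T i j k x w = (((t i k x w).mul (c.T i j k x w)).mul
      (cm.pμ (c.f i j x w) (t j k x w).inv)).mul (t i j x w).inv

/-- Equivalence of differential cocycles (not involving 1-gauge transformations). -/
def CocycleEquiv (C : TrivializingCover P ι N deg)
    (c c' : CocycleData 𝔢 E 𝔤 G EM M ι N) : Prop := ∃ t, CocycleEquivVia C c c' t

end Bundle

end TwoBundle

end

/-!
The equations defining the local data of a paracocycle live on `T[1]P`, those to be proved live on
the base. Both sets are related by pullback along the projection, which is injective: a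
trivialization has the local section `x ↦ Ψ0 x 1`, so through every `x` passes a point `p` at which
`dπ` is onto (`LocalTriv.exists_surjective_tangentMapAt`), and substitution of odd generators along
an onto map is injective (`pullT_injective`, `pull_injective`). It remains to verify the pulled back
equations at such points, by comparing the two expressions of `f_b`, `F_b` and of
`T⁻¹ μ(f_b, T) T` in terms of the local data, with `T = T' π^* t`. This comparison is short algebra
(`ParaEquivVia.cocycleEquivVia`), provided that values of internal functions can be handled like
elements of ordinary groups and that `d` behaves as expected. These are the two substantial points.

*Algebra of values.* A value of an internal function in a manifold is a point together with an even
nilpotent displacement in a chart, and maps are evaluated by Taylor expansion. Taylor expansion is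
the exponential of commuting derivations; that it is multiplicative and compatible with composition
is proved formally, by the uniqueness of solutions of linear systems over polynomial rings
(`expSum_mul`, `expSum_comp`), applied to the commutative algebra of even elements, in which
elements without constant term are nilpotent (`soulIdeal_pow`). Thus evaluation is functorial
(`IsSoul.taylor_comp`, `eval_push`). As finitely many values are values at a common point of smooth
maps on one vector space (`exists_push₃`), every identity between maps of manifolds yields the
corresponding identity between values. In this way values in a Lie group form a group (`GPt`), and
the rules of the crossed module extend to them (`pdμ_mul`, `pμ_pτ`, …) and are compatible with
pullback. Evenness of the displacement is a consequence of degree `0`, as all generators have odd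
degree (`IsMField.good`).

*Calculus.* The de Rham field satisfies the chain rule (`extD_value`), whence the product rule
`d(TT') (TT')⁻¹ = dT T⁻¹ + Ad T (dT' T'⁻¹)` (`logR_mul`), and it commutes with pullback
(`lineDiffAt_pullField_and_extD`) because second derivatives are symmetric and covectors
anticommute; hence so does the logarithmic derivative (`logR_pullMField`).
-/

noncomputable section

set_option linter.unusedSectionVars false

namespace TwoBundle

/-! ### Exponentials of commuting derivations -/

section FormalTaylor

open Finset

variable {ι R S S' A : Type*} [Fintype ι]

/-- The `k`-th term of a formal Taylor expansion, without the factor `1 / k!`: the sum over all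
multi-indices of `c (∂_{i₁} ⋯ ∂_{i_k} f) ξ_{i₁} ⋯ ξ_{i_k}`. Here `R` plays the part of an algebra of
functions with partial derivatives `∂`, and `c` that of the evaluation at the base point. -/
def expTerm [NonUnitalNonAssocSemiring S] (d : ι → R → R) (c : R → S) (ξ : ι → S) : ℕ → R → S
  | 0, f => c f
  | k + 1, f => ∑ j, expTerm d c ξ k (d j f) * ξ j

/-- The formal Taylor expansion up to order `D`. -/
def expSum [Ring S] [Algebra ℝ S] (d : ι → R → R) (c : R → S) (ξ : ι → S) (D : ℕ) (f : R) : S :=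
  ∑ k ∈ range (D + 1), (k.factorial : ℝ)⁻¹ • expTerm d c ξ k f

lemma expTerm_map [Ring S] [Algebra ℝ S] [Ring S'] [Algebra ℝ S'] (d : ι → R → R) (c : R → S)
    (ξ : ι → S) (e : S →ₐ[ℝ] S') (k : ℕ) (f : R) :
    e (expTerm d c ξ k f) = expTerm d (fun g => e (c g)) (fun j => e (ξ j)) k f := by
  induction k generalizing f with
  | zero => rfl
  | succ k ih => simp [expTerm, ih]

lemma expSum_map [Ring S] [Algebra ℝ S] [Ring S'] [Algebra ℝ S'] (d : ι → R → R) (c : R → S)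
    (ξ : ι → S) (e : S →ₐ[ℝ] S') (D : ℕ) (f : R) :
    e (expSum d c ξ D f) = expSum d (fun g => e (c g)) (fun j => e (ξ j)) D f := by
  simp [expSum, expTerm_map]

section Derivation

variable [Ring S] [Algebra ℝ S] [Ring A] [Algebra ℝ A] (d : ι → R → R)
  (hd : ∀ i j f, d i (d j f) = d j (d i f)) (c : R → S) (ξ b : ι → S)
  (ev : S →ₐ[ℝ] A) (hev : ∀ s a, ev s * a = a * ev s)
  (δ : S →ₗ[ℝ] A) (hδ : ∀ s s', δ (s * s') = δ s * ev s' + ev s * δ s')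
  (hc : ∀ f, δ (c f) = ∑ j, ev (c (d j f)) * δ (b j))

include hd hev hδ hc in
/-- A derivation `δ` along `ev` which moves the base point by `δ b` acts on the terms of the Taylor
expansion through the base point and through the displacement `ξ`. -/
lemma derivation_expTerm (k : ℕ) (f : R) :
    δ (expTerm d c ξ (k + 1) f) = ∑ j, ev (expTerm d c ξ (k + 1) (d j f)) * δ (b j)
      + ((k : ℝ) + 1) • ∑ j, ev (expTerm d c ξ k (d j f)) * δ (ξ j) := by
  induction k generalizing f with
  | zero =>
    simp only [expTerm, map_sum, hδ, hc, sum_add_distrib, sum_mul, map_mul]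
    simp only [CharP.cast_eq_zero, zero_add, one_smul, add_left_inj]
    rw [sum_comm]
    refine sum_congr rfl fun i _ => sum_congr rfl fun j _ => ?_
    rw [hd i j, mul_assoc, mul_assoc, hev (ξ j)]
  | succ k ih =>
    rw [expTerm]
    simp only [map_sum, hδ, sum_add_distrib]
    simp_rw [ih]
    simp only [add_mul, sum_add_distrib, sum_mul, smul_mul_assoc]
    have e1 : ∑ x, ∑ i, ev (expTerm d c ξ (k + 1) (d i (d x f))) * δ (b i) * ev (ξ x)
        = ∑ j, ev (expTerm d c ξ (k + 1 + 1) (d j f)) * δ (b j) := by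
      rw [sum_comm]
      refine sum_congr rfl fun i _ => ?_
      rw [expTerm, map_sum, sum_mul]
      refine sum_congr rfl fun j _ => ?_
      rw [hd i j, map_mul, mul_assoc, mul_assoc, hev (ξ j)]
    have e2 : ∑ x, ((k : ℝ) + 1) • ∑ i, ev (expTerm d c ξ k (d i (d x f))) * δ (ξ i) * ev (ξ x)
        = ((k : ℝ) + 1) • ∑ j, ev (expTerm d c ξ (k + 1) (d j f)) * δ (ξ j) := by
      rw [← smul_sum, sum_comm]
      congr 1
      refine sum_congr rfl fun i _ => ?_
      rw [expTerm, map_sum, sum_mul]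
      refine sum_congr rfl fun j _ => ?_
      rw [hd i j, map_mul, mul_assoc, mul_assoc, hev (ξ j)]
    rw [e1, e2]
    push_cast
    rw [add_smul ((k : ℝ) + 1) 1, one_smul, add_assoc]

include hd hev hδ hc in
/-- The chain rule for formal Taylor expansions: a displacement of the base point by `b` and one
of `ξ` contribute alike. -/
lemma derivation_expSum (D : ℕ) (f : R) :
    δ (expSum d c ξ (D + 1) f) = ∑ j, ev (expSum d c ξ (D + 1) (d j f)) * δ (b j)
      + ∑ j, ev (expSum d c ξ D (d j f)) * δ (ξ j) := by
  have h1 : δ (expSum d c ξ (D + 1) f) = δ (c f) + ∑ k ∈ range (D + 1),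
      ((k + 1).factorial : ℝ)⁻¹ • δ (expTerm d c ξ (k + 1) f) := by
    rw [expSum, sum_range_succ', map_add, map_sum, add_comm]
    simp [expTerm]
  have h2 : ∀ g, ev (expSum d c ξ (D + 1) g) = ev (c g) + ∑ k ∈ range (D + 1),
      ((k + 1).factorial : ℝ)⁻¹ • ev (expTerm d c ξ (k + 1) g) := by
    intro g
    rw [expSum, sum_range_succ', map_add, map_sum, add_comm]
    simp [expTerm]
  rw [h1]
  simp_rw [h2, derivation_expTerm d hd c ξ b ev hev δ hδ hc]
  simp only [add_mul, sum_add_distrib, smul_add, hc, expSum, map_sum, sum_mul, map_smul,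
    smul_mul_assoc, smul_sum, add_assoc]
  congr 1
  congr 1
  · rw [sum_comm]
  · rw [sum_comm]
    refine sum_congr rfl fun j _ => sum_congr rfl fun k _ => ?_
    rw [smul_smul]
    congr 1
    rw [Nat.factorial_succ]
    push_cast
    field_simp

end Derivation

section Nilpotent

variable [CommRing S] [Algebra ℝ S] (d : ι → R → R) (c : R → S) {ξ : ι → S} {J : Ideal S} {D : ℕ}

omit [Algebra ℝ S] in
lemma expTerm_mem_pow (hξ : ∀ j, ξ j ∈ J) (k : ℕ) (f : R) : expTerm d c ξ k f ∈ J ^ k := by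
  induction k generalizing f with
  | zero => simp
  | succ k ih =>
    rw [expTerm, pow_succ]
    exact sum_mem fun j _ => Ideal.mul_mem_mul (ih _) (hξ j)

omit [Algebra ℝ S] in
lemma expTerm_eq_zero (hJ : J ^ (D + 1) = ⊥) (hξ : ∀ j, ξ j ∈ J) {k : ℕ} (hk : D < k) (f : R) :
    expTerm d c ξ k f = 0 := by
  have := Ideal.pow_le_pow_right (I := J) hk (expTerm_mem_pow d c hξ k f)
  rwa [hJ] at this

lemma expSum_eq_of_le (hJ : J ^ (D + 1) = ⊥) (hξ : ∀ j, ξ j ∈ J) {D' : ℕ} (h : D ≤ D') (f : R) :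
    expSum d c ξ D' f = expSum d c ξ D f := by
  rw [expSum, expSum]
  refine (sum_subset (range_subset_range.2 (by omega)) fun k _ hk => ?_).symm
  rw [expTerm_eq_zero d c hJ hξ (by simpa using hk), smul_zero]

lemma expSum_sub_mem (hξ : ∀ j, ξ j ∈ J) (f : R) : expSum d c ξ D f - c f ∈ J := by
  rw [expSum, sum_range_succ']
  simp only [Nat.factorial_zero, Nat.cast_one, inv_one, one_smul, expTerm.eq_1,
    add_sub_cancel_right]
  exact sum_mem fun k _ => Submodule.smul_of_tower_mem J _
    (Ideal.pow_le_self (Nat.succ_ne_zero k) (expTerm_mem_pow d c hξ (k + 1) f))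

end Nilpotent

section Polynomial

open Polynomial

variable {B : Type*} [CommRing B] [Algebra ℝ B]

/-- A formal version of the uniqueness of solutions of a linear system of differential equations:
polynomials with zero initial value whose derivatives are combinations of them vanish. -/
lemma polynomial_eq_zero_of_derivative_mem {κ : Type*} (Δ : κ → B[X])
    (h0 : ∀ i, (Δ i).coeff 0 = 0) (h : ∀ i, derivative (Δ i) ∈ Ideal.span (Set.range Δ)) (i : κ) :
    Δ i = 0 := by
  have key : ∀ n : ℕ, ∀ i, (X : B[X]) ^ n ∣ Δ i := by
    intro n
    induction n with
    | zero => simp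
    | succ n ih =>
      intro i
      rw [X_pow_dvd_iff]
      rintro (_ | m) hm
      · exact h0 i
      · have hdvd : (X : B[X]) ^ n ∣ derivative (Δ i) := by
          rw [← Ideal.mem_span_singleton]
          refine (Ideal.span_le.2 ?_) (h i)
          rintro _ ⟨j, rfl⟩
          exact Ideal.mem_span_singleton.2 (ih j)
        have h1 := (X_pow_dvd_iff.1 hdvd) m (by omega)
        rw [coeff_derivative] at h1
        have h2 : ((m : ℝ) + 1) • (Δ i).coeff (m + 1) = 0 := by
          rw [Algebra.smul_def, mul_comm]
          simpa using h1
        exact (smul_eq_zero_iff_right (M := B) (by positivity : (m : ℝ) + 1 ≠ 0)).1 h2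
  ext n
  simpa using X_pow_dvd_iff.1 (key (n + 1) i) n (by omega)

variable [CommRing R] [Algebra ℝ R] (d : ι → Derivation ℝ R R)
  (hd : ∀ i j f, d i (d j f) = d j (d i f)) (c : R →ₐ[ℝ] B) {ξ : ι → B} {J : Ideal B} {D : ℕ}

/-- The formal Taylor expansion along the segment `s ↦ s ξ`. -/
def expPoly (ξ : ι → B) (D : ℕ) (f : R) : B[X] :=
  expSum (fun j => d j) (fun g => C (c g)) (fun j => C (ξ j) * X) D f

omit [Algebra ℝ B] in
lemma pow_map_C (hJ : J ^ (D + 1) = ⊥) : (J.map (C : B →+* B[X])) ^ (D + 1) = ⊥ := by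
  rw [← Ideal.map_pow, hJ, Ideal.map_bot]

omit [Fintype ι] [Algebra ℝ B] in
lemma C_mul_X_mem (hξ : ∀ j, ξ j ∈ J) (j : ι) : C (ξ j) * X ∈ J.map (C : B →+* B[X]) :=
  Ideal.mul_mem_right _ _ (Ideal.mem_map_of_mem _ (hξ j))

include hd in
lemma derivative_expPoly (hJ : J ^ (D + 1) = ⊥) (hξ : ∀ j, ξ j ∈ J) (f : R) :
    derivative (expPoly d c ξ D f) = ∑ j, expPoly d c ξ D (d j f) * C (ξ j) := by
  have hle := fun g => expSum_eq_of_le (fun j => d j) (fun g => C (c g)) (pow_map_C hJ)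
    (C_mul_X_mem hξ) (Nat.le_succ D) g
  have := derivation_expSum (S := B[X]) (A := B[X]) (fun j => d j) hd (fun g => C (c g))
    (fun j => C (ξ j) * X) (fun _ => 0) (AlgHom.id ℝ _) (fun s a => mul_comm _ _)
    (derivative.restrictScalars ℝ) (fun s s' => by simp [derivative_mul]) (fun f => by simp) D f
  simp only [hle, LinearMap.coe_restrictScalars] at this
  rw [expPoly, this]
  simp [expPoly]

lemma coeff_zero_expPoly (f : R) : (expPoly d c ξ D f).coeff 0 = c f := by
  rw [coeff_zero_eq_eval_zero]
  have := expSum_map (fun j => d j) (fun g => C (c g)) (fun j => C (ξ j) * X)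
    ((aeval (0 : B)).restrictScalars ℝ : B[X] →ₐ[ℝ] B) D f
  simp only [AlgHom.coe_restrictScalars', coe_aeval_eq_eval] at this
  rw [expPoly, this, expSum, sum_range_succ']
  simp [expTerm]

lemma eval_one_expPoly (f : R) : (expPoly d c ξ D f).eval 1 = expSum (fun j => d j) c ξ D f := by
  have := expSum_map (fun j => d j) (fun g => C (c g)) (fun j => C (ξ j) * X)
    ((aeval (1 : B)).restrictScalars ℝ : B[X] →ₐ[ℝ] B) D f
  simp only [AlgHom.coe_restrictScalars', coe_aeval_eq_eval] at this
  rw [expPoly, this]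
  simp

lemma expTerm_add {S : Type*} [CommRing S] [Algebra ℝ S] (e : R →ₐ[ℝ] S) (ζ : ι → S) (k : ℕ)
    (f g : R) : expTerm (fun j => d j) e ζ k (f + g)
      = expTerm (fun j => d j) e ζ k f + expTerm (fun j => d j) e ζ k g := by
  induction k generalizing f g with
  | zero => simp [expTerm]
  | succ k ih => simp [expTerm, ih, add_mul, sum_add_distrib]

lemma expPoly_add (f g : R) :
    expPoly d c ξ D (f + g) = expPoly d c ξ D f + expPoly d c ξ D g := by
  have := expTerm_add d ((CAlgHom (R := ℝ) (A := B)).comp c) (fun j => C (ξ j) * X)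
  simp only [AlgHom.coe_comp, Function.comp_def, CAlgHom_apply] at this
  simp [expPoly, expSum, this, sum_add_distrib]

lemma expPoly_sum {κ : Type*} (s : Finset κ) (f : κ → R) :
    expPoly d c ξ D (∑ k ∈ s, f k) = ∑ k ∈ s, expPoly d c ξ D (f k) :=
  map_sum (AddMonoidHom.mk' (expPoly d c ξ D) (expPoly_add d c)) f s

include hd in
lemma expPoly_mul (hJ : J ^ (D + 1) = ⊥) (hξ : ∀ j, ξ j ∈ J) (f g : R) :
    expPoly d c ξ D (f * g) = expPoly d c ξ D f * expPoly d c ξ D g := by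
  -- both sides solve the same linear system along the segment `s ↦ s ξ`
  let Δ : R × R → B[X] := fun p =>
    expPoly d c ξ D (p.1 * p.2) - expPoly d c ξ D p.1 * expPoly d c ξ D p.2
  have h := polynomial_eq_zero_of_derivative_mem Δ (fun p => ?_) (fun p => ?_) (f, g)
  · exact sub_eq_zero.1 h
  · simp [Δ, mul_coeff_zero, coeff_zero_expPoly]
  · have : derivative (Δ p) = ∑ j, (Δ (d j p.1, p.2) + Δ (p.1, d j p.2)) * C (ξ j) := by
      simp only [Δ, map_sub, derivative_mul, derivative_expPoly d hd c hJ hξ, Derivation.leibniz,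
        smul_eq_mul, expPoly_add, sum_mul, mul_sum, ← sum_sub_distrib, ← sum_add_distrib]
      refine sum_congr rfl fun j _ => ?_
      rw [mul_comm p.2 (d j p.1)]
      ring
    rw [this]
    exact sum_mem fun j _ => Ideal.mul_mem_right _ _ (add_mem
      (Ideal.subset_span ⟨_, rfl⟩) (Ideal.subset_span ⟨_, rfl⟩))

include hd in
/-- The formal Taylor expansion is multiplicative. -/
lemma expSum_mul (hJ : J ^ (D + 1) = ⊥) (hξ : ∀ j, ξ j ∈ J) (f g : R) :
    expSum (fun j => d j) c ξ D (f * g)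
      = expSum (fun j => d j) c ξ D f * expSum (fun j => d j) c ξ D g := by
  simp only [← eval_one_expPoly, expPoly_mul d hd c hJ hξ, eval_mul]

include hd in
/-- Formal Taylor expansions compose. The homomorphism `ψ` is the pull-back along a map whose
components are the `x m`. -/
lemma expSum_comp {κ R' : Type*} [Fintype κ] [CommRing R'] [Algebra ℝ R']
    (d' : κ → Derivation ℝ R' R') (hd' : ∀ i j f, d' i (d' j f) = d' j (d' i f))
    (ψ : R' →ₐ[ℝ] R) (x : κ → R)
    (hψ : ∀ j f, d j (ψ f) = ∑ m, ψ (d' m f) * d j (x m))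
    (hJ : J ^ (D + 1) = ⊥) (hξ : ∀ j, ξ j ∈ J) (f : R') :
    expSum (fun m => d' m) (fun g => c (ψ g))
      (fun m => expSum (fun j => d j) c ξ D (x m) - c (x m)) D f
      = expSum (fun j => d j) c ξ D (ψ f) := by
  -- both sides, along the segment `s ↦ s ξ`, solve the same linear system in `s`
  let H : R → B[X] := expPoly d c ξ D
  let ζ : κ → B[X] := fun m => H (x m) - C (c (x m))
  let K : R' → B[X] := expSum (fun m => d' m) (fun g => C (c (ψ g))) ζ D
  have hζ : ∀ m, ζ m ∈ J.map (C : B →+* B[X]) := fun m =>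
    expSum_sub_mem (fun j => d j) (fun g => C (c g)) (C_mul_X_mem hξ) (x m)
  have hle := fun g => expSum_eq_of_le (fun m => d' m) (fun g => C (c (ψ g))) (pow_map_C hJ)
    hζ (Nat.le_succ D) g
  have hK : ∀ f, derivative (K f) = ∑ m, K (d' m f) * derivative (H (x m)) := by
    intro f
    have := derivation_expSum (S := B[X]) (A := B[X]) (fun m => d' m) hd' (fun g => C (c (ψ g)))
      ζ (fun _ => 0) (AlgHom.id ℝ _) (fun s a => mul_comm _ _)
      (derivative.restrictScalars ℝ) (fun s s' => by simp [derivative_mul]) (fun f => by simp) D f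
    simp only [hle, LinearMap.coe_restrictScalars] at this
    change derivative (expSum _ _ _ D f) = _
    rw [this]
    simp [K, ζ]
  have hK0 : ∀ f, (K f).coeff 0 = c (ψ f) := by
    intro f
    rw [coeff_zero_eq_eval_zero]
    have := expSum_map (fun m => d' m) (fun g => C (c (ψ g))) ζ
      ((aeval (0 : B)).restrictScalars ℝ : B[X] →ₐ[ℝ] B) D f
    simp only [AlgHom.coe_restrictScalars', coe_aeval_eq_eval] at this
    have hz : ∀ m, (ζ m).eval 0 = 0 := fun m => by
      simp [ζ, H, ← coeff_zero_eq_eval_zero, coeff_zero_expPoly]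
    rw [this, expSum, sum_range_succ']
    simp [expTerm, hz]
  let Δ : R' → B[X] := fun f => H (ψ f) - K f
  have h := polynomial_eq_zero_of_derivative_mem Δ (fun f => ?_) (fun f => ?_) f
  · have h1 : (K f).eval 1 = (H (ψ f)).eval 1 := by rw [sub_eq_zero.1 h]
    rw [eval_one_expPoly] at h1
    rw [← h1]
    have := expSum_map (fun m => d' m) (fun g => C (c (ψ g))) ζ
      ((aeval (1 : B)).restrictScalars ℝ : B[X] →ₐ[ℝ] B) D f
    simp only [AlgHom.coe_restrictScalars', coe_aeval_eq_eval] at this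
    rw [this]
    simp [ζ, H, eval_one_expPoly]
  · simp [Δ, H, hK0, coeff_zero_expPoly]
  · have : derivative (Δ f) = ∑ m, Δ (d' m f) * derivative (H (x m)) := by
      simp only [Δ, map_sub, hK, H, derivative_expPoly d hd c hJ hξ, hψ, expPoly_sum,
        expPoly_mul d hd c hJ hξ, sub_mul, sum_sub_distrib, mul_sum, sum_mul]
      congr 1
      rw [sum_comm]
      simp only [mul_assoc]
    rw [this]
    exact sum_mem fun j _ => Ideal.mul_mem_right _ _ (Ideal.subset_span ⟨_, rfl⟩)

end Polynomial

end FormalTaylor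

/-! ### The even part of an exterior algebra -/

section Exterior

open ExteriorAlgebra

variable {M : Type*} [AddCommGroup M] [Module ℝ M]

/-- The grade involution. -/
def parity : ExteriorAlgebra ℝ M →ₐ[ℝ] ExteriorAlgebra ℝ M := ExteriorAlgebra.map (-LinearMap.id)

@[simp] lemma parity_ι (m : M) : parity (ι ℝ m) = -ι ℝ m := by simp [parity]

lemma ι_mul_eq_parity_mul_ι (m : M) (x : ExteriorAlgebra ℝ M) :
    ι ℝ m * x = parity x * ι ℝ m := by
  induction x using ExteriorAlgebra.induction with
  | algebraMap r => rw [AlgHom.commutes]; exact (Algebra.commutes r _).symm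
  | ι v =>
    rw [parity_ι, neg_mul]
    exact eq_neg_of_add_eq_zero_left (ι_add_mul_swap m v)
  | mul a b ha hb => rw [← mul_assoc, ha, mul_assoc, hb, ← mul_assoc, map_mul]
  | add a b ha hb => rw [mul_add, ha, hb, map_add, add_mul]

variable (M) in
/-- The even part: the fixed points of the grade involution. -/
def evenPart : Subalgebra ℝ (ExteriorAlgebra ℝ M) := AlgHom.equalizer parity (AlgHom.id ℝ _)

lemma mem_evenPart {x : ExteriorAlgebra ℝ M} : x ∈ evenPart M ↔ parity x = x := Iff.rfl

lemma evenPart_central {x : ExteriorAlgebra ℝ M} (hx : x ∈ evenPart M)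
    (y : ExteriorAlgebra ℝ M) : x * y = y * x := by
  induction y using ExteriorAlgebra.induction with
  | algebraMap r => exact (Algebra.commutes r _).symm
  | ι v => rw [ι_mul_eq_parity_mul_ι, mem_evenPart.1 hx]
  | mul a b ha hb => rw [← mul_assoc, ha, mul_assoc, hb, ← mul_assoc]
  | add a b ha hb => rw [mul_add, ha, hb, add_mul]

/-- The even part as a commutative ring, in which Taylor expansions take their values. -/
def Ev (M : Type*) [AddCommGroup M] [Module ℝ M] : Type _ := evenPart M

instance : CommRing (Ev M) :=
  { (inferInstance : Ring (evenPart M)) with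
    mul_comm := fun a b => Subtype.ext (evenPart_central a.2 b.1) }

instance : Algebra ℝ (Ev M) := inferInstanceAs (Algebra ℝ (evenPart M))

variable (M) in
/-- The inclusion of the even part. -/
def Ev.incl : Ev M →ₐ[ℝ] ExteriorAlgebra ℝ M := (evenPart M).val

lemma Ev.incl_mem (a : Ev M) : Ev.incl M a ∈ evenPart M := Subtype.prop a

lemma Ev.incl_injective : Function.Injective (Ev.incl M) := Subtype.val_injective

lemma Ev.incl_central (a : Ev M) (y : ExteriorAlgebra ℝ M) :
    Ev.incl M a * y = y * Ev.incl M a := evenPart_central a.incl_mem y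

/-- An even element, as an element of the commutative ring of even elements. -/
def Ev.mk (a : ExteriorAlgebra ℝ M) (ha : a ∈ evenPart M) : Ev M := ⟨a, ha⟩

/-- The even elements without constant term. -/
def soulIdeal (M : Type*) [AddCommGroup M] [Module ℝ M] : Ideal (Ev M) :=
  RingHom.ker ((algebraMapInv (R := ℝ) (M := M)).comp (Ev.incl M))

lemma mem_soulIdeal {a : Ev M} : a ∈ soulIdeal M ↔ algebraMapInv (Ev.incl M a) = (0 : ℝ) := Iff.rfl

/-- The span of the products of at least `k` generators. -/
def filt (M : Type*) [AddCommGroup M] [Module ℝ M] (k : ℕ) :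
    Submodule ℝ (ExteriorAlgebra ℝ M) :=
  Submodule.span ℝ {x | ∃ l : List M, k ≤ l.length ∧ (l.map (ι ℝ)).prod = x}

lemma mul_mem_filt {k l : ℕ} {x y : ExteriorAlgebra ℝ M} (hx : x ∈ filt M k) (hy : y ∈ filt M l) :
    x * y ∈ filt M (k + l) := by
  have h := Submodule.mul_mem_mul hx hy
  rw [filt, filt, Submodule.span_mul_span] at h
  refine Submodule.span_mono ?_ h
  rintro _ ⟨_, ⟨a, ha, rfl⟩, _, ⟨b, hb, rfl⟩, rfl⟩
  exact ⟨a ++ b, by simp; omega, by simp⟩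

lemma mem_filt_zero (x : ExteriorAlgebra ℝ M) : x ∈ filt M 0 := by
  induction x using ExteriorAlgebra.induction with
  | algebraMap r =>
    rw [Algebra.algebraMap_eq_smul_one]
    exact Submodule.smul_mem _ _ (Submodule.subset_span ⟨[], by simp, by simp⟩)
  | ι v => exact Submodule.subset_span ⟨[v], by simp, by simp⟩
  | mul a b ha hb => simpa only [add_zero] using mul_mem_filt ha hb
  | add a b ha hb => exact Submodule.add_mem (filt M 0) ha hb

lemma sub_algebraMapInv_mem_filt (x : ExteriorAlgebra ℝ M) :
    x - algebraMap ℝ _ (algebraMapInv x) ∈ filt M 1 := by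
  induction x using ExteriorAlgebra.induction with
  | algebraMap r => simp
  | ι v =>
    have : algebraMapInv (ι ℝ v) = (0 : ℝ) := by simp [algebraMapInv]
    rw [this, map_zero, sub_zero]
    exact Submodule.subset_span ⟨[v], by simp, by simp⟩
  | mul a b ha hb =>
    have : a * b - algebraMap ℝ _ (algebraMapInv (a * b))
        = (a - algebraMap ℝ _ (algebraMapInv a)) * b
          + algebraMap ℝ _ (algebraMapInv a) * (b - algebraMap ℝ _ (algebraMapInv b)) := by
      rw [map_mul, map_mul]
      noncomm_ring
    rw [this]
    exact Submodule.add_mem (filt M 1)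
      (by simpa only [add_zero] using mul_mem_filt ha (mem_filt_zero b))
      (by simpa only [zero_add] using mul_mem_filt (mem_filt_zero _) hb)
  | add a b ha hb =>
    rw [map_add, map_add, add_sub_add_comm]
    exact Submodule.add_mem (filt M 1) ha hb

lemma filt_eq_bot [FiniteDimensional ℝ M] {k : ℕ} (hk : Module.finrank ℝ M < k) :
    filt M k = ⊥ := by
  rw [filt, Submodule.span_eq_bot]
  rintro _ ⟨l, hl, rfl⟩
  have h1 : (l.map (ι ℝ)).prod = ιMulti ℝ l.length l.get := by
    rw [ιMulti_apply]
    congr 1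
    rw [List.ofFn_comp' l.get (ι ℝ), List.ofFn_get]
  rw [h1]
  refine AlternatingMap.map_linearDependent _ _ fun hli => ?_
  have := hli.fintype_card_le_finrank
  simp at this
  omega

/-- Even elements without constant term are nilpotent of uniform order: products of more than
`dim M` generators vanish. -/
lemma soulIdeal_pow [FiniteDimensional ℝ M] {D : ℕ} (hD : Module.finrank ℝ M ≤ D) :
    soulIdeal M ^ (D + 1) = ⊥ := by
  have key : ∀ k, ∀ x ∈ soulIdeal M ^ k, Ev.incl M x ∈ filt M k := by
    intro k
    induction k with
    | zero => exact fun x _ => mem_filt_zero _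
    | succ k ih =>
      intro x hx
      rw [pow_succ] at hx
      refine Submodule.mul_induction_on hx (fun a ha b hb => ?_) (fun a b ha hb => ?_)
      swap
      · rw [map_add]
        exact Submodule.add_mem _ ha hb
      rw [map_mul]
      refine mul_mem_filt (ih a ha) ?_
      simpa [mem_soulIdeal.1 hb] using sub_algebraMapInv_mem_filt (Ev.incl M b)
  rw [eq_bot_iff]
  intro x hx
  have := key _ x hx
  rw [filt_eq_bot (by omega)] at this
  exact Ev.incl_injective (this.trans (map_zero _).symm)

/-- The odd derivation defined by a linear form on the generators. -/
def contr (c : Module.Dual ℝ M) : ExteriorAlgebra ℝ M →ₗ[ℝ] ExteriorAlgebra ℝ M :=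
  CliffordAlgebra.contractLeft (Q := (0 : QuadraticForm ℝ M)) c

lemma contr_ι_mul (c : Module.Dual ℝ M) (m : M) (x : ExteriorAlgebra ℝ M) :
    contr c (ι ℝ m * x) = c m • x - ι ℝ m * contr c x :=
  CliffordAlgebra.contractLeft_ι_mul _ _ _

lemma contr_algebraMap (c : Module.Dual ℝ M) (r : ℝ) : contr c (algebraMap ℝ _ r) = 0 :=
  CliffordAlgebra.contractLeft_algebraMap _ _ _

/-- Induction on elements of an exterior algebra by multiplication with generators on the left. -/
lemma exterior_left_induction {C : ExteriorAlgebra ℝ M → Prop}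
    (h0 : ∀ r, C (algebraMap ℝ _ r)) (hadd : ∀ x y, C x → C y → C (x + y))
    (hmul : ∀ x m, C x → C (ι ℝ m * x)) (x : ExteriorAlgebra ℝ M) : C x :=
  CliffordAlgebra.left_induction (Q := (0 : QuadraticForm ℝ M)) h0 hadd hmul x

/-- The graded Leibniz rule. -/
lemma contr_mul (c : Module.Dual ℝ M) (x y : ExteriorAlgebra ℝ M) :
    contr c (x * y) = contr c x * y + parity x * contr c y := by
  induction x using exterior_left_induction with
  | h0 r =>
    rw [contr_algebraMap, AlgHom.commutes, ← Algebra.smul_def, map_smul, Algebra.smul_def, zero_mul,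
      zero_add]
  | hadd a b ha hb => simp only [add_mul, map_add, ha, hb]; abel
  | hmul a m ha =>
    rw [mul_assoc, contr_ι_mul, ha, contr_ι_mul, map_mul, parity_ι]
    simp only [sub_mul, mul_add, smul_mul_assoc, neg_mul, mul_assoc]
    abel

lemma contr_map {M' : Type*} [AddCommGroup M'] [Module ℝ M'] (f : M →ₗ[ℝ] M')
    (c : Module.Dual ℝ M') (x : ExteriorAlgebra ℝ M) :
    contr c (ExteriorAlgebra.map f x) = ExteriorAlgebra.map f (contr (c ∘ₗ f) x) := by
  induction x using exterior_left_induction with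
  | h0 r => simp only [AlgHom.commutes, contr_algebraMap, map_zero]
  | hadd a b ha hb => simp only [map_add, ha, hb]
  | hmul a m ha => simp [contr_ι_mul, ha]

lemma map_mem_evenPart {M' : Type*} [AddCommGroup M'] [Module ℝ M'] (f : M →ₗ[ℝ] M')
    {x : ExteriorAlgebra ℝ M} (hx : x ∈ evenPart M) : ExteriorAlgebra.map f x ∈ evenPart M' := by
  have h : parity.comp (ExteriorAlgebra.map f) = (ExteriorAlgebra.map f).comp parity := by
    ext; simp
  have := DFunLike.congr_fun h x
  simp only [AlgHom.comp_apply, mem_evenPart.1 hx] at this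
  exact this

@[simp] lemma algebraMapInv_map {M' : Type*} [AddCommGroup M'] [Module ℝ M'] (f : M →ₗ[ℝ] M')
    (x : ExteriorAlgebra ℝ M) :
    algebraMapInv (ExteriorAlgebra.map f x) = (algebraMapInv x : ℝ) := by
  have h : (algebraMapInv : _ →ₐ[ℝ] ℝ).comp (ExteriorAlgebra.map f) = algebraMapInv := by
    ext; simp [algebraMapInv]
  exact DFunLike.congr_fun h x

end Exterior

/-! ### Components of algebra valued vectors -/

section Components

variable {W W' A A' : Type*} [AddCommGroup W] [Module ℝ W] [AddCommGroup W'] [Module ℝ W']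
  [Ring A] [Algebra ℝ A] [Ring A'] [Algebra ℝ A']

/-- The component of an `A`-valued vector along a linear form. -/
def comp (l : Module.Dual ℝ W) : W ⊗[ℝ] A →ₗ[ℝ] A :=
  (TensorProduct.lid ℝ A).toLinearMap ∘ₗ LinearMap.rTensor A l

@[simp] lemma comp_tmul (l : Module.Dual ℝ W) (w : W) (a : A) : comp l (w ⊗ₜ[ℝ] a) = l w • a := by
  simp [comp]

lemma eq_sum_comp {κ : Type*} [Fintype κ] (b : Module.Basis κ ℝ W) (u : W ⊗[ℝ] A) :
    u = ∑ j, b j ⊗ₜ[ℝ] comp (b.coord j) u := by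
  induction u using TensorProduct.induction_on with
  | zero => simp
  | tmul w a =>
    simp only [comp_tmul, ← TensorProduct.smul_tmul, ← TensorProduct.sum_tmul]
    rw [show ∑ j, b.coord j w • b j = w from b.sum_repr w]
  | add x y hx hy =>
    conv_lhs => rw [hx, hy]
    simp [TensorProduct.tmul_add, Finset.sum_add_distrib]

lemma ext_comp [FiniteDimensional ℝ W] {u v : W ⊗[ℝ] A}
    (h : ∀ l : Module.Dual ℝ W, comp l u = comp l v) : u = v := by
  rw [eq_sum_comp (Module.finBasis ℝ W) u, eq_sum_comp (Module.finBasis ℝ W) v]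
  simp [h]

lemma comp_lTensor (α : A →ₗ[ℝ] A') (l : Module.Dual ℝ W) (u : W ⊗[ℝ] A) :
    comp l (LinearMap.lTensor W α u) = α (comp l u) := by
  induction u using TensorProduct.induction_on with
  | zero => simp
  | tmul w a => simp
  | add x y hx hy => simp [hx, hy]

lemma comp_lin (L : W →ₗ[ℝ] W') (l : Module.Dual ℝ W') (u : W ⊗[ℝ] A) :
    comp l (lin L u) = comp (l ∘ₗ L) u := by
  induction u using TensorProduct.induction_on with
  | zero => simp [lin]
  | tmul w a => simp [lin]
  | add x y hx hy =>
    have : lin L (x + y) = lin L x + lin L y := map_add (LinearMap.rTensor A L) x y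
    simp [this, hx, hy]

lemma comp_eq_sum {κ : Type*} [Fintype κ] (b : Module.Basis κ ℝ W) (l : Module.Dual ℝ W)
    (u : W ⊗[ℝ] A) : comp l u = ∑ j, l (b j) • comp (b.coord j) u := by
  conv_lhs => rw [eq_sum_comp b u]
  simp

end Components

section ComponentsNormed

variable {V W A A' : Type*} [NormedAddCommGroup V] [NormedSpace ℝ V]
  [NormedAddCommGroup W] [NormedSpace ℝ W] [Ring A] [Algebra ℝ A] [Ring A'] [Algebra ℝ A']

lemma app_add (L : (V →L[ℝ] W) ⊗[ℝ] A) (u v : V ⊗[ℝ] A) : app L (u + v) = app L u + app L v :=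
  map_add _ _ _

lemma app_sub (L : (V →L[ℝ] W) ⊗[ℝ] A) (u v : V ⊗[ℝ] A) : app L (u - v) = app L u - app L v :=
  map_sub _ _ _

@[simp] lemma app_zero (L : (V →L[ℝ] W) ⊗[ℝ] A) : app L 0 = 0 := map_zero _

lemma add_app (L L' : (V →L[ℝ] W) ⊗[ℝ] A) (u : V ⊗[ℝ] A) :
    app (L + L') u = app L u + app L' u := by
  simp [app, bil]

@[simp] lemma app_tmul (L : V →L[ℝ] W) (v : V) (a a' : A) :
    app (L ⊗ₜ[ℝ] a) (v ⊗ₜ[ℝ] a') = L v ⊗ₜ (a * a') := by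
  simp [app, bil]

/-- The linear form `L ↦ l (L v)`. -/
def evalForm (l : Module.Dual ℝ W) (v : V) : Module.Dual ℝ (V →L[ℝ] W) :=
  l ∘ₗ (LinearMap.applyₗ v : (V →ₗ[ℝ] W) →ₗ[ℝ] W) ∘ₗ ContinuousLinearMap.coeLM ℝ

@[simp] lemma evalForm_apply (l : Module.Dual ℝ W) (v : V) (L : V →L[ℝ] W) :
    evalForm l v L = l (L v) := rfl

lemma comp_app {κ : Type*} [Fintype κ] (b : Module.Basis κ ℝ V) (l : Module.Dual ℝ W)
    (L : (V →L[ℝ] W) ⊗[ℝ] A) (v : V ⊗[ℝ] A) :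
    comp l (app L v) = ∑ j, comp (evalForm l (b j)) L * comp (b.coord j) v := by
  induction L using TensorProduct.induction_on with
  | zero => simp [app, bil]
  | add x y hx hy => simp [add_app, hx, hy, add_mul, Finset.sum_add_distrib]
  | tmul L a =>
    induction v using TensorProduct.induction_on with
    | zero => simp
    | add x y hx hy => simp [app_add, hx, hy, mul_add, Finset.sum_add_distrib]
    | tmul v a' =>
      simp only [app_tmul, comp_tmul, evalForm_apply, smul_mul_smul_comm, ← Finset.sum_smul]
      congr 1
      conv_lhs => rw [← b.sum_repr v]
      simp only [map_sum, map_smul, smul_eq_mul, Module.Basis.coord_apply]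
      exact Finset.sum_congr rfl fun _ _ => mul_comm _ _

lemma lTensor_app (α : A →ₐ[ℝ] A') (L : (V →L[ℝ] W) ⊗[ℝ] A) (v : V ⊗[ℝ] A) :
    LinearMap.lTensor W α.toLinearMap (app L v)
      = app (LinearMap.lTensor _ α.toLinearMap L) (LinearMap.lTensor V α.toLinearMap v) := by
  induction L using TensorProduct.induction_on with
  | zero => simp [app, bil]
  | add x y hx hy => simp [add_app, hx, hy]
  | tmul L a =>
    induction v using TensorProduct.induction_on with
    | zero => simp
    | add x y hx hy => simp only [app_add, map_add, hx, hy]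
    | tmul v a' => simp

end ComponentsNormed

/-! ### Smooth functions and their Taylor expansions -/

section Smooth

variable (Y : Type*) [NormedAddCommGroup Y] [NormedSpace ℝ Y]

/-- The subalgebra of smooth functions on a vector space. -/
def smoothSubalgebra : Subalgebra ℝ (Y → ℝ) where
  carrier := {f | ContDiff ℝ ∞ f}
  mul_mem' {f g} (hf : ContDiff ℝ ∞ f) (hg : ContDiff ℝ ∞ g) := ContDiff.mul hf hg
  add_mem' {f g} (hf : ContDiff ℝ ∞ f) (hg : ContDiff ℝ ∞ g) := ContDiff.add hf hg
  algebraMap_mem' r := (contDiff_const : ContDiff ℝ ∞ fun _ : Y => r)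

/-- The commutative algebra of smooth functions on a vector space. -/
def SF : Type _ := smoothSubalgebra Y

instance : CommRing (SF Y) := inferInstanceAs (CommRing (smoothSubalgebra Y))

instance : Algebra ℝ (SF Y) := inferInstanceAs (Algebra ℝ (smoothSubalgebra Y))

variable {Y}

/-- The evaluation of smooth functions at a point. -/
def SF.evalAt (y : Y) : SF Y →ₐ[ℝ] ℝ :=
  (Pi.evalAlgHom ℝ (fun _ : Y => ℝ) y).comp (smoothSubalgebra Y).val

/-- The function underlying an element of the algebra of smooth functions. -/
def SF.fn (f : SF Y) (y : Y) : ℝ := SF.evalAt y f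

/-- A smooth function, as an element of the algebra of smooth functions. -/
def SF.mk (f : Y → ℝ) (hf : ContDiff ℝ ∞ f) : SF Y := ⟨f, hf⟩

@[simp] lemma SF.fn_mk (f : Y → ℝ) (hf : ContDiff ℝ ∞ f) (y : Y) : (SF.mk f hf).fn y = f y := rfl

lemma SF.ext {f g : SF Y} (h : ∀ y, f.fn y = g.fn y) : f = g := Subtype.ext (funext h)

@[simp] lemma SF.fn_add (f g : SF Y) (y : Y) : (f + g).fn y = f.fn y + g.fn y := map_add _ _ _

@[simp] lemma SF.fn_mul (f g : SF Y) (y : Y) : (f * g).fn y = f.fn y * g.fn y := map_mul _ _ _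

@[simp] lemma SF.fn_smul (r : ℝ) (f : SF Y) (y : Y) : (r • f).fn y = r * f.fn y :=
  map_smul (SF.evalAt y) r f

@[simp] lemma SF.fn_sum {κ : Type*} (s : Finset κ) (f : κ → SF Y) (y : Y) :
    (∑ k ∈ s, f k).fn y = ∑ k ∈ s, (f k).fn y := map_sum (SF.evalAt y) _ _

lemma SF.contDiff (f : SF Y) : ContDiff ℝ ∞ f.fn := f.2

lemma SF.differentiable (f : SF Y) : Differentiable ℝ f.fn :=
  f.contDiff.differentiable (by simp)

/-- The directional derivative as a derivation of the algebra of smooth functions. -/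
def SF.pd (v : Y) : Derivation ℝ (SF Y) (SF Y) :=
  Derivation.mk'
    { toFun := fun f => SF.mk (fun y => fderiv ℝ f.fn y v)
        ((f.contDiff.fderiv_right (m := ∞) (by simp)).clm_apply contDiff_const)
      map_add' := fun f g => SF.ext fun y => by
        have : (f + g).fn = f.fn + g.fn := funext fun y => SF.fn_add f g y
        simp [this, fderiv_add (f.differentiable y) (g.differentiable y)]
      map_smul' := fun r f => SF.ext fun y => by
        have : (r • f).fn = r • f.fn := funext fun y => SF.fn_smul r f y
        simp [this, fderiv_const_smul (f.differentiable y) r] }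
    (fun f g => SF.ext fun y => by
      have : (f * g).fn = f.fn * g.fn := funext fun y => SF.fn_mul f g y
      simp [this, fderiv_mul (f.differentiable y) (g.differentiable y)])

lemma SF.pd_apply (v : Y) (f : SF Y) (y : Y) : (SF.pd v f).fn y = fderiv ℝ f.fn y v := rfl

lemma SF.pd_comm (v w : Y) (f : SF Y) : SF.pd v (SF.pd w f) = SF.pd w (SF.pd v f) := by
  apply SF.ext
  intro y
  have hs : IsSymmSndFDerivAt ℝ f.fn y :=
    f.contDiff.contDiffAt.isSymmSndFDerivAt
      (by
          rw [minSmoothness_of_isRCLikeNormedField]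
          exact WithTop.coe_le_coe.2 (le_top : (2 : ℕ∞) ≤ ⊤))
  have hd : DifferentiableAt ℝ (fderiv ℝ f.fn) y :=
    (f.contDiff.fderiv_right (m := ∞) (by simp)).differentiable (by simp) y
  have key : ∀ v w : Y, (SF.pd v (SF.pd w f)).fn y = fderiv ℝ (fderiv ℝ f.fn) y v w := by
    intro v w
    rw [SF.pd_apply]
    change fderiv ℝ (fun y => fderiv ℝ f.fn y w) y v = _
    rw [fderiv_clm_apply hd (differentiableAt_const w)]
    simp
  rw [key, key, hs.eq]

variable [FiniteDimensional ℝ Y] {A : Type*} [Ring A] [Algebra ℝ A]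

/-- The partial derivatives with respect to the standard basis. -/
def SF.dj (j : Fin (Module.finrank ℝ Y)) : Derivation ℝ (SF Y) (SF Y) :=
  SF.pd (Module.finBasis ℝ Y j)

lemma SF.dj_comm (i j : Fin (Module.finrank ℝ Y)) (f : SF Y) :
    SF.dj i (SF.dj j f) = SF.dj j (SF.dj i f) := SF.pd_comm _ _ _

/-- Evaluation at a point, with values in an algebra. -/
def SF.ev (A : Type*) [Ring A] [Algebra ℝ A] (y : Y) : SF Y →ₐ[ℝ] A :=
  (Algebra.ofId ℝ A).comp (SF.evalAt y)

omit [FiniteDimensional ℝ Y] in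
lemma SF.ev_apply (y : Y) (f : SF Y) : SF.ev A y f = algebraMap ℝ A (f.fn y) := rfl

lemma iteratedFDeriv_succ_finBasis (f : SF Y) (k : ℕ) (y : Y)
    (i : Fin (k + 1) → Fin (Module.finrank ℝ Y)) :
    iteratedFDeriv ℝ (k + 1) f.fn y (fun j => Module.finBasis ℝ Y (i j))
      = iteratedFDeriv ℝ k (SF.dj (i (Fin.last k)) f).fn y
          (fun j => Module.finBasis ℝ Y (i j.castSucc)) := by
  rw [iteratedFDeriv_succ_apply_right]
  have h := ContinuousLinearMap.iteratedFDeriv_comp_left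
    (ContinuousLinearMap.apply ℝ ℝ (Module.finBasis ℝ Y (i (Fin.last k))))
    (f := fderiv ℝ f.fn) (x := y) (n := ∞) (i := k)
    ((f.contDiff.fderiv_right (m := ∞) (by simp)).contDiffAt) (by exact_mod_cast le_top)
  have h2 := congrArg (fun m => m (fun j => Module.finBasis ℝ Y (i j.castSucc))) h
  exact h2.symm

lemma sum_iteratedFDeriv_eq_expTerm (f : SF Y) (k : ℕ) (y : Y)
    (ξ : Fin (Module.finrank ℝ Y) → A) :
    ∑ i : Fin k → Fin (Module.finrank ℝ Y),
      (iteratedFDeriv ℝ k f.fn y fun j => Module.finBasis ℝ Y (i j)) •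
        (List.ofFn fun j => ξ (i j)).prod
      = expTerm (fun j => SF.dj j) (SF.ev A y) ξ k f := by
  induction k generalizing f with
  | zero => simp [expTerm, SF.ev_apply, Algebra.algebraMap_eq_smul_one]
  | succ k ih =>
    rw [← (Fin.snocEquiv (fun _ => Fin (Module.finrank ℝ Y))).sum_comp, Fintype.sum_prod_type]
    rw [expTerm]
    refine Finset.sum_congr rfl fun l _ => ?_
    rw [← ih, Finset.sum_mul]
    refine Finset.sum_congr rfl fun i _ => ?_
    rw [iteratedFDeriv_succ_finBasis, List.ofFn_succ']
    simp [Fin.snocEquiv]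

variable {W : Type*} [NormedAddCommGroup W] [NormedSpace ℝ W]

lemma taylor_congr {D : ℕ} {f g : Y → W} {y : Y} (h : f =ᶠ[nhds y] g) (w : Y ⊗[ℝ] A) :
    taylor D f y w = taylor D g y w := by
  unfold taylor
  refine Finset.sum_congr rfl fun k _ => ?_
  rw [(h.iteratedFDeriv ℝ k).eq_of_nhds]

lemma lTensor_taylor {A' : Type*} [Ring A'] [Algebra ℝ A'] (α : A →ₐ[ℝ] A') (D : ℕ) (f : Y → W)
    (y : Y) (w : Y ⊗[ℝ] A) :
    LinearMap.lTensor W α.toLinearMap (taylor D f y w)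
      = taylor D f y (LinearMap.lTensor Y α.toLinearMap w) := by
  have h : ∀ l : Module.Dual ℝ Y, TensorProduct.lid ℝ A'
      (lin l (LinearMap.lTensor Y α.toLinearMap w)) = α (TensorProduct.lid ℝ A (lin l w)) :=
    fun l => comp_lTensor α.toLinearMap l w
  simp only [taylor, map_sum, map_smul, LinearMap.lTensor_tmul, AlgHom.toLinearMap_apply,
    map_list_prod, List.map_ofFn, Function.comp_def, h]

section Finite

variable [FiniteDimensional ℝ W]

/-- Composition with a linear form. -/
def SF.comp (l : Module.Dual ℝ W) {f : Y → W} (hf : ContDiff ℝ ∞ f) : SF Y :=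
  SF.mk (fun y => l (f y)) ((LinearMap.toContinuousLinearMap l).contDiff.comp hf)

lemma comp_taylor (D : ℕ) {f : Y → W} (hf : ContDiff ℝ ∞ f) (y : Y) (w : Y ⊗[ℝ] A)
    (l : Module.Dual ℝ W) :
    comp l (taylor D f y w) = expSum (fun j => SF.dj j) (SF.ev A y)
      (fun j => comp ((Module.finBasis ℝ Y).coord j) w) D (SF.comp l hf) := by
  rw [taylor, expSum, map_sum]
  refine Finset.sum_congr rfl fun k _ => ?_
  rw [map_smul, map_sum, ← sum_iteratedFDeriv_eq_expTerm]
  congr 1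
  refine Finset.sum_congr rfl fun i _ => ?_
  rw [comp_tmul]
  congr 1
  have h := ContinuousLinearMap.iteratedFDeriv_comp_left (LinearMap.toContinuousLinearMap l)
    (f := f) (x := y) (n := ∞) (i := k) hf.contDiffAt (by exact_mod_cast le_top)
  exact (congrArg (fun m => m (fun j => Module.finBasis ℝ Y (i j))) h).symm

end Finite

/-- `f` is smooth at all points near `y`. -/
def SmoothNear (f : Y → W) (y : Y) : Prop := ∀ᶠ z in nhds y, ContDiffAt ℝ ∞ f z

lemma SmoothNear.exists_contDiff {f : Y → W} {y : Y} (hf : SmoothNear f y) :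
    ∃ g : Y → W, ContDiff ℝ ∞ g ∧ f =ᶠ[nhds y] g := by
  obtain ⟨r, hr, hball⟩ := Metric.eventually_nhds_iff_ball.1 hf
  let χ : ContDiffBump y := ⟨r / 3, r / 2, by positivity, by linarith⟩
  refine ⟨fun z => χ z • f z, contDiff_iff_contDiffAt.2 fun z => ?_, ?_⟩
  · by_cases hz : z ∈ Metric.ball y r
    · exact χ.contDiff.contDiffAt.smul (hball z hz)
    · have hz' : z ∉ tsupport χ := by
        rw [χ.tsupport_eq]
        intro h
        refine hz (Metric.closedBall_subset_ball ?_ h)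
        change r / 2 < r
        linarith
      have h0 : (fun z => χ z • f z) =ᶠ[nhds z] fun _ => 0 := by
        filter_upwards [notMem_tsupport_iff_eventuallyEq.1 hz'] with x hx
        simp [hx]
      exact contDiffAt_const.congr_of_eventuallyEq h0
  · filter_upwards [χ.eventuallyEq_one] with z hz
    simp [hz]

end Smooth

/-! ### Taylor expansions at even nilpotent displacements -/

section Souls

open ExteriorAlgebra

variable {M : Type*} [AddCommGroup M] [Module ℝ M]

section Defs

variable {W W' : Type*} [AddCommGroup W] [Module ℝ W] [AddCommGroup W'] [Module ℝ W']

/-- All components are even. -/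
def IsEven (u : W ⊗[ℝ] ExteriorAlgebra ℝ M) : Prop :=
  ∀ l : Module.Dual ℝ W, comp l u ∈ evenPart M

/-- All components are even and have no constant term. -/
def IsSoul (u : W ⊗[ℝ] ExteriorAlgebra ℝ M) : Prop :=
  ∀ l : Module.Dual ℝ W, comp l u ∈ evenPart M ∧ algebraMapInv (comp l u) = (0 : ℝ)

/-- The constant term. -/
def body : W ⊗[ℝ] ExteriorAlgebra ℝ M →ₗ[ℝ] W :=
  (TensorProduct.rid ℝ W).toLinearMap ∘ₗ LinearMap.lTensor W algebraMapInv.toLinearMap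

@[simp] lemma body_tmul (w : W) (a : ExteriorAlgebra ℝ M) :
    body (w ⊗ₜ a) = (algebraMapInv a : ℝ) • w := by
  simp [body]

lemma apply_body (l : Module.Dual ℝ W) (u : W ⊗[ℝ] ExteriorAlgebra ℝ M) :
    l (body u) = algebraMapInv (comp l u) := by
  induction u using TensorProduct.induction_on with
  | zero => simp
  | tmul w a => simp [mul_comm]
  | add x y hx hy => simp [hx, hy]

lemma IsEven.sub_body {u : W ⊗[ℝ] ExteriorAlgebra ℝ M} (hu : IsEven u) :
    IsSoul (u - body u ⊗ₜ 1) := by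
  intro l
  rw [map_sub, comp_tmul, map_sub, apply_body]
  refine ⟨sub_mem (hu l) (Subalgebra.smul_mem _ (one_mem _) _), by simp⟩

lemma isEven_tmul_one (w : W) : IsEven (w ⊗ₜ[ℝ] (1 : ExteriorAlgebra ℝ M)) := fun l => by
  rw [comp_tmul]; exact Subalgebra.smul_mem _ (one_mem _) _

lemma IsSoul.isEven {u : W ⊗[ℝ] ExteriorAlgebra ℝ M} (hu : IsSoul u) : IsEven u := fun l => (hu l).1

lemma IsEven.add {u v : W ⊗[ℝ] ExteriorAlgebra ℝ M} (hu : IsEven u) (hv : IsEven v) :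
    IsEven (u + v) := fun l => by rw [map_add]; exact add_mem (hu l) (hv l)

lemma IsSoul.add {u v : W ⊗[ℝ] ExteriorAlgebra ℝ M} (hu : IsSoul u) (hv : IsSoul v) :
    IsSoul (u + v) := fun l => by
  rw [map_add, map_add, (hu l).2, (hv l).2, add_zero]; exact ⟨add_mem (hu l).1 (hv l).1, rfl⟩

lemma isSoul_zero : IsSoul (0 : W ⊗[ℝ] ExteriorAlgebra ℝ M) := fun l => by simp

lemma IsSoul.lin_apply {u : W ⊗[ℝ] ExteriorAlgebra ℝ M} (hu : IsSoul u) (L : W →ₗ[ℝ] W') :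
    IsSoul (lin L u) := fun l => by rw [comp_lin]; exact hu _

lemma IsEven.lin_apply {u : W ⊗[ℝ] ExteriorAlgebra ℝ M} (hu : IsEven u) (L : W →ₗ[ℝ] W') :
    IsEven (lin L u) := fun l => by rw [comp_lin]; exact hu _

lemma IsSoul.body_eq [FiniteDimensional ℝ W] {u : W ⊗[ℝ] ExteriorAlgebra ℝ M} (hu : IsSoul u) :
    body u = 0 := by
  rw [← Module.forall_dual_apply_eq_zero_iff ℝ]
  exact fun l => by rw [apply_body, (hu l).2]

variable {M' : Type*} [AddCommGroup M'] [Module ℝ M']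

lemma IsSoul.map {u : W ⊗[ℝ] ExteriorAlgebra ℝ M} (hu : IsSoul u) (f : M →ₗ[ℝ] M') :
    IsSoul (LinearMap.lTensor W (ExteriorAlgebra.map f).toLinearMap u) := fun l => by
  rw [comp_lTensor]
  exact ⟨map_mem_evenPart f (hu l).1, by simp [(hu l).2]⟩

lemma IsEven.map {u : W ⊗[ℝ] ExteriorAlgebra ℝ M} (hu : IsEven u) (f : M →ₗ[ℝ] M') :
    IsEven (LinearMap.lTensor W (ExteriorAlgebra.map f).toLinearMap u) := fun l => by
  rw [comp_lTensor]
  exact map_mem_evenPart f (hu l)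

lemma body_map (u : W ⊗[ℝ] ExteriorAlgebra ℝ M) (f : M →ₗ[ℝ] M') :
    body (LinearMap.lTensor W (ExteriorAlgebra.map f).toLinearMap u) = body u := by
  induction u using TensorProduct.induction_on with
  | zero => simp
  | tmul w a => simp
  | add x y hx hy => simp [hx, hy]

end Defs

section Scalar

variable {Y : Type*} [NormedAddCommGroup Y] [NormedSpace ℝ Y] [FiniteDimensional ℝ Y]

/-- The components of a soul, as elements of the even part. -/
def IsSoul.coord {w : Y ⊗[ℝ] ExteriorAlgebra ℝ M} (hw : IsSoul w)
    (j : Fin (Module.finrank ℝ Y)) : Ev M :=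
  Ev.mk (comp ((Module.finBasis ℝ Y).coord j) w) (hw _).1

lemma IsSoul.coord_mem {w : Y ⊗[ℝ] ExteriorAlgebra ℝ M} (hw : IsSoul w)
    (j : Fin (Module.finrank ℝ Y)) : hw.coord j ∈ soulIdeal M := (hw _).2

/-- The value of a smooth function at `y + w`, where `w` is a soul. -/
def IsSoul.val {w : Y ⊗[ℝ] ExteriorAlgebra ℝ M} (hw : IsSoul w) (D : ℕ) (y : Y) (f : SF Y) : Ev M :=
  expSum (fun j => SF.dj j) (SF.ev (Ev M) y) hw.coord D f

variable {w : Y ⊗[ℝ] ExteriorAlgebra ℝ M} (hw : IsSoul w) (y : Y)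
  {W : Type*} [NormedAddCommGroup W] [NormedSpace ℝ W] [FiniteDimensional ℝ W]

include hw in
lemma IsSoul.comp_taylor (D : ℕ) {f : Y → W} (hf : ContDiff ℝ ∞ f) (l : Module.Dual ℝ W) :
    comp l (taylor D f y w) = Ev.incl M (hw.val D y (SF.comp l hf)) := by
  rw [TwoBundle.comp_taylor D hf]
  exact (expSum_map (fun j => SF.dj j) (SF.ev (Ev M) y) hw.coord (Ev.incl M) D _).symm

lemma IsSoul.val_add (D : ℕ) (f g : SF Y) : hw.val D y (f + g) = hw.val D y f + hw.val D y g := by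
  simp [IsSoul.val, expSum, expTerm_add SF.dj, Finset.sum_add_distrib]

lemma IsSoul.val_sum (D : ℕ) {κ : Type*} (s : Finset κ) (f : κ → SF Y) :
    hw.val D y (∑ k ∈ s, f k) = ∑ k ∈ s, hw.val D y (f k) :=
  map_sum (AddMonoidHom.mk' (hw.val D y) (hw.val_add y D)) f s

lemma IsSoul.val_sub_mem (D : ℕ) (f : SF Y) :
    hw.val D y f - algebraMap ℝ _ (f.fn y) ∈ soulIdeal M :=
  expSum_sub_mem _ _ hw.coord_mem f

variable [FiniteDimensional ℝ M] {D : ℕ} (hD : Module.finrank ℝ M ≤ D)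

include hD in
lemma IsSoul.val_mul (f g : SF Y) : hw.val D y (f * g) = hw.val D y f * hw.val D y g := by
  unfold IsSoul.val
  exact expSum_mul (ξ := hw.coord) SF.dj SF.dj_comm (SF.ev (Ev M) y) (soulIdeal_pow hD)
    hw.coord_mem f g

include hD in
lemma IsSoul.val_of_le {D' : ℕ} (h : D ≤ D') (f : SF Y) : hw.val D' y f = hw.val D y f :=
  expSum_eq_of_le _ _ (soulIdeal_pow hD) hw.coord_mem h f

end Scalar

section Taylor

variable {Y V V' W : Type*} [NormedAddCommGroup Y] [NormedSpace ℝ Y] [FiniteDimensional ℝ Y]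
  [NormedAddCommGroup V] [NormedSpace ℝ V] [FiniteDimensional ℝ V]
  [NormedAddCommGroup V'] [NormedSpace ℝ V'] [FiniteDimensional ℝ V']
  [NormedAddCommGroup W] [NormedSpace ℝ W] [FiniteDimensional ℝ W]

/-- The pull-back of smooth functions along a smooth map. -/
def SF.pull {f : Y → V} (hf : ContDiff ℝ ∞ f) : SF V →ₐ[ℝ] SF Y where
  toFun h := SF.mk (fun z => h.fn (f z)) (h.contDiff.comp hf)
  map_one' := rfl
  map_mul' _ _ := rfl
  map_zero' := rfl
  map_add' _ _ := rfl
  commutes' _ := rfl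

/-- The chain rule for partial derivatives. -/
lemma SF.dj_pull {f : Y → V} (hf : ContDiff ℝ ∞ f) (j : Fin (Module.finrank ℝ Y)) (h : SF V) :
    SF.dj j (SF.pull hf h) = ∑ m, SF.pull hf (SF.dj m h)
      * SF.dj j (SF.comp ((Module.finBasis ℝ V).coord m) hf) := by
  apply SF.ext
  intro z
  have hdf : DifferentiableAt ℝ f z := hf.differentiable (by simp) z
  have h1 : (SF.dj j (SF.pull hf h)).fn z
      = fderiv ℝ h.fn (f z) (fderiv ℝ f z (Module.finBasis ℝ Y j)) := by
    change fderiv ℝ (h.fn ∘ f) z _ = _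
    rw [fderiv_comp z (SF.differentiable h (f z)) hdf]
    rfl
  have h2 : ∀ m, (SF.dj j (SF.comp ((Module.finBasis ℝ V).coord m) hf)).fn z
      = (Module.finBasis ℝ V).coord m (fderiv ℝ f z (Module.finBasis ℝ Y j)) := by
    intro m
    change fderiv ℝ (LinearMap.toContinuousLinearMap ((Module.finBasis ℝ V).coord m) ∘ f) z _ = _
    rw [fderiv_comp z (ContinuousLinearMap.differentiableAt _) hdf, ContinuousLinearMap.fderiv]
    rfl
  rw [h1, SF.fn_sum]
  simp only [h2, SF.fn_mul]
  conv_lhs => rw [← (Module.finBasis ℝ V).sum_repr (fderiv ℝ f z (Module.finBasis ℝ Y j))]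
  rw [map_sum]
  refine Finset.sum_congr rfl fun m _ => ?_
  rw [map_smul, smul_eq_mul, mul_comm]
  rfl

variable {w : Y ⊗[ℝ] ExteriorAlgebra ℝ M} (hw : IsSoul w) {y : Y}

include hw in
lemma IsSoul.taylor_sub (D : ℕ) {f : Y → W} (hf : SmoothNear f y) :
    IsSoul (taylor D f y w - f y ⊗ₜ 1) := by
  obtain ⟨g, hg, hfg⟩ := hf.exists_contDiff
  intro l
  rw [taylor_congr hfg, hfg.eq_of_nhds, map_sub, hw.comp_taylor y D hg, comp_tmul]
  have h := hw.val_sub_mem y D (SF.comp l hg)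
  rw [mem_soulIdeal, map_sub, AlgHom.commutes, Algebra.algebraMap_eq_smul_one] at h
  exact ⟨sub_mem (Ev.incl_mem _) (Subalgebra.smul_mem _ (one_mem _) _), h⟩

include hw in
lemma IsSoul.taylor_isEven (D : ℕ) {f : Y → W} (hf : SmoothNear f y) :
    IsEven (taylor D f y w) := by
  have := (hw.taylor_sub D hf).isEven.add (isEven_tmul_one (f y))
  rwa [sub_add_cancel] at this

include hw in
lemma IsSoul.body_taylor (D : ℕ) {f : Y → W} (hf : SmoothNear f y) :
    body (taylor D f y w) = f y := by
  have := (hw.taylor_sub D hf).body_eq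
  rw [map_sub, body_tmul, map_one, one_smul] at this
  exact sub_eq_zero.1 this

variable [FiniteDimensional ℝ M] {D : ℕ} (hD : Module.finrank ℝ M ≤ D)

include hw hD in
lemma IsSoul.taylor_of_le {D' : ℕ} (h : D ≤ D') {f : Y → W} (hf : SmoothNear f y) :
    taylor D' f y w = taylor D f y w := by
  obtain ⟨g, hg, hfg⟩ := hf.exists_contDiff
  refine ext_comp fun l => ?_
  rw [taylor_congr hfg, taylor_congr hfg, hw.comp_taylor y _ hg, hw.comp_taylor y _ hg,
    hw.val_of_le y hD h]

include hw hD in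
/-- The Taylor expansion of a composition. -/
lemma IsSoul.taylor_comp {ψ : Y → V} {φ : V → W} (hψ : SmoothNear ψ y) (hφ : SmoothNear φ (ψ y)) :
    taylor D φ (ψ y) (taylor D ψ y w - ψ y ⊗ₜ 1) = taylor D (fun z => φ (ψ z)) y w := by
  obtain ⟨f, hf, hψf⟩ := hψ.exists_contDiff
  obtain ⟨g, hg, hφg⟩ := hφ.exists_contDiff
  have hv := hw.taylor_sub D hψ
  have hcomp : (fun z => φ (ψ z)) =ᶠ[nhds y] g ∘ f := by
    have hc : ContinuousAt ψ y := hψ.self_of_nhds.continuousAt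
    filter_upwards [hc.eventually hφg, hψf] with z h1 h2
    rw [h1, h2, Function.comp_apply]
  refine ext_comp fun l => ?_
  rw [taylor_congr hcomp, hw.comp_taylor y D (hg.comp hf), taylor_congr hφg,
    hv.comp_taylor _ D hg]
  congr 1
  have key := expSum_comp SF.dj SF.dj_comm (SF.ev (Ev M) y) (ξ := hw.coord)
    SF.dj SF.dj_comm (SF.pull hf) (fun m => SF.comp ((Module.finBasis ℝ V).coord m) hf)
    (SF.dj_pull hf) (soulIdeal_pow hD) hw.coord_mem (SF.comp l hg)
  have e : SF.pull hf (SF.comp l hg) = SF.comp l (hg.comp hf) := rfl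
  rw [e] at key
  rw [IsSoul.val, IsSoul.val, ← key]
  have e1 : (fun h : SF V => SF.ev (Ev M) y (SF.pull hf h)) = SF.ev (Ev M) (ψ y) := by
    funext h
    rw [SF.ev_apply, SF.ev_apply, hψf.eq_of_nhds]
    rfl
  rw [e1]
  congr 1
  funext m
  apply Ev.incl_injective
  change comp _ (taylor D ψ y w - ψ y ⊗ₜ[ℝ] 1) = _
  rw [taylor_congr hψf, hψf.eq_of_nhds, map_sub, hw.comp_taylor y D hf, comp_tmul,
    ← Algebra.algebraMap_eq_smul_one, map_sub, SF.ev_apply, AlgHom.commutes]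
  rfl

omit [FiniteDimensional ℝ V'] [FiniteDimensional ℝ Y] [FiniteDimensional ℝ V]
  [FiniteDimensional ℝ W] in
lemma SmoothNear.clm_comp {L : Y → V →L[ℝ] W} {L' : Y → V' →L[ℝ] V} (hL : SmoothNear L y)
    (hL' : SmoothNear L' y) : SmoothNear (fun z => (L z).comp (L' z)) y := by
  filter_upwards [hL, hL'] with z h1 h2 using h1.clm_comp h2

include hw hD in
lemma IsSoul.app_taylor_app {L : Y → V →L[ℝ] W} {L' : Y → V' →L[ℝ] V} (hL : SmoothNear L y)
    (hL' : SmoothNear L' y) (u : V' ⊗[ℝ] ExteriorAlgebra ℝ M) :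
    app (taylor D L y w) (app (taylor D L' y w) u)
      = app (V := V') (W := W) (taylor D (fun z => (L z).comp (L' z)) y w) u := by
  obtain ⟨g, hg, hLg⟩ := hL.exists_contDiff
  obtain ⟨f, hf, hLf⟩ := hL'.exists_contDiff
  have h : (fun z => (L z).comp (L' z)) =ᶠ[nhds y] fun z => (g z).comp (f z) := by
    filter_upwards [hLg, hLf] with z h1 h2
    rw [h1, h2]
  rw [taylor_congr hLg, taylor_congr hLf, taylor_congr h]
  refine ext_comp fun l => ?_
  rw [comp_app (Module.finBasis ℝ V), comp_app (Module.finBasis ℝ V')]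
  simp only [comp_app (Module.finBasis ℝ V'), Finset.mul_sum, ← mul_assoc]
  rw [Finset.sum_comm]
  refine Finset.sum_congr rfl fun i _ => ?_
  rw [← Finset.sum_mul]
  congr 1
  rw [hw.comp_taylor y D (hg.clm_comp hf)]
  simp only [hw.comp_taylor y D hg, hw.comp_taylor y D hf, ← map_mul,
    ← hw.val_mul y hD, ← map_sum, ← hw.val_sum]
  congr 2
  apply SF.ext
  intro z
  rw [SF.fn_sum]
  change _ = l (g z (f z (Module.finBasis ℝ V' i)))
  conv_rhs => rw [← (Module.finBasis ℝ V).sum_repr (f z (Module.finBasis ℝ V' i))]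
  simp only [map_sum, map_smul, smul_eq_mul]
  exact Finset.sum_congr rfl fun m _ => mul_comm _ _

lemma SF.dj_comp (j : Fin (Module.finrank ℝ Y)) (l : Module.Dual ℝ W) {f : Y → W}
    (hf : ContDiff ℝ ∞ f) (hf' : ContDiff ℝ ∞ (fderiv ℝ f)) :
    SF.dj j (SF.comp l hf) = SF.comp (evalForm l (Module.finBasis ℝ Y j)) hf' := by
  apply SF.ext
  intro z
  change fderiv ℝ (LinearMap.toContinuousLinearMap l ∘ f) z _ = _
  rw [fderiv_comp z (ContinuousLinearMap.differentiableAt _) (hf.differentiable (by simp) z),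
    ContinuousLinearMap.fderiv]
  rfl

lemma SF.dj_const (j : Fin (Module.finrank ℝ Y)) (l : Module.Dual ℝ W) (a : W) :
    SF.dj j (SF.comp l (contDiff_const (c := a))) = (0 : SF Y) := by
  apply SF.ext
  intro z
  change fderiv ℝ (fun _ => l a) z _ = 0
  simp

include hw in
omit [FiniteDimensional ℝ M] in
lemma IsSoul.taylor_const (D : ℕ) (a : W) : taylor D (fun _ : Y => a) y w = a ⊗ₜ 1 := by
  refine ext_comp fun l => ?_
  rw [hw.comp_taylor y D contDiff_const, IsSoul.val, expSum, Finset.sum_range_succ', comp_tmul]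
  have : ∀ k, expTerm (fun j => SF.dj j) (SF.ev (Ev M) y) hw.coord (k + 1)
      (SF.comp l (contDiff_const (c := a))) = 0 := by
    intro k
    simp only [expTerm, SF.dj_const]
    refine Finset.sum_eq_zero fun j _ => ?_
    have := expTerm_add SF.dj (SF.ev (Ev M) y) hw.coord k 0 0
    rw [add_zero, left_eq_add] at this
    rw [this, zero_mul]
  rw [Finset.sum_eq_zero fun k _ => by rw [this, smul_zero], zero_add, expTerm, SF.ev_apply]
  simp only [Nat.factorial_zero, Nat.cast_one, inv_one, one_smul, AlgHom.commutes]
  exact Algebra.algebraMap_eq_smul_one _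

include hw hD in
/-- The Taylor expansion of a linear map is exact. -/
lemma IsSoul.taylor_clm (L : Y →L[ℝ] W) :
    taylor D L y w = L y ⊗ₜ 1 + lin (L : Y →ₗ[ℝ] W) w := by
  refine ext_comp fun l => ?_
  rw [hw.comp_taylor y D L.contDiff, ← hw.val_of_le y hD (Nat.le_succ D), IsSoul.val, expSum,
    Finset.sum_range_succ', Finset.sum_range_succ', map_add (comp l), comp_tmul, comp_lin]
  have h1 : ∀ j, SF.dj j (SF.comp l L.contDiff)
      = SF.comp l (contDiff_const (c := L (Module.finBasis ℝ Y j))) := by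
    intro j
    have e : fderiv ℝ L = fun _ => L := funext fun z => L.fderiv
    rw [SF.dj_comp j l L.contDiff (by rw [e]; exact contDiff_const)]
    apply SF.ext
    intro z
    change l (fderiv ℝ L z _) = _
    rw [L.fderiv]
    rfl
  have : ∀ k, expTerm (fun j => SF.dj j) (SF.ev (Ev M) y) hw.coord (k + 1 + 1)
      (SF.comp l L.contDiff) = 0 := by
    intro k
    simp only [expTerm, h1, SF.dj_const]
    refine Finset.sum_eq_zero fun j _ => ?_
    have := expTerm_add SF.dj (SF.ev (Ev M) y) hw.coord k 0 0
    rw [add_zero, left_eq_add] at this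
    simp [this]
  rw [Finset.sum_eq_zero fun k _ => by rw [this, smul_zero], zero_add, expTerm, expTerm]
  simp only [expTerm, SF.ev_apply, h1]
  rw [comp_eq_sum (Module.finBasis ℝ Y) (l ∘ₗ (L : Y →ₗ[ℝ] W)) w, add_comm]
  simp [SF.comp, Algebra.algebraMap_eq_smul_one, IsSoul.coord]
  rfl

include hw hD in
lemma IsSoul.taylor_id : taylor D (fun z : Y => z) y w = y ⊗ₜ 1 + w := by
  have h := hw.taylor_clm (y := y) hD (ContinuousLinearMap.id ℝ Y)
  have e : lin ((ContinuousLinearMap.id ℝ Y : Y →L[ℝ] Y) : Y →ₗ[ℝ] Y) w = w := by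
    rw [lin, ContinuousLinearMap.coe_id, LinearMap.rTensor_id]; rfl
  rw [e] at h
  exact h

include hw hD in
/-- The chain rule for contractions. -/
lemma IsSoul.contr_taylor (c : Module.Dual ℝ M) {f : Y → W} (hf : SmoothNear f y) :
    LinearMap.lTensor W (contr c) (taylor D f y w)
      = app (taylor D (fderiv ℝ f) y w) (LinearMap.lTensor Y (contr c) w) := by
  obtain ⟨g, hg, hfg⟩ := hf.exists_contDiff
  have hg' : ContDiff ℝ ∞ (fderiv ℝ g) := hg.fderiv_right (by simp)
  rw [taylor_congr hfg, taylor_congr hfg.fderiv]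
  refine ext_comp fun l => ?_
  rw [comp_lTensor, comp_app (Module.finBasis ℝ Y), hw.comp_taylor y D hg]
  simp only [hw.comp_taylor y D hg', comp_lTensor, ← SF.dj_comp _ l hg hg']
  rw [← hw.val_of_le y hD (Nat.le_succ D)]
  have h := derivation_expSum (fun j => SF.dj j) SF.dj_comm (SF.ev (Ev M) y) hw.coord
    (fun _ => 0) (Ev.incl M) Ev.incl_central
    ((contr c).comp (Ev.incl M).toLinearMap)
    (fun s s' => by simp [contr_mul, mem_evenPart.1 s.incl_mem])
    (fun f => by
      change contr c (algebraMap ℝ _ _) = _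
      rw [contr_algebraMap]; simp) D (SF.comp l hg)
  simp only [map_zero, mul_zero, Finset.sum_const_zero, zero_add] at h
  exact h

end Taylor

end Souls

/-! ### Weak derivatives of curves -/

section WeakDerivative

open ExteriorAlgebra Filter

section Basic

variable {V V' V'' : Type*} [AddCommGroup V] [Module ℝ V] [AddCommGroup V'] [Module ℝ V']
  [AddCommGroup V''] [Module ℝ V'']

/-- The curve `c` has derivative `v` at `0` when tested on linear forms. -/
def HasWDeriv (c : ℝ → V) (v : V) : Prop :=
  ∀ l : Module.Dual ℝ V, HasDerivAt (fun t => l (c t)) (l v) 0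

lemma HasWDeriv.wderiv_eq {c : ℝ → V} {v : V} (h : HasWDeriv c v) : wderiv c = v := by
  have hex : ∃ v, ∀ l : Module.Dual ℝ V, HasDerivAt (fun t => l (c t)) (l v) 0 := ⟨v, h⟩
  rw [wderiv, dif_pos hex, ← sub_eq_zero, ← Module.forall_dual_apply_eq_zero_iff ℝ]
  intro l
  rw [map_sub, (hex.choose_spec l).unique (h l), sub_self]

lemma HasWDeriv.congr {c c' : ℝ → V} {v : V} (h : HasWDeriv c v) (hc : c' =ᶠ[nhds 0] c) :
    HasWDeriv c' v := fun l =>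
  (h l).congr_of_eventuallyEq (hc.mono fun t ht => by simp [ht])

lemma wderiv_congr {c c' : ℝ → V} (hc : c' =ᶠ[nhds 0] c) : wderiv c' = wderiv c := by
  by_cases h : ∃ v, HasWDeriv c v
  · obtain ⟨v, hv⟩ := h
    rw [hv.wderiv_eq, (hv.congr hc).wderiv_eq]
  · have h' : ¬∃ v, HasWDeriv c' v := fun ⟨v, hv⟩ => h ⟨v, hv.congr hc.symm⟩
    rw [wderiv, wderiv, dif_neg, dif_neg]
    exacts [h, h']

lemma HasWDeriv.linear {c : ℝ → V} {v : V} (h : HasWDeriv c v) (L : V →ₗ[ℝ] V') :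
    HasWDeriv (fun t => L (c t)) (L v) := fun l => h (l ∘ₗ L)

lemma hasWDeriv_const (v : V) : HasWDeriv (fun _ : ℝ => v) 0 := fun l => by
  simpa using hasDerivAt_const (0 : ℝ) (l v)

lemma HasWDeriv.add {c c' : ℝ → V} {v v' : V} (h : HasWDeriv c v) (h' : HasWDeriv c' v') :
    HasWDeriv (fun t => c t + c' t) (v + v') := fun l => by
  simpa using (h l).fun_add (h' l)

lemma HasWDeriv.sub {c c' : ℝ → V} {v v' : V} (h : HasWDeriv c v) (h' : HasWDeriv c' v') :
    HasWDeriv (fun t => c t - c' t) (v - v') := fun l => by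
  simpa using (h l).fun_sub (h' l)

lemma HasDerivAt.hasWDeriv_smul {f : ℝ → ℝ} {f' : ℝ} (h : HasDerivAt f f' 0) (v : V) :
    HasWDeriv (fun t => f t • v) (f' • v) := fun l => by
  simpa using h.mul_const (l v)

/-- The product rule for a bilinear map of finite dimensional spaces. -/
lemma HasWDeriv.bilin [FiniteDimensional ℝ V] [FiniteDimensional ℝ V'] {c : ℝ → V} {c' : ℝ → V'}
    {v : V} {v' : V'} (h : HasWDeriv c v) (h' : HasWDeriv c' v') (β : V →ₗ[ℝ] V' →ₗ[ℝ] V'') :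
    HasWDeriv (fun t => β (c t) (c' t)) (β v (c' 0) + β (c 0) v') := by
  intro l
  obtain ⟨K, e⟩ : ∃ K : Fin (Module.finrank ℝ V) → Fin (Module.finrank ℝ V') → ℝ,
      ∀ (x : V) (x' : V'), l (β x x') = ∑ i, ∑ j, ((Module.finBasis ℝ V).coord i x
        * (Module.finBasis ℝ V').coord j x') * K i j := by
    refine ⟨fun i j => l (β (Module.finBasis ℝ V i) (Module.finBasis ℝ V' j)), fun x x' => ?_⟩
    conv_lhs => rw [← (Module.finBasis ℝ V).sum_repr x, ← (Module.finBasis ℝ V').sum_repr x']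
    simp only [map_sum, map_smul, LinearMap.sum_apply, LinearMap.smul_apply, Finset.smul_sum,
      smul_eq_mul, Module.Basis.coord_apply]
    rw [Finset.sum_comm]
    refine Finset.sum_congr rfl fun i _ => Finset.sum_congr rfl fun j _ => ?_
    ring
  simp only [map_add, e, ← Finset.sum_add_distrib, ← add_mul]
  refine HasDerivAt.fun_sum fun i _ => HasDerivAt.fun_sum fun j _ => ?_
  exact ((h _).fun_mul (h' _)).mul_const _

end Basic

lemma HasWDeriv.hasDerivAt {V : Type*} [NormedAddCommGroup V] [NormedSpace ℝ V]
    [FiniteDimensional ℝ V] {c : ℝ → V} {v : V} (h : HasWDeriv c v) : HasDerivAt c v 0 := by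
  have e : ∀ x : V, x = ∑ i, (Module.finBasis ℝ V).coord i x • Module.finBasis ℝ V i :=
    fun x => ((Module.finBasis ℝ V).sum_repr x).symm
  have e' : c = fun t => ∑ i, (Module.finBasis ℝ V).coord i (c t) • Module.finBasis ℝ V i :=
    funext fun t => e (c t)
  rw [e', e v]
  exact HasDerivAt.fun_sum fun i _ => (h _).smul_const _

lemma HasDerivAt.hasWDeriv {V : Type*} [NormedAddCommGroup V] [NormedSpace ℝ V]
    [FiniteDimensional ℝ V] {c : ℝ → V} {v : V} (h : HasDerivAt c v 0) : HasWDeriv c v := fun l =>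
  (LinearMap.toContinuousLinearMap l).hasFDerivAt.comp_hasDerivAt (0 : ℝ) h

lemma hasWDeriv_of_comp {W A : Type*} [AddCommGroup W] [Module ℝ W] [FiniteDimensional ℝ W]
    [Ring A] [Algebra ℝ A] {c : ℝ → W ⊗[ℝ] A} {v : W ⊗[ℝ] A}
    (h : ∀ l : Module.Dual ℝ W, HasWDeriv (fun t => comp l (c t)) (comp l v)) : HasWDeriv c v := by
  intro L
  have e : ∀ u : W ⊗[ℝ] A, L u = ∑ j, (L ∘ₗ TensorProduct.mk ℝ W A (Module.finBasis ℝ W j))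
      (comp ((Module.finBasis ℝ W).coord j) u) := by
    intro u
    conv_lhs => rw [eq_sum_comp (Module.finBasis ℝ W) u, map_sum]
    rfl
  simp only [e]
  exact HasDerivAt.fun_sum fun j _ => h _ _

variable {M : Type*} [AddCommGroup M] [Module ℝ M]

/-- The value at the even point `u` of a smooth function: its Taylor expansion at the constant term
of `u`. -/
def value {Y W : Type*} [NormedAddCommGroup Y] [NormedSpace ℝ Y] [FiniteDimensional ℝ Y]
    [NormedAddCommGroup W] [NormedSpace ℝ W] (D : ℕ) (f : Y → W)
    (u : Y ⊗[ℝ] ExteriorAlgebra ℝ M) : W ⊗[ℝ] ExteriorAlgebra ℝ M :=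
  taylor D f (body u) (u - body u ⊗ₜ 1)

variable [FiniteDimensional ℝ M]

instance : FiniteDimensional ℝ (ExteriorAlgebra ℝ M) := by
  have h : (⊤ : Submodule ℝ (ExteriorAlgebra ℝ M))
      ≤ ⨆ i : Fin (Module.finrank ℝ M + 1), LinearMap.range (ι ℝ (M := M)) ^ (i : ℕ) := by
    intro x _
    refine Submodule.span_le.2 ?_ (mem_filt_zero x)
    rintro _ ⟨l, -, rfl⟩
    by_cases hl : l.length < Module.finrank ℝ M + 1
    · refine Submodule.mem_iSup_of_mem ⟨l.length, hl⟩ ?_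
      change _ ∈ LinearMap.range (ι ℝ (M := M)) ^ l.length
      clear hl
      induction l with
      | nil => simp
      | cons m l ih =>
        rw [List.map_cons, List.prod_cons, List.length_cons, pow_succ']
        exact Submodule.mul_mem_mul ⟨m, rfl⟩ ih
    · have h0 : (l.map (ι ℝ)).prod ∈ filt M (Module.finrank ℝ M + 1) :=
        Submodule.subset_span ⟨l, by omega, rfl⟩
      rw [filt_eq_bot (Nat.lt_succ_self _), Submodule.mem_bot] at h0
      rw [h0]
      exact Submodule.zero_mem _
  refine ⟨?_⟩
  rw [← top_le_iff.1 h]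
  exact Submodule.fg_iSup _ fun i => (Submodule.FG.of_finite (N := LinearMap.range (ι ℝ))).pow _

/-- The curves in the exterior algebra which are weakly differentiable and even at `0`. On this
algebra the derivative at `0` is a derivation along the evaluation at `0`, as the formal chain rule
`derivation_expSum` demands. -/
def curveAlg (M : Type*) [AddCommGroup M] [Module ℝ M] [FiniteDimensional ℝ M] :
    Subalgebra ℝ (ℝ → ExteriorAlgebra ℝ M) where
  carrier := {g | (∃ g', HasWDeriv g g') ∧ g 0 ∈ evenPart M}
  mul_mem' := by
    rintro g h ⟨⟨g', hg⟩, hg0⟩ ⟨⟨h', hh⟩, hh0⟩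
    exact ⟨⟨_, hg.bilin hh (LinearMap.mul ℝ _)⟩, mul_mem hg0 hh0⟩
  add_mem' := by
    rintro g h ⟨⟨g', hg⟩, hg0⟩ ⟨⟨h', hh⟩, hh0⟩
    exact ⟨⟨_, hg.add hh⟩, add_mem hg0 hh0⟩
  algebraMap_mem' r := ⟨⟨_, hasWDeriv_const (algebraMap ℝ _ r)⟩, Subalgebra.algebraMap_mem _ r⟩

lemma curveAlg.hasWDeriv (g : curveAlg M) : HasWDeriv g.1 (wderiv g.1) := by
  obtain ⟨g', hg⟩ := g.2.1
  rwa [hg.wderiv_eq]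

/-- The derivative at `0`. -/
def curveAlg.deriv : curveAlg M →ₗ[ℝ] ExteriorAlgebra ℝ M where
  toFun g := wderiv g.1
  map_add' g h := ((curveAlg.hasWDeriv g).add (curveAlg.hasWDeriv h)).wderiv_eq
  map_smul' r g := ((curveAlg.hasWDeriv g).linear (r • LinearMap.id)).wderiv_eq

/-- The value at `t`. -/
def curveAlg.at (t : ℝ) : curveAlg M →ₐ[ℝ] ExteriorAlgebra ℝ M :=
  (Pi.evalAlgHom ℝ (fun _ : ℝ => ExteriorAlgebra ℝ M) t).comp (curveAlg M).val

variable {Y W : Type*} [NormedAddCommGroup Y] [NormedSpace ℝ Y] [FiniteDimensional ℝ Y]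
  [NormedAddCommGroup W] [NormedSpace ℝ W] [FiniteDimensional ℝ W]
  {D : ℕ} (hD : Module.finrank ℝ M ≤ D)

include hD in
/-- The chain rule for curves of even points. -/
lemma HasWDeriv.value {w : ℝ → Y ⊗[ℝ] ExteriorAlgebra ℝ M} {w' : Y ⊗[ℝ] ExteriorAlgebra ℝ M}
    (hw : HasWDeriv w w') (he : ∀ᶠ t in nhds 0, IsEven (w t)) {f : Y → W}
    (hf : SmoothNear f (body (w 0))) :
    HasWDeriv (fun t => value D f (w t)) (app (TwoBundle.value D (fderiv ℝ f) (w 0)) w') := by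
  obtain ⟨g, hg, hfg⟩ := hf.exists_contDiff
  have hg' : ContDiff ℝ ∞ (fderiv ℝ g) := hg.fderiv_right (by simp)
  have hy : HasDerivAt (fun t => body (w t)) (body w') 0 := (hw.linear body).hasDerivAt
  have hev : (fun t => TwoBundle.value D f (w t)) =ᶠ[nhds 0]
      fun t => TwoBundle.value (D + 1) g (w t) := by
    filter_upwards [he, hy.continuousAt.eventually hfg.eventuallyEq_nhds] with t h1 h2
    rw [TwoBundle.value, TwoBundle.value, taylor_congr h2,
      h1.sub_body.taylor_of_le hD (Nat.le_succ D) (Eventually.of_forall fun z => hg.contDiffAt)]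
  refine HasWDeriv.congr (hasWDeriv_of_comp fun l => ?_) hev
  have h0 : IsSoul (w 0 - body (w 0) ⊗ₜ 1) := he.self_of_nhds.sub_body
  have hcoord : ∀ (j) (t : ℝ), (Module.finBasis ℝ Y).coord j (body (w t))
      • (1 : ExteriorAlgebra ℝ M) = algebraMap ℝ _ ((Module.finBasis ℝ Y).coord j (body (w t))) :=
    fun j t => (Algebra.algebraMap_eq_smul_one _).symm
  let c : SF Y → curveAlg M := fun h => ⟨fun t => algebraMap ℝ _ (h.fn (body (w t))), by
    have h1 : HasDerivAt (fun t => h.fn (body (w t))) (fderiv ℝ h.fn (body (w 0)) (body w')) 0 :=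
      (h.differentiable (body (w 0))).hasFDerivAt.comp_hasDerivAt (0 : ℝ) hy
    have h2 := HasDerivAt.hasWDeriv_smul h1 (1 : ExteriorAlgebra ℝ M)
    simp only [← Algebra.algebraMap_eq_smul_one] at h2
    exact ⟨⟨_, h2⟩, Subalgebra.algebraMap_mem _ _⟩⟩
  have hc : ∀ h, curveAlg.deriv (c h)
      = algebraMap ℝ _ (fderiv ℝ h.fn (body (w 0)) (body w')) := by
    intro h
    have h1 : HasDerivAt (fun t => h.fn (body (w t))) (fderiv ℝ h.fn (body (w 0)) (body w')) 0 :=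
      (h.differentiable (body (w 0))).hasFDerivAt.comp_hasDerivAt (0 : ℝ) hy
    have h2 := HasDerivAt.hasWDeriv_smul h1 (1 : ExteriorAlgebra ℝ M)
    simp only [← Algebra.algebraMap_eq_smul_one] at h2
    exact h2.wderiv_eq
  have hlin : ∀ j, ContDiff ℝ ∞ fun z : Y => (Module.finBasis ℝ Y).coord j z := fun j =>
    (LinearMap.toContinuousLinearMap ((Module.finBasis ℝ Y).coord j)).contDiff
  let b : Fin (Module.finrank ℝ Y) → curveAlg M := fun j => c (SF.mk _ (hlin j))
  have hb : ∀ j, curveAlg.deriv (b j)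
      = algebraMap ℝ _ ((Module.finBasis ℝ Y).coord j (body w')) := by
    intro j
    rw [hc]
    congr 1
    change fderiv ℝ (LinearMap.toContinuousLinearMap ((Module.finBasis ℝ Y).coord j)) _ _ = _
    rw [ContinuousLinearMap.fderiv]
    rfl
  have hξ : ∀ j, HasWDeriv (fun t => comp ((Module.finBasis ℝ Y).coord j) (w t - body (w t) ⊗ₜ 1))
      (comp ((Module.finBasis ℝ Y).coord j) (w' - body w' ⊗ₜ 1)) := by
    intro j
    refine HasWDeriv.linear (V := Y ⊗[ℝ] ExteriorAlgebra ℝ M) (hw.sub ?_) _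
    exact (hw.linear body).linear ((TensorProduct.mk ℝ Y (ExteriorAlgebra ℝ M)).flip 1)
  let ξ : Fin (Module.finrank ℝ Y) → curveAlg M := fun j =>
    ⟨fun t => comp ((Module.finBasis ℝ Y).coord j) (w t - body (w t) ⊗ₜ 1), ⟨_, hξ j⟩, (h0 _).1⟩
  have hat : ∀ (t : ℝ) (K : ℕ) (h : SF Y),
      curveAlg.at t (expSum (fun j => SF.dj j) c ξ K h) = expSum (fun j => SF.dj j)
        (SF.ev (ExteriorAlgebra ℝ M) (body (w t)))
        (fun j => comp ((Module.finBasis ℝ Y).coord j) (w t - body (w t) ⊗ₜ 1)) K h :=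
    fun t K h => expSum_map _ _ _ _ _ _
  have key := derivation_expSum (fun j => SF.dj j) SF.dj_comm c ξ b (curveAlg.at 0)
    (fun s a => evenPart_central s.2.2 a) curveAlg.deriv
    (fun s s' => ((curveAlg.hasWDeriv s).bilin (curveAlg.hasWDeriv s')
      (LinearMap.mul ℝ _)).wderiv_eq)
    (fun h => by
      rw [hc]
      conv_lhs => rw [← (Module.finBasis ℝ Y).sum_repr (body w')]
      rw [map_sum, map_sum]
      refine Finset.sum_congr rfl fun j _ => ?_
      rw [hb, map_smul, smul_eq_mul, mul_comm, map_mul]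
      rfl) D (SF.comp l hg)
  have hval : (fun t => comp l (TwoBundle.value (D + 1) g (w t)))
      = (expSum (fun j => SF.dj j) c ξ (D + 1) (SF.comp l hg)).1 := by
    funext t
    rw [TwoBundle.value, comp_taylor (D + 1) hg, ← hat]
    rfl
  rw [hval]
  have hfin : comp l (app (TwoBundle.value D (fderiv ℝ f) (w 0)) w')
      = curveAlg.deriv (expSum (fun j => SF.dj j) c ξ (D + 1) (SF.comp l hg)) := by
    rw [key, comp_app (Module.finBasis ℝ Y), ← Finset.sum_add_distrib]
    refine Finset.sum_congr rfl fun j _ => ?_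
    rw [hat, hat, SF.dj_comp j l hg hg', ← comp_taylor (D + 1) hg', ← comp_taylor D hg',
      h0.taylor_of_le hD (Nat.le_succ D) (Eventually.of_forall fun z => hg'.contDiffAt), ← mul_add,
      TwoBundle.value, taylor_congr hfg.fderiv]
    congr 1
    have h1 : curveAlg.deriv (ξ j) = comp ((Module.finBasis ℝ Y).coord j) (w' - body w' ⊗ₜ 1) :=
      (hξ j).wderiv_eq
    rw [hb, h1, map_sub, comp_tmul, ← Algebra.algebraMap_eq_smul_one, add_sub_cancel]
  rw [hfin]
  exact curveAlg.hasWDeriv _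

end WeakDerivative

/-! ### Manifold valued points as values of smooth maps -/

section LinTaylor

open ExteriorAlgebra

variable {M : Type*} [AddCommGroup M] [Module ℝ M] [FiniteDimensional ℝ M]
  {Y V W : Type*} [NormedAddCommGroup Y] [NormedSpace ℝ Y] [FiniteDimensional ℝ Y]
  [NormedAddCommGroup V] [NormedSpace ℝ V] [FiniteDimensional ℝ V]
  [NormedAddCommGroup W] [NormedSpace ℝ W] [FiniteDimensional ℝ W]
  {w : Y ⊗[ℝ] ExteriorAlgebra ℝ M} (hw : IsSoul w) {y : Y}
  {D : ℕ} (hD : Module.finrank ℝ M ≤ D)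

section Lin

variable {V V' A : Type*} [AddCommGroup V] [Module ℝ V] [AddCommGroup V'] [Module ℝ V']
  [Ring A] [Algebra ℝ A]

@[simp] lemma lin_tmul (L : V →ₗ[ℝ] V') (v : V) (a : A) : lin L (v ⊗ₜ[ℝ] a) = L v ⊗ₜ a := rfl

lemma lin_add (L : V →ₗ[ℝ] V') (u v : V ⊗[ℝ] A) : lin L (u + v) = lin L u + lin L v :=
  map_add (LinearMap.rTensor A L) u v

lemma lin_sub (L : V →ₗ[ℝ] V') (u v : V ⊗[ℝ] A) : lin L (u - v) = lin L u - lin L v :=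
  map_sub (LinearMap.rTensor A L) u v

@[simp] lemma lin_zero (L : V →ₗ[ℝ] V') : lin L (0 : V ⊗[ℝ] A) = 0 :=
  map_zero (LinearMap.rTensor A L)

@[simp] lemma lin_fst_pair (u : V ⊗[ℝ] A) (v : V' ⊗[ℝ] A) :
    lin (LinearMap.fst ℝ V V') (lin (LinearMap.inl ℝ V V') u + lin (LinearMap.inr ℝ V V') v)
      = u := by
  simp only [lin, map_add, ← LinearMap.rTensor_comp_apply]
  simp

@[simp] lemma lin_snd_pair (u : V ⊗[ℝ] A) (v : V' ⊗[ℝ] A) :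
    lin (LinearMap.snd ℝ V V') (lin (LinearMap.inl ℝ V V') u + lin (LinearMap.inr ℝ V V') v)
      = v := by
  simp only [lin, map_add, ← LinearMap.rTensor_comp_apply]
  simp

lemma lin_pair_eta (u : (V × V') ⊗[ℝ] A) :
    lin (LinearMap.inl ℝ V V') (lin (LinearMap.fst ℝ V V') u)
      + lin (LinearMap.inr ℝ V V') (lin (LinearMap.snd ℝ V V') u) = u := by
  simp only [lin, ← LinearMap.rTensor_comp_apply, ← LinearMap.add_apply, ← LinearMap.rTensor_add]
  have : LinearMap.inl ℝ V V' ∘ₗ LinearMap.fst ℝ V V'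
      + LinearMap.inr ℝ V V' ∘ₗ LinearMap.snd ℝ V V' = LinearMap.id := by ext <;> simp
  rw [this, LinearMap.rTensor_id]
  rfl

end Lin

include hw hD in
lemma IsSoul.lin_taylor (L : V →L[ℝ] W) {f : Y → V} (hf : SmoothNear f y) :
    lin (L : V →ₗ[ℝ] W) (taylor D f y w) = taylor D (fun z => L (f z)) y w := by
  rw [← hw.taylor_comp hD hf (φ := L) (Filter.Eventually.of_forall fun z => L.contDiff.contDiffAt),
    (hw.taylor_sub D hf).taylor_clm hD, lin_sub, lin_tmul]
  simp

include hw hD in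
lemma IsSoul.taylor_comp_clm (L : Y →L[ℝ] V) {f : V → W} (hf : SmoothNear f (L y)) :
    taylor D (fun z => f (L z)) y w = taylor D f (L y) (lin (L : Y →ₗ[ℝ] V) w) := by
  rw [← hw.taylor_comp hD (ψ := L) (Filter.Eventually.of_forall fun z => L.contDiff.contDiffAt) hf,
    hw.taylor_clm hD, add_sub_cancel_left]

include hw hD in
lemma IsSoul.taylor_prodMk {f : Y → V} {g : Y → W} (hf : SmoothNear f y) (hg : SmoothNear g y) :
    taylor D (fun z => (f z, g z)) y w = lin (LinearMap.inl ℝ V W) (taylor D f y w)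
      + lin (LinearMap.inr ℝ V W) (taylor D g y w) := by
  have hfg : SmoothNear (fun z => (f z, g z)) y := by
    filter_upwards [hf, hg] with z h1 h2 using h1.prodMk h2
  rw [← lin_pair_eta (taylor D (fun z => (f z, g z)) y w)]
  congr 2
  · exact hw.lin_taylor hD (ContinuousLinearMap.fst ℝ V W) hfg
  · exact hw.lin_taylor hD (ContinuousLinearMap.snd ℝ V W) hfg

include hw hD in
lemma IsSoul.taylor_add {f g : Y → V} (hf : SmoothNear f y) (hg : SmoothNear g y) :
    taylor D (fun z => f z + g z) y w = taylor D f y w + taylor D g y w := by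
  have hfg : SmoothNear (fun z => (f z, g z)) y := by
    filter_upwards [hf, hg] with z h1 h2 using h1.prodMk h2
  have h := hw.lin_taylor hD
    (ContinuousLinearMap.fst ℝ V V + ContinuousLinearMap.snd ℝ V V) hfg
  rw [hw.taylor_prodMk hD hf hg] at h
  refine h.symm.trans ?_
  simp only [lin, map_add, ← LinearMap.rTensor_comp_apply]
  rw [show ((ContinuousLinearMap.fst ℝ V V + ContinuousLinearMap.snd ℝ V V : V × V →L[ℝ] V) :
      V × V →ₗ[ℝ] V) ∘ₗ LinearMap.inl ℝ V V = LinearMap.id by ext; simp,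
    show ((ContinuousLinearMap.fst ℝ V V + ContinuousLinearMap.snd ℝ V V : V × V →L[ℝ] V) :
      V × V →ₗ[ℝ] V) ∘ₗ LinearMap.inr ℝ V V = LinearMap.id by ext; simp]
  simp

omit [FiniteDimensional ℝ Y] [FiniteDimensional ℝ V] [FiniteDimensional ℝ W] in
lemma app_const_tmul_one {A : Type*} [Ring A] [Algebra ℝ A] (L : V →L[ℝ] W) (u : V ⊗[ℝ] A) :
    app (L ⊗ₜ[ℝ] (1 : A)) u = lin (L : V →ₗ[ℝ] W) u := by
  induction u using TensorProduct.induction_on with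
  | zero => simp
  | tmul v a => simp
  | add x y hx hy => rw [app_add, hx, hy, lin_add]

end LinTaylor

section Points

variable {EX F : Type*} [NormedAddCommGroup EX] [NormedSpace ℝ EX] [FiniteDimensional ℝ EX]
  [NormedAddCommGroup F] [NormedSpace ℝ F] [FiniteDimensional ℝ F] {N : ℕ}
  {EK K EK' K' EK'' K'' EL L W : Type*}
  [NormedAddCommGroup EK] [NormedSpace ℝ EK] [FiniteDimensional ℝ EK]
  [TopologicalSpace K] [ChartedSpace EK K] [IsManifold 𝓘(ℝ, EK) ∞ K]
  [NormedAddCommGroup EK'] [NormedSpace ℝ EK'] [FiniteDimensional ℝ EK']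
  [TopologicalSpace K'] [ChartedSpace EK' K'] [IsManifold 𝓘(ℝ, EK') ∞ K']
  [NormedAddCommGroup EK''] [NormedSpace ℝ EK''] [FiniteDimensional ℝ EK'']
  [TopologicalSpace K''] [ChartedSpace EK'' K''] [IsManifold 𝓘(ℝ, EK'') ∞ K'']
  [NormedAddCommGroup EL] [NormedSpace ℝ EL] [FiniteDimensional ℝ EL]
  [TopologicalSpace L] [ChartedSpace EL L] [IsManifold 𝓘(ℝ, EL) ∞ L]
  [NormedAddCommGroup W] [NormedSpace ℝ W] [FiniteDimensional ℝ W]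
  {Y Z : Type*} [NormedAddCommGroup Y] [NormedSpace ℝ Y] [FiniteDimensional ℝ Y]
  [NormedAddCommGroup Z] [NormedSpace ℝ Z] [FiniteDimensional ℝ Z]

variable (EK EL) in
/-- `f` is smooth at all points near `k`. -/
def MNear (f : K → L) (k : K) : Prop :=
  ∀ᶠ x in nhds k, ContMDiffAt 𝓘(ℝ, EK) 𝓘(ℝ, EL) ∞ f x

omit [FiniteDimensional ℝ Y] [FiniteDimensional ℝ W] in
lemma MNear.smoothNear {f : Y → W} {y : Y} (h : MNear Y W f y) : SmoothNear f y :=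
  h.mono fun _ hz => hz.contDiffAt

omit [FiniteDimensional ℝ EK] [FiniteDimensional ℝ EK'] [FiniteDimensional ℝ EL]
  [IsManifold 𝓘(ℝ, EK) ∞ K] [IsManifold 𝓘(ℝ, EK') ∞ K'] [IsManifold 𝓘(ℝ, EL) ∞ L] in
lemma MNear.comp {φ : K' → L} {c : K → K'} {k : K} (hφ : MNear EK' EL φ (c k))
    (hc : MNear EK EK' c k) : MNear EK EL (fun z => φ (c z)) k := by
  filter_upwards [hc, hc.self_of_nhds.continuousAt.eventually hφ] with z h1 h2
  exact ContMDiffAt.comp z h2 h1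

omit [FiniteDimensional ℝ EK] [FiniteDimensional ℝ EK'] [FiniteDimensional ℝ EL]
  [FiniteDimensional ℝ Y]
  [IsManifold 𝓘(ℝ, EK) ∞ K] [IsManifold 𝓘(ℝ, EK') ∞ K'] [IsManifold 𝓘(ℝ, EL) ∞ L] in
lemma MNear.comp₂ {φ : K → K' → L}
    (hφ : ContMDiff (𝓘(ℝ, EK).prod 𝓘(ℝ, EK')) 𝓘(ℝ, EL) ∞ fun p : K × K' => φ p.1 p.2)
    {c : Y → K} {c' : Y → K'} {y : Y} (hc : MNear Y EK c y) (hc' : MNear Y EK' c' y) :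
    MNear Y EL (fun z => φ (c z) (c' z)) y := by
  filter_upwards [hc, hc'] with z h1 h2
  exact ContMDiffAt.comp z (hφ (c z, c' z)) (h1.prodMk h2)

omit [FiniteDimensional ℝ EK] [FiniteDimensional ℝ EL]
  [IsManifold 𝓘(ℝ, EK) ∞ K] [IsManifold 𝓘(ℝ, EL) ∞ L] in
lemma ContMDiff.mNear {φ : K → L} (h : ContMDiff 𝓘(ℝ, EK) 𝓘(ℝ, EL) ∞ φ) (k : K) :
    MNear EK EL φ k := Filter.Eventually.of_forall fun z => h z

omit [FiniteDimensional ℝ EK] in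
lemma mNear_ch {k k' : K} (h : k' ∈ (ch (EK := EK) k).source) :
    MNear EK EK (ch (EK := EK) k) k' := by
  filter_upwards [(isOpen_extChartAt_source k).mem_nhds h] with z hz
  exact contMDiffAt_extChartAt' (by simpa using hz)

omit [FiniteDimensional ℝ EK] [IsManifold 𝓘(ℝ, EK) ∞ K] in
lemma isOpen_ch_target (k : K) : IsOpen (ch (EK := EK) k).target := isOpen_extChartAt_target k

omit [FiniteDimensional ℝ EK] [IsManifold 𝓘(ℝ, EK) ∞ K] in
lemma ch_target_mem_nhds {k : K} {z : EK} (h : z ∈ (ch (EK := EK) k).target) :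
    (ch (EK := EK) k).target ∈ nhds z := (isOpen_ch_target k).mem_nhds h

omit [FiniteDimensional ℝ EK] in
lemma mNear_ch_symm {k : K} {z : EK} (h : z ∈ (ch (EK := EK) k).target) :
    MNear EK EK (ch (EK := EK) k).symm z := by
  filter_upwards [ch_target_mem_nhds h] with z hz
  exact (contMDiffOn_extChartAt_symm k).contMDiffAt (ch_target_mem_nhds hz)

omit [FiniteDimensional ℝ EK] [IsManifold 𝓘(ℝ, EK) ∞ K] in
@[simp] lemma ch_symm_self (k : K) : (ch (EK := EK) k).symm (ch k k) = k :=
  extChartAt_to_inv k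

omit [FiniteDimensional ℝ EK] [IsManifold 𝓘(ℝ, EK) ∞ K] in
lemma ch_self_mem_target (k : K) : ch (EK := EK) k k ∈ (ch (EK := EK) k).target :=
  mem_extChartAt_target k

omit [FiniteDimensional ℝ EK] in
lemma mNear_ch_symm_self (k : K) : MNear EK EK (ch (EK := EK) k).symm (ch k k) :=
  mNear_ch_symm (ch_self_mem_target k)

omit [FiniteDimensional ℝ EK] in
lemma mNear_ch_self (k : K) : MNear EK EK (ch (EK := EK) k) k := mNear_ch (mem_extChartAt_source k)

omit [FiniteDimensional ℝ Y] [FiniteDimensional ℝ EK] in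
lemma MNear.ch_comp {c : Y → K} {y : Y} (hc : MNear Y EK c y) {k : K}
    (h : c y ∈ (ch (EK := EK) k).source) : SmoothNear (fun z => ch (EK := EK) k (c z)) y :=
  ((mNear_ch h).comp hc).smoothNear

/-- The displacement of `p` is even and nilpotent, as for the values of internal functions of
degree `0`. -/
def Pt.Good (p : Pt K EK EX F N) : Prop := IsSoul p.2

/-- The value at `y + w` of a smooth map `c` into a manifold. -/
def push (c : Y → K) (y : Y) (w : Y ⊗[ℝ] Gr EX F N) : Pt K EK EX F N :=
  (c y, taylor (oddDim EX F N) (fun z => ch (EK := EK) (c y) (c z)) y w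
    - ch (c y) (c y) ⊗ₜ 1)

variable {w : Y ⊗[ℝ] Gr EX F N} (hw : IsSoul w) {y : Y}

include hw in
omit [FiniteDimensional ℝ EX] [FiniteDimensional ℝ F] in
lemma push_good {c : Y → K} (hc : MNear Y EK c y) : (push (EK := EK) c y w).Good :=
  hw.taylor_sub _ (hc.ch_comp (mem_extChartAt_source (c y)))

include hw in
/-- Functoriality of Taylor expansions: evaluating `φ` at `c(y + w)` is evaluating `φ ∘ c` at
`y + w`. In particular the chart in which the displacement is read is immaterial. -/
lemma eval_push {c : Y → K} (hc : MNear Y EK c y) {φ : K → W} (hφ : MNear EK W φ (c y)) :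
    Pt.eval φ (push (EK := EK) c y w) = taylor (oddDim EX F N) (fun z => φ (c z)) y w := by
  have hsm : SmoothNear (fun z => φ ((ch (EK := EK) (c y)).symm z)) (ch (c y) (c y)) := by
    refine (MNear.comp (φ := φ) ?_ (mNear_ch_symm_self (c y))).smoothNear
    rwa [ch_symm_self]
  have h := hw.taylor_comp (D := oddDim EX F N) le_rfl
    (hc.ch_comp (mem_extChartAt_source (c y))) hsm
  rw [Pt.eval]
  refine h.trans (taylor_congr ?_ w)
  filter_upwards [hc.self_of_nhds.continuousAt.eventually
    ((isOpen_extChartAt_source (I := 𝓘(ℝ, EK)) (c y)).mem_nhds (mem_extChartAt_source (c y)))]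
    with z hz
  rw [(ch (EK := EK) (c y)).left_inv hz]

include hw in
lemma map_push {c : Y → K} (hc : MNear Y EK c y) {φ : K → L}
    (hφ : ContMDiff 𝓘(ℝ, EK) 𝓘(ℝ, EL) ∞ φ) :
    Pt.map φ (push (EK := EK) c y w) = push (EK := EL) (fun z => φ (c z)) y w := by
  refine Prod.ext rfl ?_
  change Pt.eval (fun k => ch (EK := EL) (φ (c y)) (φ k)) (push (EK := EK) c y w) - _ = _
  rw [eval_push hw hc ((mNear_ch_self _).comp (ContMDiff.mNear hφ _))]
  rfl

include hw in
lemma eval₂_push {c : Y → K} {c' : Y → K'} (hc : MNear Y EK c y) (hc' : MNear Y EK' c' y)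
    {φ : K → K' → W}
    (hφ : MNear (EK × EK') W (fun z : EK × EK' => φ ((ch (EK := EK) (c y)).symm z.1)
      ((ch (EK := EK') (c' y)).symm z.2)) (ch (c y) (c y), ch (c' y) (c' y))) :
    Pt.eval₂ φ (push (EK := EK) c y w) (push (EK := EK') c' y w)
      = taylor (oddDim EX F N) (fun z => φ (c z) (c' z)) y w := by
  have h1 := hc.ch_comp (mem_extChartAt_source (I := 𝓘(ℝ, EK)) (c y))
  have h2 := hc'.ch_comp (mem_extChartAt_source (I := 𝓘(ℝ, EK')) (c' y))
  have h12 : SmoothNear (fun z => (ch (EK := EK) (c y) (c z), ch (EK := EK') (c' y) (c' z))) y := by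
    filter_upwards [h1, h2] with z h1 h2 using h1.prodMk h2
  have h := hw.taylor_comp (D := oddDim EX F N) le_rfl h12 hφ.smoothNear
  rw [hw.taylor_prodMk (D := oddDim EX F N) le_rfl h1 h2] at h
  rw [Pt.eval₂]
  have e : lin (LinearMap.inl ℝ EK EK') (push (EK := EK) c y w).2
      + lin (LinearMap.inr ℝ EK EK') (push (EK := EK') c' y w).2
      = lin (LinearMap.inl ℝ EK EK') (taylor (oddDim EX F N) (fun z => ch (c y) (c z)) y w)
        + lin (LinearMap.inr ℝ EK EK') (taylor (oddDim EX F N) (fun z => ch (c' y) (c' z)) y w)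
        - (ch (c y) (c y), ch (c' y) (c' y)) ⊗ₜ 1 := by
    simp only [push, lin_sub, lin_tmul, LinearMap.inl_apply, LinearMap.inr_apply]
    rw [sub_add_sub_comm, ← TensorProduct.add_tmul]
    simp
  rw [e]
  refine h.trans (taylor_congr ?_ w)
  filter_upwards [hc.self_of_nhds.continuousAt.eventually
      ((isOpen_extChartAt_source (I := 𝓘(ℝ, EK)) (c y)).mem_nhds (mem_extChartAt_source (c y))),
    hc'.self_of_nhds.continuousAt.eventually
      ((isOpen_extChartAt_source (I := 𝓘(ℝ, EK')) (c' y)).mem_nhds (mem_extChartAt_source (c' y)))]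
    with z hz hz'
  rw [(ch (EK := EK) (c y)).left_inv hz, (ch (EK := EK') (c' y)).left_inv hz']

omit [FiniteDimensional ℝ EK] [FiniteDimensional ℝ EK'] [FiniteDimensional ℝ EL]
  [IsManifold 𝓘(ℝ, EL) ∞ L] in
lemma mNear_chart_pair {φ : K → K' → L}
    (hφ : ContMDiff (𝓘(ℝ, EK).prod 𝓘(ℝ, EK')) 𝓘(ℝ, EL) ∞ fun p : K × K' => φ p.1 p.2) (k : K)
    (k' : K') : MNear (EK × EK') EL (fun z : EK × EK' => φ ((ch (EK := EK) k).symm z.1)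
      ((ch (EK := EK') k').symm z.2)) (ch k k, ch k' k') := by
  refine MNear.comp₂ hφ ?_ ?_
  · exact (mNear_ch_symm_self k).comp (c := Prod.fst)
      (k := (ch (EK := EK) k k, ch (EK := EK') k' k'))
      (Filter.Eventually.of_forall fun z => contDiff_fst.contMDiff z)
  · exact (mNear_ch_symm_self k').comp (c := Prod.snd)
      (k := (ch (EK := EK) k k, ch (EK := EK') k' k'))
      (Filter.Eventually.of_forall fun z => contDiff_snd.contMDiff z)

include hw in
lemma map₂_push {c : Y → K} {c' : Y → K'} (hc : MNear Y EK c y) (hc' : MNear Y EK' c' y)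
    {φ : K → K' → L}
    (hφ : ContMDiff (𝓘(ℝ, EK).prod 𝓘(ℝ, EK')) 𝓘(ℝ, EL) ∞ fun p : K × K' => φ p.1 p.2) :
    Pt.map₂ φ (push (EK := EK) c y w) (push (EK := EK') c' y w)
      = push (EK := EL) (fun z => φ (c z) (c' z)) y w := by
  refine Prod.ext rfl ?_
  change Pt.eval₂ (fun k k' => ch (EK := EL) (φ (c y) (c' y)) (φ k k')) (push (EK := EK) c y w)
    (push (EK := EK') c' y w) - _ = _
  rw [eval₂_push hw hc hc']
  · rfl
  · refine MNear.comp (φ := ch (EK := EL) (φ (c y) (c' y))) ?_ (mNear_chart_pair hφ (c y) (c' y))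
    simp only [ch_symm_self]
    exact mNear_ch_self _

lemma push_symm {p : Pt K EK EX F N} (hp : p.Good) :
    push (EK := EK) (ch (EK := EK) p.1).symm (ch p.1 p.1) p.2 = p := by
  refine Prod.ext (ch_symm_self p.1) ?_
  change taylor _ (fun z => ch ((ch p.1).symm (ch p.1 p.1)) ((ch p.1).symm z)) _ _
    - ch ((ch p.1).symm (ch p.1 p.1)) ((ch p.1).symm (ch p.1 p.1)) ⊗ₜ[ℝ] 1 = p.2
  rw [ch_symm_self]
  have : (fun z => ch (EK := EK) p.1 ((ch (EK := EK) p.1).symm z)) =ᶠ[nhds (ch p.1 p.1)]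
      fun z => z := by
    filter_upwards [ch_target_mem_nhds (ch_self_mem_target p.1)] with z hz
    exact (ch (EK := EK) p.1).right_inv hz
  rw [taylor_congr this, IsSoul.taylor_id hp (D := oddDim EX F N) le_rfl, add_sub_cancel_left]

include hw in
lemma push_clm (A : Y →L[ℝ] Z) {c : Z → K} (hc : MNear Z EK c (A y)) :
    push (EK := EK) (fun z => c (A z)) y w = push c (A y) (lin (A : Y →ₗ[ℝ] Z) w) := by
  refine Prod.ext rfl ?_
  change taylor _ (fun z => ch (c (A y)) (c (A z))) y w - _ = taylor _ _ _ _ - _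
  rw [hw.taylor_comp_clm (D := oddDim EX F N) le_rfl A (f := fun z => ch (c (A y)) (c z))
    (hc.ch_comp (mem_extChartAt_source _))]

/-- The base point of the joint representation of two points. -/
abbrev pairBase (p : Pt K EK EX F N) (q : Pt K' EK' EX F N) : EK × EK' :=
  (ch p.1 p.1, ch q.1 q.1)

/-- The displacement of the joint representation of two points. -/
abbrev pairSoul (p : Pt K EK EX F N) (q : Pt K' EK' EX F N) : (EK × EK') ⊗[ℝ] Gr EX F N :=
  lin (LinearMap.inl ℝ EK EK') p.2 + lin (LinearMap.inr ℝ EK EK') q.2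

omit [FiniteDimensional ℝ EX] [FiniteDimensional ℝ F] [FiniteDimensional ℝ EK]
  [FiniteDimensional ℝ EK'] [TopologicalSpace K] [ChartedSpace EK K] [IsManifold 𝓘(ℝ, EK) ∞ K]
  [TopologicalSpace K'] [ChartedSpace EK' K'] [IsManifold 𝓘(ℝ, EK') ∞ K'] in
lemma pairSoul_isSoul {p : Pt K EK EX F N} {q : Pt K' EK' EX F N} (hp : p.Good) (hq : q.Good) :
    IsSoul (pairSoul p q) := IsSoul.add (IsSoul.lin_apply hp _) (IsSoul.lin_apply hq _)

lemma push_pair_fst {p : Pt K EK EX F N} {q : Pt K' EK' EX F N} (hp : p.Good) (hq : q.Good) :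
    push (EK := EK) (fun z : EK × EK' => (ch (EK := EK) p.1).symm z.1) (pairBase p q)
      (pairSoul p q) = p := by
  have h := push_clm (pairSoul_isSoul hp hq) (y := pairBase p q) (ContinuousLinearMap.fst ℝ EK EK')
    (mNear_ch_symm_self p.1)
  rw [ContinuousLinearMap.coe_fst, lin_fst_pair] at h
  exact h.trans (push_symm hp)

lemma push_pair_snd {p : Pt K EK EX F N} {q : Pt K' EK' EX F N} (hp : p.Good) (hq : q.Good) :
    push (EK := EK') (fun z : EK × EK' => (ch (EK := EK') q.1).symm z.2) (pairBase p q)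
      (pairSoul p q) = q := by
  have h := push_clm (pairSoul_isSoul hp hq) (y := pairBase p q) (ContinuousLinearMap.snd ℝ EK EK')
    (mNear_ch_symm_self q.1)
  rw [ContinuousLinearMap.coe_snd, lin_snd_pair] at h
  exact h.trans (push_symm hq)

omit [FiniteDimensional ℝ EK] [FiniteDimensional ℝ EK'] in
lemma mNear_pair_fst (k : K) (k' : K') : MNear (EK × EK') EK
    (fun z : EK × EK' => (ch (EK := EK) k).symm z.1) (ch k k, ch (EK := EK') k' k') :=
  (mNear_ch_symm_self k).comp (c := Prod.fst) (k := (ch (EK := EK) k k, ch (EK := EK') k' k'))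
      (Filter.Eventually.of_forall fun z => contDiff_fst.contMDiff z)

omit [FiniteDimensional ℝ EK] [FiniteDimensional ℝ EK'] in
lemma mNear_pair_snd (k : K) (k' : K') : MNear (EK × EK') EK'
    (fun z : EK × EK' => (ch (EK := EK') k').symm z.2) (ch (EK := EK) k k, ch k' k') :=
  (mNear_ch_symm_self k').comp (c := Prod.snd) (k := (ch (EK := EK) k k, ch (EK := EK') k' k'))
      (Filter.Eventually.of_forall fun z => contDiff_snd.contMDiff z)

/-- Three points are values at the same point of three smooth maps on a vector space. Through this,
identities between operations on points follow from the identities between the maps. -/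
lemma exists_push₃ {p : Pt K EK EX F N} {q : Pt K' EK' EX F N} {r : Pt K'' EK'' EX F N}
    (hp : p.Good) (hq : q.Good) (hr : r.Good) :
    ∃ (y : EK × EK' × EK'') (w : (EK × EK' × EK'') ⊗[ℝ] Gr EX F N) (c : EK × EK' × EK'' → K)
      (c' : EK × EK' × EK'' → K') (c'' : EK × EK' × EK'' → K''), IsSoul w ∧
      MNear (EK × EK' × EK'') EK c y ∧ MNear (EK × EK' × EK'') EK' c' y ∧
      MNear (EK × EK' × EK'') EK'' c'' y ∧
      p = push (EK := EK) c y w ∧ q = push (EK := EK') c' y w ∧ r = push (EK := EK'') c'' y w := by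
  let qr : Pt (EK' × EK'') (EK' × EK'') EX F N := (pairBase q r, pairSoul q r)
  have hqr : qr.Good := pairSoul_isSoul hq hr
  let A := ContinuousLinearMap.snd ℝ EK (EK' × EK'')
  have hA : ∀ y, MNear (EK × EK' × EK'') (EK' × EK'') A y :=
    fun y => Filter.Eventually.of_forall fun z => A.contDiff.contMDiff z
  refine ⟨(ch p.1 p.1, pairBase q r), pairSoul p qr, fun z => (ch (EK := EK) p.1).symm z.1,
    fun z => (ch (EK := EK') q.1).symm (A z).1, fun z => (ch (EK := EK'') r.1).symm (A z).2,
    pairSoul_isSoul hp hqr, ?_, ?_, ?_, ?_, ?_, ?_⟩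
  · exact mNear_pair_fst p.1 qr.1
  · exact (mNear_pair_fst q.1 r.1).comp (c := A) (hA (ch p.1 p.1, pairBase q r))
  · exact (mNear_pair_snd q.1 r.1).comp (c := A) (hA (ch p.1 p.1, pairBase q r))
  · exact (push_pair_fst hp hqr).symm
  · rw [push_clm (pairSoul_isSoul hp hqr) A (y := (ch p.1 p.1, pairBase q r))
      (c := fun z => (ch (EK := EK') q.1).symm z.1) (mNear_pair_fst q.1 r.1)]
    rw [show lin (A : EK × EK' × EK'' →ₗ[ℝ] EK' × EK'') (pairSoul p qr) = qr.2 from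
      lin_snd_pair _ _]
    exact (push_pair_fst hq hr).symm
  · rw [push_clm (pairSoul_isSoul hp hqr) A (y := (ch p.1 p.1, pairBase q r))
      (c := fun z => (ch (EK := EK'') r.1).symm z.2) (mNear_pair_snd q.1 r.1)]
    rw [show lin (A : EK × EK' × EK'' →ₗ[ℝ] EK' × EK'') (pairSoul p qr) = qr.2 from
      lin_snd_pair _ _]
    exact (push_pair_snd hq hr).symm

end Points

/-! ### Derivatives of maps between manifolds in given charts -/

section ChartDeriv

variable {EK K EK' K' EL L W : Type*}
  [NormedAddCommGroup EK] [NormedSpace ℝ EK] [FiniteDimensional ℝ EK]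
  [TopologicalSpace K] [ChartedSpace EK K] [IsManifold 𝓘(ℝ, EK) ∞ K]
  [NormedAddCommGroup EK'] [NormedSpace ℝ EK'] [FiniteDimensional ℝ EK']
  [TopologicalSpace K'] [ChartedSpace EK' K'] [IsManifold 𝓘(ℝ, EK') ∞ K']
  [NormedAddCommGroup EL] [NormedSpace ℝ EL] [FiniteDimensional ℝ EL]
  [TopologicalSpace L] [ChartedSpace EL L] [IsManifold 𝓘(ℝ, EL) ∞ L]

variable (EK EL) in
/-- The derivative of `f` at `h`, in the charts at `c` and `d`. -/
def chD (c : K) (d : L) (f : K → L) (h : K) : EK →L[ℝ] EL :=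
  fderiv ℝ (fun z => ch (EK := EL) d (f ((ch (EK := EK) c).symm z))) (ch c h)

lemma chRep_contDiffAt {c h : K} {d : L} {f : K → L} (hf : ContMDiffAt 𝓘(ℝ, EK) 𝓘(ℝ, EL) ∞ f h)
    (hc : h ∈ (ch (EK := EK) c).source) (hd : f h ∈ (ch (EK := EL) d).source) :
    ContDiffAt ℝ ∞ (fun z => ch (EK := EL) d (f ((ch (EK := EK) c).symm z))) (ch c h) := by
  have e : (ch (EK := EK) c).symm (ch c h) = h := (ch c).left_inv hc
  refine ContMDiffAt.contDiffAt ?_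
  have h1 := (mNear_ch_symm ((ch (EK := EK) c).map_source hc)).self_of_nhds
  have h2 := (mNear_ch hd).self_of_nhds
  refine ContMDiffAt.comp (I' := 𝓘(ℝ, EL)) (ch (EK := EK) c h) (g := ch (EK := EL) d)
    (f := fun z => f ((ch (EK := EK) c).symm z)) (by rwa [e]) ?_
  exact ContMDiffAt.comp (I' := 𝓘(ℝ, EK)) (ch (EK := EK) c h) (g := f)
    (f := (ch (EK := EK) c).symm) (by rwa [e]) h1

lemma chRep_differentiableAt {c h : K} {d : L} {f : K → L}
    (hf : ContMDiffAt 𝓘(ℝ, EK) 𝓘(ℝ, EL) ∞ f h)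
    (hc : h ∈ (ch (EK := EK) c).source) (hd : f h ∈ (ch (EK := EL) d).source) :
    DifferentiableAt ℝ (fun z => ch (EK := EL) d (f ((ch (EK := EK) c).symm z))) (ch c h) :=
  (chRep_contDiffAt hf hc hd).differentiableAt (by simp)

lemma mfderiv_eq_chD {f : K → L} {k : K} (hf : ContMDiffAt 𝓘(ℝ, EK) 𝓘(ℝ, EL) ∞ f k) :
    (mfderiv 𝓘(ℝ, EK) 𝓘(ℝ, EL) f k : EK →L[ℝ] EL) = chD EK EL k (f k) f k := by
  have h : mfderiv 𝓘(ℝ, EK) 𝓘(ℝ, EL) f k = fderivWithin ℝ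
      (writtenInExtChartAt 𝓘(ℝ, EK) 𝓘(ℝ, EL) k f) (Set.range 𝓘(ℝ, EK)) (ch (EK := EK) k k) :=
    (hf.mdifferentiableAt (by simp)).mfderiv
  refine h.trans ?_
  rw [modelWithCornersSelf_coe, Set.range_id, fderivWithin_univ]
  rfl

lemma chD_congr {c : K} {d : L} {f g : K → L} {h : K} (hc : h ∈ (ch (EK := EK) c).source)
    (hfg : f =ᶠ[nhds h] g) : chD EK EL c d f h = chD EK EL c d g h := by
  refine Filter.EventuallyEq.fderiv_eq ?_
  have h1 : ContinuousAt (ch (EK := EK) c).symm (ch c h) :=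
    (mNear_ch_symm ((ch (EK := EK) c).map_source hc)).self_of_nhds.continuousAt
  rw [ContinuousAt, (ch (EK := EK) c).left_inv hc] at h1
  filter_upwards [h1.eventually hfg] with z hz
  rw [hz]

lemma chD_comp {c h : K} {d : K'} {e : L} {f : K → K'} {g : K' → L}
    (hf : ContMDiffAt 𝓘(ℝ, EK) 𝓘(ℝ, EK') ∞ f h) (hg : ContMDiffAt 𝓘(ℝ, EK') 𝓘(ℝ, EL) ∞ g (f h))
    (hc : h ∈ (ch (EK := EK) c).source) (hd : f h ∈ (ch (EK := EK') d).source)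
    (he : g (f h) ∈ (ch (EK := EL) e).source) :
    chD EK EL c e (fun k => g (f k)) h = (chD EK' EL d e g (f h)).comp (chD EK EK' c d f h) := by
  have e1 : (ch (EK := EK) c).symm (ch c h) = h := (ch c).left_inv hc
  have h1 := chRep_differentiableAt hf hc hd
  have h2 := chRep_differentiableAt hg hd he
  have h3 : chD EK EL c e (fun k => g (f k)) h = fderiv ℝ
      ((fun z => ch (EK := EL) e (g ((ch (EK := EK') d).symm z))) ∘
        fun z => ch (EK := EK') d (f ((ch (EK := EK) c).symm z))) (ch c h) := by
    refine Filter.EventuallyEq.fderiv_eq ?_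
    have h4 : ContinuousAt (fun z => f ((ch (EK := EK) c).symm z)) (ch c h) := by
      refine ContinuousAt.comp (g := f) ?_
        (mNear_ch_symm ((ch (EK := EK) c).map_source hc)).self_of_nhds.continuousAt
      rw [e1]; exact hf.continuousAt
    have h5 : ∀ᶠ x in nhds (f ((ch (EK := EK) c).symm (ch c h))),
        x ∈ (ch (EK := EK') d).source := by
      rw [e1]; exact (isOpen_extChartAt_source d).mem_nhds hd
    filter_upwards [h4.eventually h5] with z hz
    simp only [Function.comp]
    rw [(ch (EK := EK') d).left_inv hz]
  rw [h3, fderiv_comp _ (by simpa only [e1] using h2) h1]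
  simp only [e1]
  rfl

lemma chD_id {c h : K} (hc : h ∈ (ch (EK := EK) c).source) :
    chD EK EK c c (fun k => k) h = ContinuousLinearMap.id ℝ EK := by
  rw [chD, ← fderiv_id (𝕜 := ℝ) (x := ch (EK := EK) c h)]
  refine Filter.EventuallyEq.fderiv_eq ?_
  filter_upwards [ch_target_mem_nhds ((ch (EK := EK) c).map_source hc)] with z hz
  exact (ch (EK := EK) c).right_inv hz

/-- A family of derivatives at a fixed point depends smoothly on the parameter. -/
lemma mNear_chD {Φ : K → K' → L} (hΦ : ContMDiff (𝓘(ℝ, EK).prod 𝓘(ℝ, EK')) 𝓘(ℝ, EL) ∞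
    fun p : K × K' => Φ p.1 p.2) {k₀ : K'} {l₀ : L} (h : ∀ k, Φ k k₀ = l₀) (k : K) :
    MNear EK (EK' →L[ℝ] EL) (fun k => chD EK' EL k₀ l₀ (Φ k) k₀) k := by
  suffices H : ∀ k, ContMDiffAt 𝓘(ℝ, EK) 𝓘(ℝ, EK' →L[ℝ] EL) ∞
      (fun k => chD EK' EL k₀ l₀ (Φ k) k₀) k from Filter.Eventually.of_forall H
  intro k
  have h1 : ContDiffAt ℝ ∞ (fun z : EK × EK' => ch (EK := EL) l₀ (Φ ((ch (EK := EK) k).symm z.1)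
      ((ch (EK := EK') k₀).symm z.2))) (ch k k, ch k₀ k₀) := by
    refine ContMDiffAt.contDiffAt ?_
    have h2 := (mNear_chart_pair hΦ k k₀).self_of_nhds
    refine ContMDiffAt.comp (I' := 𝓘(ℝ, EL)) (ch (EK := EK) k k, ch (EK := EK') k₀ k₀)
      (g := ch (EK := EL) l₀) (f := fun z : EK × EK' => Φ ((ch (EK := EK) k).symm z.1)
      ((ch (EK := EK') k₀).symm z.2)) ?_ h2
    simp only [ch_symm_self, h]
    exact (mNear_ch_self l₀).self_of_nhds
  have h3 : ContDiffAt ℝ ∞ (fun z : EK => chD EK' EL k₀ l₀ (Φ ((ch (EK := EK) k).symm z)) k₀)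
      (ch k k) := ContDiffAt.fderiv (n := ∞) h1 contDiffAt_const (by simp)
  have h4 := ContMDiffAt.comp (I' := 𝓘(ℝ, EK)) k (g := fun z : EK => chD EK' EL k₀ l₀
    (Φ ((ch (EK := EK) k).symm z)) k₀) h3.contMDiffAt (mNear_ch_self k).self_of_nhds
  refine h4.congr_of_eventuallyEq ?_
  filter_upwards [(isOpen_extChartAt_source (I := 𝓘(ℝ, EK)) k).mem_nhds (mem_extChartAt_source k)]
    with x hx
  simp only [Function.comp, (ch (EK := EK) k).left_inv hx]

end ChartDeriv

section Group

variable {EK K EL L : Type*}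
  [NormedAddCommGroup EK] [NormedSpace ℝ EK] [FiniteDimensional ℝ EK]
  [TopologicalSpace K] [ChartedSpace EK K] [IsManifold 𝓘(ℝ, EK) ∞ K]
  [NormedAddCommGroup EL] [NormedSpace ℝ EL] [FiniteDimensional ℝ EL]
  [TopologicalSpace L] [ChartedSpace EL L] [Group L] [LieGroup 𝓘(ℝ, EL) ∞ L]

/-- The Leibniz rule for products of maps which take the value `1`. -/
lemma chD_mul {c h : K} {f g : K → L} (hf : ContMDiffAt 𝓘(ℝ, EK) 𝓘(ℝ, EL) ∞ f h)
    (hg : ContMDiffAt 𝓘(ℝ, EK) 𝓘(ℝ, EL) ∞ g h) (hc : h ∈ (ch (EK := EK) c).source)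
    (hf1 : f h = 1) (hg1 : g h = 1) :
    chD EK EL c 1 (fun k => f k * g k) h = chD EK EL c 1 f h + chD EK EL c 1 g h := by
  have e1 : (ch (EK := EK) c).symm (ch c h) = h := (ch c).left_inv hc
  have hs := mem_extChartAt_source (I := 𝓘(ℝ, EL)) (1 : L)
  have hfr := chRep_differentiableAt hf hc (d := 1) (by rwa [hf1])
  have hgr := chRep_differentiableAt hg hc (d := 1) (by rwa [hg1])
  let o : EL := ch (1 : L) 1
  have eo : (ch (EK := EL) (1 : L)).symm o = 1 := ch_symm_self 1
  let m : EL × EL → EL := fun z => ch (EK := EL) (1 : L)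
    ((ch (EK := EL) (1 : L)).symm z.1 * (ch (EK := EL) (1 : L)).symm z.2)
  have hm : DifferentiableAt ℝ m (o, o) := by
    have h2 := (mNear_chart_pair (contMDiff_mul 𝓘(ℝ, EL) ∞ (G := L)) 1 1).self_of_nhds
    have h3 : ContMDiffAt 𝓘(ℝ, EL × EL) 𝓘(ℝ, EL) ∞ m (o, o) := by
      refine ContMDiffAt.comp (I' := 𝓘(ℝ, EL)) (o, o) (g := ch (EK := EL) (1 : L)) ?_ h2
      simp only [eo, mul_one]
      exact (mNear_ch_self (1 : L)).self_of_nhds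
    exact h3.contDiffAt.differentiableAt (by simp)
  have hl : (fderiv ℝ m (o, o)).comp (ContinuousLinearMap.inl ℝ EL EL)
      = ContinuousLinearMap.id ℝ EL := by
    have h1 : HasFDerivAt (fun z : EL => ((z, o) : EL × EL)) (ContinuousLinearMap.inl ℝ EL EL) o :=
      hasFDerivAt_prodMk_left o o
    rw [← (HasFDerivAt.comp (g := m) (f := fun z : EL => ((z, o) : EL × EL)) o hm.hasFDerivAt
      h1).fderiv, ← chD_id hs]
    simp only [m, Function.comp_def, eo, mul_one]
    rfl
  have hr : (fderiv ℝ m (o, o)).comp (ContinuousLinearMap.inr ℝ EL EL)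
      = ContinuousLinearMap.id ℝ EL := by
    have h1 : HasFDerivAt (fun z : EL => ((o, z) : EL × EL)) (ContinuousLinearMap.inr ℝ EL EL) o :=
      hasFDerivAt_prodMk_right o o
    rw [← (HasFDerivAt.comp (g := m) (f := fun z : EL => ((o, z) : EL × EL)) o hm.hasFDerivAt
      h1).fderiv, ← chD_id hs]
    simp only [m, Function.comp_def, eo, one_mul]
    rfl
  have hF := hfr.hasFDerivAt.prodMk hgr.hasFDerivAt
  have hm' : HasFDerivAt m (fderiv ℝ m (o, o)) (ch (EK := EL) (1 : L) (f ((ch (EK := EK) c).symm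
      (ch c h))), ch (EK := EL) (1 : L) (g ((ch (EK := EK) c).symm (ch c h)))) := by
    rw [e1, hf1, hg1]; exact hm.hasFDerivAt
  have hcomp := HasFDerivAt.comp (ch (EK := EK) c h) hm' hF
  have key : chD EK EL c 1 (fun k => f k * g k) h = (fderiv ℝ m (o, o)).comp
      ((chD EK EL c 1 f h).prod (chD EK EL c 1 g h)) := by
    refine Eq.trans ?_ hcomp.fderiv
    refine Filter.EventuallyEq.fderiv_eq ?_
    have hcs := (mNear_ch_symm ((ch (EK := EK) c).map_source hc)).self_of_nhds.continuousAt
    have h4 : ∀ q : K → L, ContMDiffAt 𝓘(ℝ, EK) 𝓘(ℝ, EL) ∞ q h → q h = 1 → ∀ᶠ z in nhds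
        (ch (EK := EK) c h), q ((ch (EK := EK) c).symm z) ∈ (ch (EK := EL) (1 : L)).source := by
      intro q hq hq1
      rw [ContinuousAt, e1] at hcs
      refine hcs.eventually (hq.continuousAt.eventually ?_)
      rw [hq1]
      exact (isOpen_extChartAt_source (1 : L)).mem_nhds hs
    filter_upwards [h4 f hf hf1, h4 g hg hg1] with z h5 h6
    simp only [m, Function.comp, (ch (EK := EL) (1 : L)).left_inv h5,
      (ch (EK := EL) (1 : L)).left_inv h6]
  rw [key]
  ext v
  have := congrArg (fun A => A (chD EK EL c 1 f h v)) hl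
  have h7 := congrArg (fun A => A (chD EK EL c 1 g h v)) hr
  simp only [ContinuousLinearMap.comp_apply, ContinuousLinearMap.inl_apply,
    ContinuousLinearMap.inr_apply, ContinuousLinearMap.id_apply] at this h7
  simp only [ContinuousLinearMap.comp_apply, ContinuousLinearMap.prod_apply,
    add_apply]
  rw [← this, ← h7, ← map_add]
  simp only [this, h7]
  simp

lemma contMDiff_conj (a : L) : ContMDiff 𝓘(ℝ, EL) 𝓘(ℝ, EL) ∞ fun b : L => a * b * a⁻¹ :=
  (contMDiff_const.mul contMDiff_id).mul contMDiff_const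

lemma adj_eq (a : L) : adj EL a = chD EL EL (1 : L) (1 : L) (fun b => a * b * a⁻¹) 1 := by
  have := mfderiv_eq_chD (contMDiff_conj (EL := EL) a 1)
  simp only [mul_one, mul_inv_cancel] at this
  exact this

lemma adj_mul (a b : L) : adj EL (a * b) = (adj EL a).comp (adj EL b) := by
  have hs := mem_extChartAt_source (I := 𝓘(ℝ, EL)) (1 : L)
  have h := chD_comp (c := 1) (d := 1) (e := 1) (contMDiff_conj (EL := EL) b 1)
    (contMDiff_conj (EL := EL) a _) hs (by simp) (by simp)
  rw [adj_eq, adj_eq, adj_eq]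
  simp only [mul_one, mul_inv_cancel] at h
  rw [← h]
  congr 1
  ext x
  group

lemma adj_one : adj EL (1 : L) = ContinuousLinearMap.id ℝ EL := by
  rw [adj_eq, ← chD_id (mem_extChartAt_source (I := 𝓘(ℝ, EL)) (1 : L))]
  simp

lemma mNear_adj (a : L) : MNear EL (EL →L[ℝ] EL) (adj EL) a := by
  have h := mNear_chD (EK := EL) (EK' := EL) (EL := EL) (Φ := fun a b : L => a * b * a⁻¹) (k₀ := 1)
    (l₀ := 1)
    ((contMDiff_fst.mul contMDiff_snd).mul contMDiff_fst.inv) (fun k => by simp) a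
  simpa only [← adj_eq] using h

/-- The right logarithmic derivative of a group valued map at `h`, in the charts at `c` and `1`. -/
abbrev rlogD (EK EL : Type*) {K L : Type*} [NormedAddCommGroup EK] [NormedSpace ℝ EK]
    [TopologicalSpace K] [ChartedSpace EK K] [NormedAddCommGroup EL] [NormedSpace ℝ EL]
    [TopologicalSpace L] [ChartedSpace EL L] [Group L] (c : K) (f : K → L) (h : K) :
    EK →L[ℝ] EL := chD EK EL c 1 (fun k => f k * (f h)⁻¹) h

/-- The product rule `d(fg) (fg)⁻¹ = df f⁻¹ + Ad f (dg g⁻¹)`. -/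
lemma rlogD_mul {c h : K} {f g : K → L} (hf : ContMDiffAt 𝓘(ℝ, EK) 𝓘(ℝ, EL) ∞ f h)
    (hg : ContMDiffAt 𝓘(ℝ, EK) 𝓘(ℝ, EL) ∞ g h) (hc : h ∈ (ch (EK := EK) c).source) :
    rlogD EK EL c (fun k => f k * g k) h
      = rlogD EK EL c f h + (adj EL (f h)).comp (rlogD EK EL c g h) := by
  have hs := mem_extChartAt_source (I := 𝓘(ℝ, EL)) (1 : L)
  have hg' : ContMDiffAt 𝓘(ℝ, EK) 𝓘(ℝ, EL) ∞ (fun k => g k * (g h)⁻¹) h :=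
    hg.mul contMDiffAt_const
  have h1 := chD_comp (c := c) (d := 1) (e := 1) hg' (contMDiff_conj (EL := EL) (f h) _) hc
    (by simp) (by simp)
  simp only [mul_inv_cancel] at h1
  have hf' : ContMDiffAt 𝓘(ℝ, EK) 𝓘(ℝ, EL) ∞ (fun k => f k * (f h)⁻¹) h :=
    hf.mul contMDiffAt_const
  have hg'' : ContMDiffAt 𝓘(ℝ, EK) 𝓘(ℝ, EL) ∞ (fun k => f h * (g k * (g h)⁻¹) * (f h)⁻¹) h :=
    (contMDiffAt_const.mul hg').mul contMDiffAt_const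
  rw [adj_eq, ← h1, ← chD_mul hf' hg'' hc (by simp) (by simp)]
  change chD EK EL c 1 (fun k => f k * g k * (f h * g h)⁻¹) h = _
  congr 1
  funext k
  group

lemma rlogD_eq_rightMC {f : K → L} {c h : K} (hf : ContMDiffAt 𝓘(ℝ, EK) 𝓘(ℝ, EL) ∞ f h)
    (hc : h ∈ (ch (EK := EK) c).source) {d : L} (hd : f h ∈ (ch (EK := EL) d).source) :
    rlogD EK EL c f h = (rightMC (EK := EL) d (f h)).comp (chD EK EL c d f h) :=
  chD_comp hf (contMDiff_id.mul contMDiff_const _) hc hd (by simp)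

end Group

/-! ### Groups of values of internal functions -/

section GroupPoints

variable {EX F : Type*} [NormedAddCommGroup EX] [NormedSpace ℝ EX] [FiniteDimensional ℝ EX]
  [NormedAddCommGroup F] [NormedSpace ℝ F] [FiniteDimensional ℝ F] {N : ℕ}
  {EK K : Type*}
  [NormedAddCommGroup EK] [NormedSpace ℝ EK] [FiniteDimensional ℝ EK]
  [TopologicalSpace K] [ChartedSpace EK K] [Group K] [LieGroup 𝓘(ℝ, EK) ∞ K]
  {Y : Type*} [NormedAddCommGroup Y] [NormedSpace ℝ Y] [FiniteDimensional ℝ Y]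
  {w : Y ⊗[ℝ] Gr EX F N} (hw : IsSoul w) {y : Y}

include hw in
lemma mul_push {c c' : Y → K} (hc : MNear Y EK c y) (hc' : MNear Y EK c' y) :
    (push (EK := EK) c y w).mul (push (EK := EK) c' y w)
      = push (EK := EK) (fun z => c z * c' z) y w :=
  map₂_push hw hc hc' (contMDiff_mul 𝓘(ℝ, EK) ∞)

include hw in
lemma inv_push {c : Y → K} (hc : MNear Y EK c y) :
    (push (EK := EK) c y w).inv = push (EK := EK) (fun z => (c z)⁻¹) y w :=
  map_push hw hc (contMDiff_inv 𝓘(ℝ, EK) ∞)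

include hw in
lemma push_const (k : K) : push (EK := EK) (fun _ : Y => k) y w = (k, 0) := by
  refine Prod.ext rfl ?_
  change taylor _ (fun _ : Y => ch k k) y w - _ = 0
  rw [hw.taylor_const (oddDim EX F N), sub_self]

lemma mNear_const (k : K) : MNear Y EK (fun _ => k) y :=
  Filter.Eventually.of_forall fun _ => contMDiffAt_const

lemma MNear.mul {c c' : Y → K} (hc : MNear Y EK c y) (hc' : MNear Y EK c' y) :
    MNear Y EK (fun z => c z * c' z) y := hc.comp₂ (contMDiff_mul 𝓘(ℝ, EK) ∞) hc'

lemma MNear.inv {c : Y → K} (hc : MNear Y EK c y) :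
    MNear Y EK (fun z => (c z)⁻¹) y :=
  (ContMDiff.mNear (contMDiff_inv 𝓘(ℝ, EK) ∞) _).comp hc

namespace Pt

variable {p q r : Pt K EK EX F N}

lemma Good.mul (hp : p.Good) (hq : q.Good) : (p.mul q).Good := by
  obtain ⟨y, w, c, c', c'', hw, hc, hc', -, rfl, rfl, -⟩ := exists_push₃ hp hq hq
  rw [mul_push hw hc hc']
  exact push_good hw (hc.mul hc')

lemma Good.inv (hp : p.Good) : p.inv.Good := by
  obtain ⟨y, w, c, c', c'', hw, hc, -, -, rfl, -, -⟩ := exists_push₃ hp hp hp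
  rw [inv_push hw hc]
  exact push_good hw hc.inv

lemma mul_assoc' (hp : p.Good) (hq : q.Good) (hr : r.Good) :
    (p.mul q).mul r = p.mul (q.mul r) := by
  obtain ⟨y, w, c, c', c'', hw, hc, hc', hc'', rfl, rfl, rfl⟩ := exists_push₃ hp hq hr
  rw [mul_push hw hc hc', mul_push hw hc' hc'', mul_push hw (hc.mul hc') hc'',
    mul_push hw hc (hc'.mul hc'')]
  simp only [mul_assoc]

lemma one_mul' (hp : p.Good) : Pt.mul ((1 : K), (0 : EK ⊗[ℝ] Gr EX F N)) p = p := by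
  obtain ⟨y, w, c, c', c'', hw, hc, -, -, rfl, -, -⟩ := exists_push₃ hp hp hp
  rw [← push_const hw (y := y), mul_push hw (mNear_const 1) hc]
  simp only [one_mul]

lemma inv_mul' (hp : p.Good) : p.inv.mul p = (1, 0) := by
  obtain ⟨y, w, c, c', c'', hw, hc, -, -, rfl, -, -⟩ := exists_push₃ hp hp hp
  rw [inv_push hw hc, mul_push hw hc.inv hc]
  simp only [inv_mul_cancel, push_const hw]

end Pt

variable (EX F N EK K) in
/-- The group of `K`-valued elements with even nilpotent displacement. -/
def GPt : Type _ := {p : Pt K EK EX F N // p.Good}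

instance : Mul (GPt EX F N EK K) := ⟨fun p q => ⟨p.1.mul q.1, p.2.mul q.2⟩⟩

instance : Inv (GPt EX F N EK K) := ⟨fun p => ⟨p.1.inv, p.2.inv⟩⟩

instance : One (GPt EX F N EK K) := ⟨⟨(1, 0), isSoul_zero⟩⟩

instance : Group (GPt EX F N EK K) :=
  Group.ofLeftAxioms (fun p q r => Subtype.ext (Pt.mul_assoc' p.2 q.2 r.2))
    (fun p => Subtype.ext (Pt.one_mul' p.2)) (fun p => Subtype.ext (Pt.inv_mul' p.2))

/-- An element with even nilpotent displacement, as an element of the group. -/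
def Pt.Good.gpt {p : Pt K EK EX F N} (hp : p.Good) : GPt EX F N EK K := ⟨p, hp⟩

lemma Pt.Ad_mul {p q : Pt K EK EX F N} (hp : p.Good) (hq : q.Good) (v : EK ⊗[ℝ] Gr EX F N) :
    (p.mul q).Ad v = p.Ad (q.Ad v) := by
  obtain ⟨y, w, c, c', c'', hw, hc, hc', -, rfl, rfl, -⟩ := exists_push₃ hp hq hq
  rw [mul_push hw hc hc', Pt.Ad, Pt.Ad, Pt.Ad, eval_push hw (hc.mul hc') (mNear_adj _),
    eval_push hw hc (mNear_adj _), eval_push hw hc' (mNear_adj _),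
    hw.app_taylor_app (D := oddDim EX F N) le_rfl ((mNear_adj _).comp hc).smoothNear
      ((mNear_adj _).comp hc').smoothNear]
  simp only [adj_mul]

lemma Pt.Ad_one (v : EK ⊗[ℝ] Gr EX F N) : Pt.Ad ((1 : K), 0) v = v := by
  have hw : IsSoul (0 : EK ⊗[ℝ] Gr EX F N) := isSoul_zero
  rw [← push_const hw (y := (0 : EK)), Pt.Ad, eval_push hw (mNear_const 1) (mNear_adj _),
    hw.taylor_const (oddDim EX F N), adj_one, app_const_tmul_one]
  exact congrArg (fun f => f v) (LinearMap.rTensor_id _ _)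

lemma Pt.Ad_inv_Ad {p : Pt K EK EX F N} (hp : p.Good) (v : EK ⊗[ℝ] Gr EX F N) :
    p.inv.Ad (p.Ad v) = v := by
  rw [← Pt.Ad_mul hp.inv hp, Pt.inv_mul' hp, Pt.Ad_one]

lemma Pt.Ad_sub (p : Pt K EK EX F N) (u v : EK ⊗[ℝ] Gr EX F N) :
    p.Ad (u - v) = p.Ad u - p.Ad v := app_sub _ _ _

end GroupPoints

section Crossed

variable {EX F : Type*} [NormedAddCommGroup EX] [NormedSpace ℝ EX] [FiniteDimensional ℝ EX]
  [NormedAddCommGroup F] [NormedSpace ℝ F] [FiniteDimensional ℝ F] {N : ℕ}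
  {𝔢 E 𝔤 G : Type*}
  [NormedAddCommGroup 𝔢] [NormedSpace ℝ 𝔢] [FiniteDimensional ℝ 𝔢]
  [TopologicalSpace E] [ChartedSpace 𝔢 E] [Group E] [LieGroup 𝓘(ℝ, 𝔢) ∞ E]
  [NormedAddCommGroup 𝔤] [NormedSpace ℝ 𝔤] [FiniteDimensional ℝ 𝔤]
  [TopologicalSpace G] [ChartedSpace 𝔤 G] [Group G] [LieGroup 𝓘(ℝ, 𝔤) ∞ G]
  (cm : LieCrossedModule 𝔢 E 𝔤 G)

namespace LieCrossedModule

lemma contMDiff_μ_mul_inv (A : E) : ContMDiff 𝓘(ℝ, 𝔤) 𝓘(ℝ, 𝔢) ∞ fun a => cm.μ a A * A⁻¹ :=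
  (cm.smooth_μ.comp (contMDiff_id.prodMk contMDiff_const)).mul contMDiff_const

lemma dμ_eq (A : E) : cm.dμ A = chD 𝔤 𝔢 1 1 (fun a => cm.μ a A * A⁻¹) 1 := by
  have := mfderiv_eq_chD (cm.contMDiff_μ_mul_inv A 1)
  simp only [map_one, MulAut.one_apply, mul_inv_cancel] at this
  exact this

lemma mNear_dμ (A : E) : MNear 𝔢 (𝔤 →L[ℝ] 𝔢) cm.dμ A := by
  have h := mNear_chD (EK := 𝔢) (EK' := 𝔤) (EL := 𝔢) (Φ := fun (A : E) (a : G) => cm.μ a A * A⁻¹)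
    (k₀ := 1) (l₀ := 1)
    ((cm.smooth_μ.comp (contMDiff_snd.prodMk contMDiff_fst)).mul contMDiff_fst.inv)
    (fun k => by simp) A
  simpa only [← dμ_eq] using h

lemma dμ_mul (A B : E) : cm.dμ (A * B) = cm.dμ A + (adj 𝔢 A).comp (cm.dμ B) := by
  have hs := mem_extChartAt_source (I := 𝓘(ℝ, 𝔤)) (1 : G)
  have h1 := chD_comp (c := 1) (d := 1) (e := 1) (cm.contMDiff_μ_mul_inv B 1)
    (contMDiff_conj (EL := 𝔢) A _) hs (by simp) (by simp)
  have e : cm.μ 1 B * B⁻¹ = 1 := by simp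
  simp only [e] at h1
  have h2 : ContMDiffAt 𝓘(ℝ, 𝔤) 𝓘(ℝ, 𝔢) ∞ (fun a => A * (cm.μ a B * B⁻¹) * A⁻¹) 1 :=
    (contMDiffAt_const.mul (cm.contMDiff_μ_mul_inv B 1)).mul contMDiffAt_const
  rw [dμ_eq, dμ_eq, dμ_eq, adj_eq, ← h1,
    ← chD_mul (cm.contMDiff_μ_mul_inv A 1) h2 hs (by simp) (by simp)]
  congr 1
  funext a
  rw [map_mul]
  group

variable {p q : Pt E 𝔢 EX F N} {g h : Pt G 𝔤 EX F N}

lemma mNear_μ {Y : Type*} [NormedAddCommGroup Y] [NormedSpace ℝ Y] {d : Y → G} {c : Y → E} {y : Y}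
    (hd : MNear Y 𝔤 d y) (hc : MNear Y 𝔢 c y) : MNear Y 𝔢 (fun z => cm.μ (d z) (c z)) y :=
  MNear.comp₂ (φ := fun a A => cm.μ a A) cm.smooth_μ hd hc

/-- The cocycle rule `˙μ(u, p q) = ˙μ(u, p) + Ad p (˙μ(u, q))`. -/
lemma pdμ_mul (hp : p.Good) (hq : q.Good) (u : 𝔤 ⊗[ℝ] Gr EX F N) :
    cm.pdμ u (p.mul q) = cm.pdμ u p + p.Ad (cm.pdμ u q) := by
  obtain ⟨y, w, c, c', c'', hw, hc, hc', -, rfl, rfl, -⟩ := exists_push₃ hp hq hq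
  have h1 := ((cm.mNear_dμ _).comp hc).smoothNear
  have h2 := ((cm.mNear_dμ _).comp hc').smoothNear
  have h3 := ((mNear_adj _).comp hc).smoothNear
  rw [mul_push hw hc hc', Pt.Ad, pdμ, pdμ, pdμ, eval_push hw (hc.mul hc') (cm.mNear_dμ _),
    eval_push hw hc (mNear_adj _), eval_push hw hc (cm.mNear_dμ _),
    eval_push hw hc' (cm.mNear_dμ _), hw.app_taylor_app (D := oddDim EX F N) le_rfl h3 h2,
    ← add_app]
  simp only [dμ_mul]
  rw [hw.taylor_add (D := oddDim EX F N) le_rfl h1 (h3.clm_comp h2)]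

lemma pτ_good (hp : p.Good) : (cm.pτ p).Good := by
  obtain ⟨y, w, c, -, -, hw, hc, -, -, rfl, -, -⟩ := exists_push₃ hp hp hp
  rw [pτ, map_push hw hc cm.smooth_τ]
  exact push_good hw ((ContMDiff.mNear cm.smooth_τ _).comp hc)

lemma pμ_good (hg : g.Good) (hp : p.Good) : (cm.pμ g p).Good := by
  obtain ⟨y, w, c, c', -, hw, hc, hc', -, rfl, rfl, -⟩ := exists_push₃ hg hp hp
  rw [pμ, map₂_push hw hc hc' cm.smooth_μ]
  exact push_good hw (cm.mNear_μ hc hc')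

lemma pτ_mul (hp : p.Good) (hq : q.Good) : cm.pτ (p.mul q) = (cm.pτ p).mul (cm.pτ q) := by
  obtain ⟨y, w, c, c', -, hw, hc, hc', -, rfl, rfl, -⟩ := exists_push₃ hp hq hq
  rw [mul_push hw hc hc', pτ, pτ, pτ, map_push hw (hc.mul hc') cm.smooth_τ,
    map_push hw hc cm.smooth_τ, map_push hw hc' cm.smooth_τ, mul_push hw
    ((ContMDiff.mNear cm.smooth_τ _).comp hc) ((ContMDiff.mNear cm.smooth_τ _).comp hc')]
  simp only [map_mul]

lemma pμ_mul_right (hg : g.Good) (hp : p.Good) (hq : q.Good) :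
    cm.pμ g (p.mul q) = (cm.pμ g p).mul (cm.pμ g q) := by
  obtain ⟨y, w, d, c, c', hw, hd, hc, hc', rfl, rfl, rfl⟩ := exists_push₃ hg hp hq
  rw [mul_push hw hc hc', pμ, pμ, pμ, map₂_push hw hd (hc.mul hc') cm.smooth_μ,
    map₂_push hw hd hc cm.smooth_μ, map₂_push hw hd hc' cm.smooth_μ,
    mul_push hw (cm.mNear_μ hd hc) (cm.mNear_μ hd hc')]
  simp only [map_mul]

lemma pμ_mul_left (hg : g.Good) (hh : h.Good) (hp : p.Good) :
    cm.pμ (g.mul h) p = cm.pμ g (cm.pμ h p) := by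
  obtain ⟨y, w, d, d', c, hw, hd, hd', hc, rfl, rfl, rfl⟩ := exists_push₃ hg hh hp
  rw [mul_push hw hd hd', pμ, pμ, pμ, map₂_push hw (hd.mul hd') hc cm.smooth_μ,
    map₂_push hw hd' hc cm.smooth_μ, map₂_push hw hd (cm.mNear_μ hd' hc) cm.smooth_μ]
  simp only [map_mul, MulAut.mul_apply]

/-- The Peiffer identity for values of internal functions. -/
lemma pμ_pτ (hp : p.Good) (hq : q.Good) : cm.pμ (cm.pτ p) q = (p.mul q).mul p.inv := by
  obtain ⟨y, w, c, c', -, hw, hc, hc', -, rfl, rfl, -⟩ := exists_push₃ hp hq hq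
  rw [mul_push hw hc hc', inv_push hw hc, mul_push hw (hc.mul hc') hc.inv, pτ, pμ,
    map_push hw hc cm.smooth_τ,
    map₂_push hw ((ContMDiff.mNear cm.smooth_τ _).comp hc) hc' cm.smooth_μ]
  simp only [cm.peiffer]

end LieCrossedModule

end Crossed

/-! ### Substitution of odd generators -/

section Pull

variable {EX F EX' F' : Type*}
  [NormedAddCommGroup EX] [NormedSpace ℝ EX] [FiniteDimensional ℝ EX]
  [NormedAddCommGroup F] [NormedSpace ℝ F] [FiniteDimensional ℝ F]
  [NormedAddCommGroup EX'] [NormedSpace ℝ EX'] [FiniteDimensional ℝ EX']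
  [NormedAddCommGroup F'] [NormedSpace ℝ F'] [FiniteDimensional ℝ F'] {N : ℕ}
  (A : EX →ₗ[ℝ] EX') (B : F →ₗ[ℝ] F')
  {V W Y : Type*} [NormedAddCommGroup V] [NormedSpace ℝ V] [FiniteDimensional ℝ V]
  [NormedAddCommGroup W] [NormedSpace ℝ W] [FiniteDimensional ℝ W]
  [NormedAddCommGroup Y] [NormedSpace ℝ Y] [FiniteDimensional ℝ Y]
  {EK K : Type*} [NormedAddCommGroup EK] [NormedSpace ℝ EK] [FiniteDimensional ℝ EK]
  [TopologicalSpace K] [ChartedSpace EK K] [IsManifold 𝓘(ℝ, EK) ∞ K]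

/-- Substitution of odd generators in vector valued elements. -/
def pullT {W : Type*} [AddCommGroup W] [Module ℝ W] :
    W ⊗[ℝ] Gr EX' F' N →ₗ[ℝ] W ⊗[ℝ] Gr EX F N :=
  LinearMap.lTensor W (Gr.pull A B).toLinearMap

/-- Substitution of odd generators in manifold valued elements. -/
def Pt.pull (p : Pt K EK EX' F' N) : Pt K EK EX F N := (p.1, pullT A B p.2)

lemma pullT_tmul_one (v : W) : pullT A B (v ⊗ₜ[ℝ] (1 : Gr EX' F' N)) = v ⊗ₜ 1 := by
  simp [pullT]

lemma IsSoul.pullT {w : Y ⊗[ℝ] Gr EX' F' N} (hw : IsSoul w) : IsSoul (pullT A B w) := hw.map _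

lemma IsEven.pullT {w : Y ⊗[ℝ] Gr EX' F' N} (hw : IsEven w) : IsEven (TwoBundle.pullT A B w) :=
  hw.map _

lemma body_pullT (w : Y ⊗[ℝ] Gr EX' F' N) : body (pullT A B w) = body w := body_map w _

lemma pullT_app (L : (V →L[ℝ] W) ⊗[ℝ] Gr EX' F' N) (v : V ⊗[ℝ] Gr EX' F' N) :
    pullT A B (app L v) = app (pullT A B L) (pullT A B v) := lTensor_app _ L v

lemma IsSoul.pullT_taylor {w : Y ⊗[ℝ] Gr EX' F' N} (hw : IsSoul w) {y : Y} {f : Y → W}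
    (hf : SmoothNear f y) :
    TwoBundle.pullT A B (taylor (oddDim EX' F' N) f y w)
      = taylor (oddDim EX F N) f y (TwoBundle.pullT A B w) := by
  rw [← hw.taylor_of_le (D := oddDim EX' F' N) le_rfl (le_max_left _ (oddDim EX F N)) hf,
    ← (hw.pullT A B).taylor_of_le (D := oddDim EX F N) le_rfl
      (le_max_right (oddDim EX' F' N) _) hf]
  exact lTensor_taylor _ _ f y w

lemma pullT_value {u : Y ⊗[ℝ] Gr EX' F' N} (hu : IsEven u) {f : Y → W}
    (hf : SmoothNear f (body u)) :
    pullT A B (value (oddDim EX' F' N) f u) = value (oddDim EX F N) f (pullT A B u) := by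
  rw [value, hu.sub_body.pullT_taylor A B hf, value, map_sub, body_pullT, pullT_tmul_one]

lemma pull_push {w : Y ⊗[ℝ] Gr EX' F' N} (hw : IsSoul w) {y : Y} {c : Y → K}
    (hc : MNear Y EK c y) :
    Pt.pull A B (push (EK := EK) c y w) = push (EK := EK) c y (pullT A B w) := by
  refine Prod.ext rfl ?_
  change pullT A B (taylor _ _ _ _ - _) = _
  rw [map_sub, pullT_tmul_one, hw.pullT_taylor A B (hc.ch_comp (mem_extChartAt_source _))]
  rfl

lemma Pt.Good.pull {p : Pt K EK EX' F' N} (hp : p.Good) : (p.pull A B).Good := IsSoul.pullT A B hp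

lemma eval_pull {p : Pt K EK EX' F' N} (hp : p.Good) {φ : K → W} (hφ : MNear EK W φ p.1) :
    Pt.eval φ (p.pull A B) = pullT A B (Pt.eval φ p) := by
  rw [Pt.eval, Pt.eval, IsSoul.pullT_taylor A B hp]
  · rfl
  · refine (MNear.comp (φ := φ) ?_ (mNear_ch_symm_self p.1)).smoothNear
    rwa [ch_symm_self]

/-- Pullback along a submersion is injective: duals of onto maps are into, and over a field
exterior powers and tensor products preserve this. -/
lemma pullT_injective (hA : Function.Surjective A) (hB : Function.Surjective B) :
    Function.Injective (pullT (N := N) A B (W := W)) := by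
  refine Module.Flat.lTensor_preserves_injective_linearMap (M := W) _ ?_
  refine ExteriorAlgebra.map_injective_field ?_
  rw [LinearMap.ker_eq_bot]
  change Function.Injective (Prod.map A.dualMap (Prod.map B.dualMap id))
  refine Function.Injective.prodMap ?_ (Function.Injective.prodMap ?_ Function.injective_id)
  · exact LinearMap.dualMap_injective_of_surjective hA
  · exact LinearMap.dualMap_injective_of_surjective hB

lemma pull_injective (hA : Function.Surjective A) (hB : Function.Surjective B) :
    Function.Injective (Pt.pull (N := N) (K := K) (EK := EK) A B) := fun _ _ h =>
  Prod.ext (congrArg (fun r : Pt K EK EX F N => r.1) h)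
    (pullT_injective A B hA hB (congrArg (fun r : Pt K EK EX F N => r.2) h))

end Pull

section PullGroup

variable {EX F EX' F' : Type*}
  [NormedAddCommGroup EX] [NormedSpace ℝ EX] [FiniteDimensional ℝ EX]
  [NormedAddCommGroup F] [NormedSpace ℝ F] [FiniteDimensional ℝ F]
  [NormedAddCommGroup EX'] [NormedSpace ℝ EX'] [FiniteDimensional ℝ EX']
  [NormedAddCommGroup F'] [NormedSpace ℝ F'] [FiniteDimensional ℝ F'] {N : ℕ}
  (A : EX →ₗ[ℝ] EX') (B : F →ₗ[ℝ] F')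
  {𝔢 E 𝔤 G : Type*}
  [NormedAddCommGroup 𝔢] [NormedSpace ℝ 𝔢] [FiniteDimensional ℝ 𝔢]
  [TopologicalSpace E] [ChartedSpace 𝔢 E] [Group E] [LieGroup 𝓘(ℝ, 𝔢) ∞ E]
  [NormedAddCommGroup 𝔤] [NormedSpace ℝ 𝔤] [FiniteDimensional ℝ 𝔤]
  [TopologicalSpace G] [ChartedSpace 𝔤 G] [Group G] [LieGroup 𝓘(ℝ, 𝔤) ∞ G]
  (cm : LieCrossedModule 𝔢 E 𝔤 G)
  {p q : Pt E 𝔢 EX' F' N} {g : Pt G 𝔤 EX' F' N}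

lemma pull_mul (hp : p.Good) (hq : q.Good) :
    (p.mul q).pull A B = (p.pull A B).mul (q.pull A B) := by
  obtain ⟨y, w, c, c', -, hw, hc, hc', -, rfl, rfl, -⟩ := exists_push₃ hp hq hq
  rw [mul_push hw hc hc', pull_push A B hw hc, pull_push A B hw hc', pull_push A B hw (hc.mul hc'),
    mul_push (hw.pullT A B) hc hc']

lemma pull_inv (hp : p.Good) : p.inv.pull A B = (p.pull A B).inv := by
  obtain ⟨y, w, c, -, -, hw, hc, -, -, rfl, -, -⟩ := exists_push₃ hp hp hp
  rw [inv_push hw hc, pull_push A B hw hc, pull_push A B hw hc.inv, inv_push (hw.pullT A B) hc]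

lemma pull_pτ (hp : p.Good) : (cm.pτ p).pull A B = cm.pτ (p.pull A B) := by
  obtain ⟨y, w, c, -, -, hw, hc, -, -, rfl, -, -⟩ := exists_push₃ hp hp hp
  rw [LieCrossedModule.pτ, LieCrossedModule.pτ, pull_push A B hw hc, map_push hw hc cm.smooth_τ,
    map_push (hw.pullT A B) hc cm.smooth_τ,
    pull_push A B hw ((ContMDiff.mNear cm.smooth_τ _).comp hc)]

lemma pull_pμ (hg : g.Good) (hp : p.Good) :
    (cm.pμ g p).pull A B = cm.pμ (g.pull A B) (p.pull A B) := by
  obtain ⟨y, w, d, c, -, hw, hd, hc, -, rfl, rfl, -⟩ := exists_push₃ hg hp hp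
  rw [LieCrossedModule.pμ, LieCrossedModule.pμ, pull_push A B hw hc, pull_push A B hw hd,
    map₂_push hw hd hc cm.smooth_μ, map₂_push (hw.pullT A B) hd hc cm.smooth_μ,
    pull_push A B hw (cm.mNear_μ hd hc)]

lemma pullT_Ad (hp : p.Good) (v : 𝔢 ⊗[ℝ] Gr EX' F' N) :
    pullT A B (p.Ad v) = (p.pull A B).Ad (pullT A B v) := by
  rw [Pt.Ad, pullT_app, ← eval_pull A B hp (mNear_adj _)]
  rfl

lemma pullT_pdμ (hp : p.Good) (u : 𝔤 ⊗[ℝ] Gr EX' F' N) :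
    pullT A B (cm.pdμ u p) = cm.pdμ (pullT A B u) (p.pull A B) := by
  rw [LieCrossedModule.pdμ, pullT_app, ← eval_pull A B hp (cm.mNear_dμ _)]
  rfl

end PullGroup

/-! ### The chain rule for the de Rham vector field -/

section ChainRule

variable {EX X F : Type*} [NormedAddCommGroup EX] [NormedSpace ℝ EX] [FiniteDimensional ℝ EX]
  [TopologicalSpace X] [ChartedSpace EX X] [IsManifold 𝓘(ℝ, EX) ∞ X]
  [NormedAddCommGroup F] [NormedSpace ℝ F] [FiniteDimensional ℝ F] {N : ℕ}
  {W Y : Type*} [NormedAddCommGroup W] [NormedSpace ℝ W] [FiniteDimensional ℝ W]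
  [NormedAddCommGroup Y] [NormedSpace ℝ Y] [FiniteDimensional ℝ Y]

lemma continuousAt_ch_symm (x : X) : ContinuousAt (ch (EK := EX) x).symm (ch x x) :=
  (mNear_ch_symm_self x).self_of_nhds.continuousAt

lemma tendsto_ch_symm (x : X) :
    Filter.Tendsto (ch (EK := EX) x).symm (nhds (ch x x)) (nhds x) := by
  have := continuousAt_ch_symm (EX := EX) x
  rwa [ContinuousAt, ch_symm_self] at this

lemma tendsto_line (a v : EX) : Filter.Tendsto (fun t : ℝ => a + t • v) (nhds 0) (nhds a) := by
  have : Continuous fun t : ℝ => a + t • v := by fun_prop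
  simpa using this.tendsto 0

lemma localRep_self {W : Type*} [AddCommGroup W] [Module ℝ W] (s : VField X EX F N W) (x : X)
    (η : F) : localRep s x (ch x x) η = s x η := by
  have h1 : ((tangentCoordChange 𝓘(ℝ, EX) x x x : EX →L[ℝ] EX) : EX →ₗ[ℝ] EX)
      = LinearMap.id := by
    ext v
    exact tangentCoordChange_self (mem_extChartAt_source (I := 𝓘(ℝ, EX)) x)
  rw [localRep]
  simp only [ch_symm_self, h1]
  have h2 : Gr.pull (N := N) (LinearMap.id : EX →ₗ[ℝ] EX) (LinearMap.id : F →ₗ[ℝ] F)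
      = AlgHom.id ℝ _ := by
    rw [Gr.pull]
    have : ((LinearMap.id : EX →ₗ[ℝ] EX).dualMap.prodMap
      ((LinearMap.id : F →ₗ[ℝ] F).dualMap.prodMap (LinearMap.id : (Fin N → ℝ) →ₗ[ℝ] Fin N → ℝ)))
      = LinearMap.id := rfl
    rw [this, ExteriorAlgebra.map_id]
  rw [h2]
  exact congrArg (fun f => f (s x η)) (LinearMap.lTensor_id _ _)

lemma extD_congr {W : Type*} [AddCommGroup W] [Module ℝ W] {s s' : VField X EX F N W} {x : X}
    {η : F} (h : ∀ᶠ x' in nhds x, s x' η = s' x' η) : extD s x η = extD s' x η := by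
  have h0 := h.self_of_nhds
  rw [extD, extD, h0]
  congr 1
  refine Finset.sum_congr rfl fun i _ => ?_
  congr 1
  refine wderiv_congr ?_
  filter_upwards [((tendsto_ch_symm x).comp
    (tendsto_line (ch x x) (Module.finBasis ℝ EX i))).eventually h] with t ht
  simp only [Function.comp] at ht
  simp only [localRep, ht]

/-- The function is differentiable at `x` along the coordinate lines of the chart. -/
def LineDiffAt {W : Type*} [AddCommGroup W] [Module ℝ W] (s : VField X EX F N W) (x : X) (η : F) :
    Prop :=
  ∀ i, HasWDeriv (fun t : ℝ => localRep s x (ch x x + t • Module.finBasis ℝ EX i) η)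
    (wderiv fun t : ℝ => localRep s x (ch x x + t • Module.finBasis ℝ EX i) η)

lemma LineDiffAt.congr {W : Type*} [AddCommGroup W] [Module ℝ W] {s s' : VField X EX F N W} {x : X}
    {η : F} (hs : LineDiffAt s x η) (h : ∀ᶠ x' in nhds x, s' x' η = s x' η) :
    LineDiffAt s' x η := by
  intro i
  have e : ∀ᶠ t in nhds (0 : ℝ), localRep s' x (ch x x + t • Module.finBasis ℝ EX i) η
      = localRep s x (ch x x + t • Module.finBasis ℝ EX i) η := by
    filter_upwards [((tendsto_ch_symm x).comp
      (tendsto_line (ch x x) (Module.finBasis ℝ EX i))).eventually h] with t ht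
    simp only [Function.comp] at ht
    simp only [localRep, ht]
  rw [wderiv_congr e]
  exact (hs i).congr e

/-- The derivative of a smooth function on the base along a line in the chart. -/
lemma SmoothAt.hasWDeriv {W : Type*} [AddCommGroup W] [Module ℝ W] [FiniteDimensional ℝ W]
    {s : VField X EX F N W} {x : X} {η : F} (h : SmoothAt s x η) (v : EX) :
    HasWDeriv (fun t : ℝ => localRep s x (ch x x + t • v) η)
      (wderiv fun t : ℝ => localRep s x (ch x x + t • v) η) := by
  have hl : ∀ l : Module.Dual ℝ (W ⊗[ℝ] Gr EX F N), DifferentiableAt ℝ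
      (fun t : ℝ => l (localRep s x (ch x x + t • v) η)) 0 := by
    intro l
    have h1 : DifferentiableAt ℝ (fun z : EX × F => l (localRep s x z.1 z.2)) (ch x x, η) :=
      (h l).differentiableAt (by simp)
    have h2 : DifferentiableAt ℝ (fun t : ℝ => ((ch (EK := EX) x x + t • v, η) : EX × F)) 0 := by
      fun_prop
    refine DifferentiableAt.comp (g := fun z : EX × F => l (localRep s x z.1 z.2))
      (f := fun t : ℝ => ((ch (EK := EX) x x + t • v, η) : EX × F)) 0 ?_ h2
    simpa using h1
  let b := Module.finBasis ℝ (W ⊗[ℝ] Gr EX F N)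
  have H : HasWDeriv (fun t : ℝ => localRep s x (ch x x + t • v) η)
      (∑ j, deriv (fun t : ℝ => b.coord j (localRep s x (ch x x + t • v) η)) 0 • b j) := by
    intro l
    have e : ∀ u : W ⊗[ℝ] Gr EX F N, l u = ∑ j, b.coord j u * l (b j) := by
      intro u
      conv_lhs => rw [← b.sum_repr u]
      rw [map_sum]
      simp only [map_smul, smul_eq_mul, Module.Basis.coord_apply]
    simp only [e (localRep s x _ η), map_sum, map_smul, smul_eq_mul]
    exact HasDerivAt.fun_sum fun j _ => ((hl (b.coord j)).hasDerivAt).mul_const _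
  rwa [H.wderiv_eq]

lemma SmoothAt.lineDiffAt {W : Type*} [AddCommGroup W] [Module ℝ W] [FiniteDimensional ℝ W]
    {s : VField X EX F N W} {x : X} {η : F} (h : SmoothAt s x η) : LineDiffAt s x η :=
  fun _ => h.hasWDeriv _

lemma lTensor_mulLeft_app {V : Type*} [NormedAddCommGroup V] [NormedSpace ℝ V]
    [FiniteDimensional ℝ V] {M : Type*} [AddCommGroup M] [Module ℝ M]
    {L : (V →L[ℝ] W) ⊗[ℝ] ExteriorAlgebra ℝ M} (hL : IsEven L) (a : ExteriorAlgebra ℝ M)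
    (v : V ⊗[ℝ] ExteriorAlgebra ℝ M) :
    LinearMap.lTensor W (LinearMap.mulLeft ℝ a) (app L v)
      = app L (LinearMap.lTensor V (LinearMap.mulLeft ℝ a) v) := by
  refine ext_comp fun l => ?_
  rw [comp_lTensor, comp_app (Module.finBasis ℝ V), comp_app (Module.finBasis ℝ V), map_sum]
  refine Finset.sum_congr rfl fun j _ => ?_
  rw [comp_lTensor, LinearMap.mulLeft_apply, LinearMap.mulLeft_apply, ← mul_assoc, ← mul_assoc,
    evenPart_central (hL _)]

lemma app_sum {V κ : Type*} [NormedAddCommGroup V] [NormedSpace ℝ V] {A : Type*} [Ring A]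
    [Algebra ℝ A] (s : Finset κ) (L : (V →L[ℝ] W) ⊗[ℝ] A) (v : κ → V ⊗[ℝ] A) :
    app L (∑ i ∈ s, v i) = ∑ i ∈ s, app L (v i) := map_sum (TensorProduct.map₂ _ _ L) v s

lemma SmoothNear.fderiv {f : Y → W} {y : Y} (hf : SmoothNear f y) :
    SmoothNear (fderiv ℝ f) y := by
  filter_upwards [hf] with z hz
  exact hz.fderiv_right (by simp)

lemma localRep_value {U : VField X EX F N Y} {f : Y → W} (x : X) (z : EX) (η : F) :
    localRep (fun x' η' => value (oddDim EX F N) f (U x' η')) x z η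
      = value (oddDim EX F N) f (localRep U x z η) := by
  rw [localRep, localRep]
  simp only [value]
  rw [lTensor_taylor, map_sub]
  have h := body_pullT (N := N) (tangentCoordChange 𝓘(ℝ, EX) x ((ch (EK := EX) x).symm z)
    ((ch (EK := EX) x).symm z) : EX →ₗ[ℝ] EX) (LinearMap.id : F →ₗ[ℝ] F)
      (U ((ch (EK := EX) x).symm z) η)
  rw [pullT] at h
  rw [h]
  congr 2
  simp

/-- The chain rule: `d (f ∘ U) = f'(U) dU`. -/
lemma extD_value {U : VField X EX F N Y} {x : X} {η : F} (hU : LineDiffAt U x η)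
    (he : ∀ᶠ x' in nhds x, IsEven (U x' η)) {f : Y → W} (hf : SmoothNear f (body (U x η))) :
    extD (fun x' η' => value (oddDim EX F N) f (U x' η')) x η
      = app (value (oddDim EX F N) (fderiv ℝ f) (U x η)) (extD U x η) := by
  have hex := he.self_of_nhds
  have hL : IsEven (value (oddDim EX F N) (fderiv ℝ f) (U x η)) :=
    hex.sub_body.taylor_isEven _ hf.fderiv
  rw [extD, extD, app_add, app_sum]
  congr 1
  · refine Finset.sum_congr rfl fun i _ => ?_
    rw [← lTensor_mulLeft_app hL]
    congr 1
    simp only [localRep_value]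
    have h0 : localRep U x (ch x x + (0 : ℝ) • Module.finBasis ℝ EX i) η = U x η := by
      rw [zero_smul, add_zero, localRep_self]
    have hw := HasWDeriv.value (D := oddDim EX F N) le_rfl (hU i)
      (f := f) ?_ (by rwa [h0])
    · rw [hw.wderiv_eq, h0]
    · filter_upwards [((tendsto_ch_symm x).comp
        (tendsto_line (ch x x) (Module.finBasis ℝ EX i))).eventually he] with t ht
      exact ht.pullT _ _
  · have h := hex.sub_body.contr_taylor (D := oddDim EX F N) le_rfl
      ((Module.Dual.eval ℝ F η) ∘ₗ LinearMap.fst ℝ _ _ ∘ₗ LinearMap.snd ℝ _ _) hf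
    refine h.trans ?_
    rw [map_sub, LinearMap.lTensor_tmul]
    have : contr (((Module.Dual.eval ℝ F η) ∘ₗ LinearMap.fst ℝ _ _ ∘ₗ LinearMap.snd ℝ _ _ :
      Module.Dual ℝ (Module.Dual ℝ EX × Module.Dual ℝ F × (Fin N → ℝ)))) 1 = 0 := by
      simpa using contr_algebraMap (((Module.Dual.eval ℝ F η) ∘ₗ LinearMap.fst ℝ _ _ ∘ₗ
        LinearMap.snd ℝ _ _ : Module.Dual ℝ (Module.Dual ℝ EX × Module.Dual ℝ F × (Fin N → ℝ)))) 1
    rw [this, TensorProduct.tmul_zero, sub_zero]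
    rfl

end ChainRule

/-! ### Logarithmic derivatives of group valued internal functions -/

section Pushv

variable {EX F : Type*} [NormedAddCommGroup EX] [NormedSpace ℝ EX] [FiniteDimensional ℝ EX]
  [NormedAddCommGroup F] [NormedSpace ℝ F] [FiniteDimensional ℝ F] {N : ℕ}
  {EK K W Y Z : Type*}
  [NormedAddCommGroup EK] [NormedSpace ℝ EK] [FiniteDimensional ℝ EK]
  [TopologicalSpace K] [ChartedSpace EK K] [IsManifold 𝓘(ℝ, EK) ∞ K]
  [NormedAddCommGroup W] [NormedSpace ℝ W] [FiniteDimensional ℝ W]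
  [NormedAddCommGroup Y] [NormedSpace ℝ Y] [FiniteDimensional ℝ Y]
  [NormedAddCommGroup Z] [NormedSpace ℝ Z] [FiniteDimensional ℝ Z]

/-- The value at the even point `u` of a smooth map `c` into a manifold. -/
def pushv (c : Y → K) (u : Y ⊗[ℝ] Gr EX F N) : Pt K EK EX F N :=
  push c (body u) (u - body u ⊗ₜ 1)

variable {u : Y ⊗[ℝ] Gr EX F N}

lemma eval_pushv (hu : IsEven u) {c : Y → K} (hc : MNear Y EK c (body u)) {φ : K → W}
    (hφ : MNear EK W φ (c (body u))) :
    Pt.eval φ (pushv (EK := EK) c u) = value (oddDim EX F N) (fun z => φ (c z)) u :=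
  eval_push hu.sub_body hc hφ

lemma body_lin {V V' M : Type*} [AddCommGroup V] [Module ℝ V] [AddCommGroup V'] [Module ℝ V']
    [AddCommGroup M] [Module ℝ M] (A : V →ₗ[ℝ] V') (u : V ⊗[ℝ] ExteriorAlgebra ℝ M) :
    body (lin A u) = A (body u) := by
  induction u using TensorProduct.induction_on with
  | zero => simp
  | tmul v a => simp
  | add x y hx hy => rw [lin_add, map_add, map_add, map_add, hx, hy]

lemma pushv_clm (hu : IsEven u) (A : Y →L[ℝ] Z) {c : Z → K} (hc : MNear Z EK c (A (body u))) :
    pushv (EK := EK) (fun z => c (A z)) u = pushv c (lin (A : Y →ₗ[ℝ] Z) u) := by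
  rw [pushv, push_clm hu.sub_body A hc, pushv, body_lin, lin_sub, lin_tmul]
  rfl

lemma exists_chart_push {p : Pt K EK EX F N} {k : K}
    (hk : p.1 ∈ (ch (EK := EK) k).source) :
    ∃ f : EK → EK, SmoothNear f (ch p.1 p.1) ∧ f (ch p.1 p.1) = ch k p.1 ∧
      Pt.eval (ch (EK := EK) k) p = taylor (oddDim EX F N) f (ch p.1 p.1) p.2 ∧
      ∀ᶠ z in nhds (ch p.1 p.1), (ch (EK := EK) k).symm (f z) = (ch (EK := EK) p.1).symm z := by
  refine ⟨fun z => ch k ((ch (EK := EK) p.1).symm z), ?_, ?_, rfl, ?_⟩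
  · exact (mNear_ch_symm_self p.1).ch_comp (by rwa [ch_symm_self])
  · simp only [ch_symm_self]
  · filter_upwards [(tendsto_ch_symm p.1).eventually ((isOpen_extChartAt_source k).mem_nhds hk)]
      with z hz
    exact (ch (EK := EK) k).left_inv hz

lemma body_eval {p : Pt K EK EX F N} (hp : p.Good) {k : K}
    (hk : p.1 ∈ (ch (EK := EK) k).source) : body (Pt.eval (ch (EK := EK) k) p) = ch k p.1 := by
  obtain ⟨f, hf, h1, h2, -⟩ := exists_chart_push hk
  rw [h2, IsSoul.body_taylor hp _ hf, h1]

lemma eval_isEven {p : Pt K EK EX F N} (hp : p.Good) {k : K}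
    (hk : p.1 ∈ (ch (EK := EK) k).source) : IsEven (Pt.eval (ch (EK := EK) k) p) := by
  obtain ⟨f, hf, h1, h2, -⟩ := exists_chart_push hk
  rw [h2]
  exact IsSoul.taylor_isEven hp _ hf

/-- A manifold valued element is determined by its coordinates in a chart around its body. -/
lemma pushv_eval {p : Pt K EK EX F N} (hp : p.Good) {k : K}
    (hk : p.1 ∈ (ch (EK := EK) k).source) :
    pushv (ch (EK := EK) k).symm (Pt.eval (ch (EK := EK) k) p) = p := by
  obtain ⟨f, hf, h1, h2, h3⟩ := exists_chart_push hk
  have hk' : (ch (EK := EK) k).symm (ch k p.1) = p.1 := (ch k).left_inv hk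
  rw [pushv, body_eval hp hk, h2]
  refine Prod.ext hk' ?_
  change taylor _ (fun z => ch ((ch k).symm (ch k p.1)) ((ch k).symm z)) _ _ -
    ch ((ch k).symm (ch k p.1)) ((ch k).symm (ch k p.1)) ⊗ₜ[ℝ] 1 = p.2
  have hs : SmoothNear (fun z => ch (EK := EK) p.1 ((ch (EK := EK) k).symm z))
      (f (ch p.1 p.1)) := by
    rw [h1]
    exact (mNear_ch_symm ((ch (EK := EK) k).map_source hk)).ch_comp
      (by rw [hk']; exact mem_extChartAt_source _)
  have key := IsSoul.taylor_comp hp (D := oddDim EX F N) le_rfl hf hs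
  rw [h1] at key
  rw [hk', key]
  have e : (fun z => ch (EK := EK) p.1 ((ch (EK := EK) k).symm (f z))) =ᶠ[nhds (ch p.1 p.1)]
      fun z => z := by
    filter_upwards [h3, ch_target_mem_nhds (ch_self_mem_target p.1)] with z hz hz'
    rw [hz]
    exact (ch (EK := EK) p.1).right_inv hz'
  rw [taylor_congr e, IsSoul.taylor_id hp (D := oddDim EX F N) le_rfl, add_sub_cancel_left]

end Pushv

section RLog

variable {EL L Y : Type*}
  [NormedAddCommGroup EL] [NormedSpace ℝ EL] [FiniteDimensional ℝ EL]
  [TopologicalSpace L] [ChartedSpace EL L] [Group L] [LieGroup 𝓘(ℝ, EL) ∞ L]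
  [NormedAddCommGroup Y] [NormedSpace ℝ Y] [FiniteDimensional ℝ Y]

lemma mNear_rightMC {d h : L} (hh : h ∈ (ch (EK := EL) d).source) :
    MNear EL (EL →L[ℝ] EL) (rightMC (EK := EL) d) h := by
  filter_upwards [(isOpen_extChartAt_source d).mem_nhds hh] with h hh
  have e1 : (ch (EK := EL) d).symm (ch d h) = h := (ch d).left_inv hh
  have hs := (mNear_ch_symm ((ch (EK := EL) d).map_source hh)).self_of_nhds
  have h1 : ContDiffAt ℝ ∞ (fun z : EL × EL => ch (EK := EL) (1 : L)
      ((ch (EK := EL) d).symm z.2 * ((ch (EK := EL) d).symm z.1)⁻¹)) (ch d h, ch d h) := by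
    refine ContMDiffAt.contDiffAt ?_
    have h2 : ContMDiffAt 𝓘(ℝ, EL × EL) 𝓘(ℝ, EL) ∞ (fun z : EL × EL =>
        (ch (EK := EL) d).symm z.2 * ((ch (EK := EL) d).symm z.1)⁻¹) (ch d h, ch d h) :=
      (hs.comp (I' := 𝓘(ℝ, EL)) (f := Prod.snd) (ch (EK := EL) d h, ch (EK := EL) d h)
        (contDiff_snd.contMDiff _)).mul
      (hs.comp (I' := 𝓘(ℝ, EL)) (f := Prod.fst) (ch (EK := EL) d h, ch (EK := EL) d h)
        (contDiff_fst.contMDiff _)).inv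
    refine ContMDiffAt.comp (I' := 𝓘(ℝ, EL)) (ch (EK := EL) d h, ch (EK := EL) d h)
      (g := ch (EK := EL) (1 : L)) ?_ h2
    simp only [mul_inv_cancel]
    exact (mNear_ch_self (1 : L)).self_of_nhds
  have h3 : ContDiffAt ℝ ∞ (fun y => fderiv ℝ (fun z => ch (EK := EL) (1 : L)
      ((ch (EK := EL) d).symm z * ((ch (EK := EL) d).symm y)⁻¹)) y) (ch d h) :=
    ContDiffAt.fderiv (n := ∞) h1 contDiffAt_id (by simp)
  have h4 := ContMDiffAt.comp (I' := 𝓘(ℝ, EL)) h h3.contMDiffAt (mNear_ch hh).self_of_nhds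
  refine h4.congr_of_eventuallyEq ?_
  filter_upwards [(isOpen_extChartAt_source (I := 𝓘(ℝ, EL)) d).mem_nhds hh] with x hx
  simp only [Function.comp, (ch (EK := EL) d).left_inv hx]
  rfl

lemma MNear.eventually_mNear {K EK L' EL' : Type*} [NormedAddCommGroup EK] [NormedSpace ℝ EK]
    [TopologicalSpace K] [ChartedSpace EK K] [NormedAddCommGroup EL'] [NormedSpace ℝ EL']
    [TopologicalSpace L'] [ChartedSpace EL' L'] {c : K → L'} {y : K} (hc : MNear EK EL' c y) :
    ∀ᶠ z in nhds y, MNear EK EL' c z := eventually_eventually_nhds.2 hc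

lemma mem_ch_source_model (y z : Y) : z ∈ (ch (EK := Y) y).source := by
  rw [ch, extChartAt_model_space_eq_id]
  exact Set.mem_univ z

lemma rlogD_eventuallyEq {c : Y → L} {y : Y} (hc : MNear Y EL c y) :
    rlogD Y EL (0 : Y) c =ᶠ[nhds y] fun z => (rightMC (EK := EL) (c y) (c z)).comp
      (fderiv ℝ (fun z => ch (EK := EL) (c y) (c z)) z) := by
  filter_upwards [hc, hc.self_of_nhds.continuousAt.eventually
    ((isOpen_extChartAt_source (I := 𝓘(ℝ, EL)) (c y)).mem_nhds (mem_extChartAt_source (c y)))]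
    with z hz h2
  have := rlogD_eq_rightMC (c := (0 : Y)) hz (mem_ch_source_model 0 z) h2
  rw [this]
  simp only [chD, ch, extChartAt_model_space_eq_id]
  rfl

lemma smoothNear_rlogD {c : Y → L} {y : Y} (hc : MNear Y EL c y) :
    SmoothNear (rlogD Y EL (0 : Y) c) y := by
  have h1 : SmoothNear (fun z => (rightMC (EK := EL) (c y) (c z)).comp
      (fderiv ℝ (fun z => ch (EK := EL) (c y) (c z)) z)) y :=
    SmoothNear.clm_comp ((mNear_rightMC (mem_extChartAt_source (c y))).comp hc).smoothNear
      (SmoothNear.fderiv (hc.ch_comp (mem_extChartAt_source (c y))))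
  filter_upwards [h1, (rlogD_eventuallyEq hc).eventuallyEq_nhds] with z h2 h3
  exact h2.congr_of_eventuallyEq h3

end RLog

section LogR

variable {EX X F : Type*} [NormedAddCommGroup EX] [NormedSpace ℝ EX] [FiniteDimensional ℝ EX]
  [TopologicalSpace X] [ChartedSpace EX X] [IsManifold 𝓘(ℝ, EX) ∞ X]
  [NormedAddCommGroup F] [NormedSpace ℝ F] [FiniteDimensional ℝ F] {N : ℕ}
  {EL L Y : Type*}
  [NormedAddCommGroup EL] [NormedSpace ℝ EL] [FiniteDimensional ℝ EL]
  [TopologicalSpace L] [ChartedSpace EL L] [Group L] [LieGroup 𝓘(ℝ, EL) ∞ L]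
  [NormedAddCommGroup Y] [NormedSpace ℝ Y] [FiniteDimensional ℝ Y]

lemma SmoothAt.tendsto_body {U : VField X EX F N Y} {x : X} {η : F} (hU : SmoothAt U x η) :
    Filter.Tendsto (fun x' => body (U x' η)) (nhds x) (nhds (body (U x η))) := by
  have h1 : ContinuousAt (fun z : EX => body (localRep U x z η)) (ch x x) := by
    have e : (fun z : EX => body (localRep U x z η)) = fun z => ∑ j,
        ((Module.finBasis ℝ Y).coord j ∘ₗ body) (localRep U x z η) • Module.finBasis ℝ Y j := by
      funext z
      exact ((Module.finBasis ℝ Y).sum_repr (body (localRep U x z η))).symm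
    rw [e]
    refine tendsto_finsetSum _ fun j _ => Filter.Tendsto.smul_const ?_ _
    have h2 := (hU ((Module.finBasis ℝ Y).coord j ∘ₗ body)).continuousAt
    exact ContinuousAt.comp (g := fun z : EX × F => ((Module.finBasis ℝ Y).coord j ∘ₗ body)
      (localRep U x z.1 z.2)) (f := fun z : EX => (z, η)) h2 (by fun_prop)
  have h3 : Filter.Tendsto (fun x' => body (localRep U x (ch x x') η)) (nhds x)
      (nhds (body (U x η))) := by
    rw [← localRep_self U x η]
    exact h1.tendsto.comp (continuousAt_extChartAt x)
  refine h3.congr' ?_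
  filter_upwards [(isOpen_extChartAt_source (I := 𝓘(ℝ, EX)) x).mem_nhds (mem_extChartAt_source x)]
    with x' hx'
  have := body_pullT (N := N) (tangentCoordChange 𝓘(ℝ, EX) x x' x' : EX →ₗ[ℝ] EX)
    (LinearMap.id : F →ₗ[ℝ] F) (U x' η)
  rw [localRep, (ch (EK := EX) x).left_inv hx']
  exact this

lemma value_congr {W M : Type*} [NormedAddCommGroup W] [NormedSpace ℝ W] [AddCommGroup M]
    [Module ℝ M] {D : ℕ} {f g : Y → W} {u : Y ⊗[ℝ] ExteriorAlgebra ℝ M}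
    (h : f =ᶠ[nhds (body u)] g) : value D f u = value D g u := taylor_congr h _

/-- The logarithmic derivative of `c(U)` is the logarithmic derivative of `c` at `U` applied
to `dU`. -/
lemma logR_pushv {s : MField X EX F N L EL} {U : VField X EX F N Y} {c : Y → L} {x : X} {η : F}
    (hU : LineDiffAt U x η)
    (hb : Filter.Tendsto (fun x' => body (U x' η)) (nhds x) (nhds (body (U x η))))
    (he : ∀ᶠ x' in nhds x, IsEven (U x' η)) (hc : MNear Y EL c (body (U x η)))
    (hs : ∀ᶠ x' in nhds x, s x' η = pushv c (U x' η)) :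
    logR extD s x η
      = app (value (oddDim EX F N) (rlogD Y EL (0 : Y) c) (U x η)) (extD U x η) := by
  have hsx := hs.self_of_nhds
  have hex := he.self_of_nhds
  set k := c (body (U x η)) with hk
  have hk1 : (s x η).1 = k := by rw [hsx]; rfl
  have hsrc := (isOpen_extChartAt_source (I := 𝓘(ℝ, EL)) k).mem_nhds (mem_extChartAt_source k)
  have hcs : SmoothNear (fun z => ch (EK := EL) k (c z)) (body (U x η)) :=
    hc.ch_comp (mem_extChartAt_source k)
  have h1 : extD (fun x' η' => Pt.eval (ch (EK := EL) k) (s x' η')) x η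
      = extD (fun x' η' => value (oddDim EX F N) (fun z => ch (EK := EL) k (c z))
        (U x' η')) x η := by
    refine extD_congr ?_
    filter_upwards [hs, he, hb.eventually hc.eventually_mNear,
      hb.eventually (hc.self_of_nhds.continuousAt.eventually hsrc)] with x' h1 h2 h3 h4
    rw [h1, eval_pushv h2 h3 (mNear_ch h4)]
  rw [logR, hk1, h1, extD_value hU he hcs, hsx, eval_pushv hex hc
    (mNear_rightMC (mem_extChartAt_source k)), value_congr (rlogD_eventuallyEq hc)]
  exact hex.sub_body.app_taylor_app (D := oddDim EX F N) le_rfl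
    ((mNear_rightMC (mem_extChartAt_source k)).comp hc).smoothNear hcs.fderiv _

/-- The properties of a manifold valued internal function near `(x, η)` on which its logarithmic
derivative at `(x, η)` depends. -/
structure MGoodAt (s : MField X EX F N L EL) (x : X) (η : F) : Prop where
  good : ∀ᶠ x' in nhds x, (s x' η).Good
  cont : ContinuousAt (fun x' => (s x' η).1) x
  line : LineDiffAt (fun x' η' => Pt.eval (ch (EK := EL) (s x η).1) (s x' η')) x η

lemma MGoodAt.mem_source {s : MField X EX F N L EL} {x : X} {η : F} (h : MGoodAt s x η) :
    ∀ᶠ x' in nhds x, (s x' η).1 ∈ (ch (EK := EL) (s x η).1).source :=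
  h.cont.eventually ((isOpen_extChartAt_source (I := 𝓘(ℝ, EL)) _).mem_nhds
    (mem_extChartAt_source _))

lemma MGoodAt.tendsto_body {s : MField X EX F N L EL} {x : X} {η : F} (h : MGoodAt s x η) :
    Filter.Tendsto (fun x' => body (Pt.eval (ch (EK := EL) (s x η).1) (s x' η))) (nhds x)
      (nhds (body (Pt.eval (ch (EK := EL) (s x η).1) (s x η)))) := by
  have hc := ((mNear_ch_self (EK := EL) (s x η).1).self_of_nhds.continuousAt.tendsto).comp h.cont
  rw [body_eval h.good.self_of_nhds h.mem_source.self_of_nhds]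
  refine hc.congr' ?_
  filter_upwards [h.good, h.mem_source] with x' h1 h2
  exact (body_eval h1 h2).symm

lemma LineDiffAt.lin_pair {V V' : Type*} [AddCommGroup V] [Module ℝ V] [AddCommGroup V']
    [Module ℝ V'] {U : VField X EX F N V} {U' : VField X EX F N V'} {x : X} {η : F}
    (hU : LineDiffAt U x η) (hU' : LineDiffAt U' x η) :
    LineDiffAt (fun x' η' => lin (LinearMap.inl ℝ V V') (U x' η')
      + lin (LinearMap.inr ℝ V V') (U' x' η')) x η := by
  intro i
  have h := ((hU i).linear (LinearMap.rTensor _ (LinearMap.inl ℝ V V'))).add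
    ((hU' i).linear (LinearMap.rTensor _ (LinearMap.inr ℝ V V')))
  have e : ∀ t : ℝ, localRep (fun x' η' => lin (LinearMap.inl ℝ V V') (U x' η')
      + lin (LinearMap.inr ℝ V V') (U' x' η')) x (ch x x + t • Module.finBasis ℝ EX i) η
      = LinearMap.rTensor _ (LinearMap.inl ℝ V V')
          (localRep U x (ch x x + t • Module.finBasis ℝ EX i) η)
        + LinearMap.rTensor _ (LinearMap.inr ℝ V V')
          (localRep U' x (ch x x + t • Module.finBasis ℝ EX i) η) := by
    intro t
    simp only [localRep, lin, map_add]
    congr 1 <;> rw [← LinearMap.comp_apply, ← LinearMap.comp_apply, LinearMap.lTensor_comp_rTensor,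
      LinearMap.rTensor_comp_lTensor]
  simp only [e]
  rwa [h.wderiv_eq]

/-- The right logarithmic derivative of a product. Both factors are written as smooth maps of their
joint coordinates `U`, to which the product rule for ordinary maps applies. -/
lemma logR_mul {s s' : MField X EX F N L EL} {x : X} {η : F} (h : MGoodAt s x η)
    (h' : MGoodAt s' x η) :
    logR extD (fun x' η' => (s x' η').mul (s' x' η')) x η
      = logR extD s x η + (s x η).Ad (logR extD s' x η) := by
  set k := (s x η).1 with hk
  set k' := (s' x η).1 with hk'
  let U : VField X EX F N (EL × EL) := fun x' η' =>
    lin (LinearMap.inl ℝ EL EL) (Pt.eval (ch (EK := EL) k) (s x' η'))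
      + lin (LinearMap.inr ℝ EL EL) (Pt.eval (ch (EK := EL) k') (s' x' η'))
  have hU : LineDiffAt U x η := h.line.lin_pair h'.line
  have he : ∀ᶠ x' in nhds x, IsEven (U x' η) := by
    filter_upwards [h.good, h'.good, h.mem_source, h'.mem_source] with x' h1 h2 h3 h4
    exact ((eval_isEven h1 h3).lin_apply _).add ((eval_isEven h2 h4).lin_apply _)
  have hbU : Filter.Tendsto (fun x' => body (U x' η)) (nhds x) (nhds (body (U x η))) := by
    have e : ∀ x', body (U x' η) = (body (Pt.eval (ch (EK := EL) k) (s x' η)),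
        body (Pt.eval (ch (EK := EL) k') (s' x' η))) := fun x' => by
      rw [map_add, body_lin, body_lin]; simp
    simp only [e]
    exact h.tendsto_body.prodMk_nhds h'.tendsto_body
  let c : EL × EL → L := fun z => (ch (EK := EL) k).symm z.1
  let c' : EL × EL → L := fun z => (ch (EK := EL) k').symm z.2
  have hb : body (U x η) = (ch k k, ch k' k') := by
    rw [map_add, body_lin, body_lin, body_eval h.good.self_of_nhds h.mem_source.self_of_nhds,
      body_eval h'.good.self_of_nhds h'.mem_source.self_of_nhds]
    simp [hk, hk']
  have hc : MNear (EL × EL) EL c (body (U x η)) := by rw [hb]; exact mNear_pair_fst k k'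
  have hc' : MNear (EL × EL) EL c' (body (U x η)) := by rw [hb]; exact mNear_pair_snd k k'
  have hs : ∀ᶠ x' in nhds x, s x' η = pushv c (U x' η) := by
    filter_upwards [h.good, h.mem_source, he] with x' h1 h3 h4
    have hb' : ContinuousLinearMap.fst ℝ EL EL (body (U x' η))
        = body (Pt.eval (ch (EK := EL) k) (s x' η)) := by
      rw [map_add, body_lin, body_lin]; simp
    have := pushv_clm h4 (ContinuousLinearMap.fst ℝ EL EL) (c := (ch (EK := EL) k).symm)
      (by rw [hb', body_eval h1 h3]; exact mNear_ch_symm ((ch (EK := EL) k).map_source h3))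
    rw [ContinuousLinearMap.coe_fst, lin_fst_pair] at this
    exact (this.trans (pushv_eval h1 h3)).symm
  have hs' : ∀ᶠ x' in nhds x, s' x' η = pushv c' (U x' η) := by
    filter_upwards [h'.good, h'.mem_source, he] with x' h1 h3 h4
    have hb' : ContinuousLinearMap.snd ℝ EL EL (body (U x' η))
        = body (Pt.eval (ch (EK := EL) k') (s' x' η)) := by
      rw [map_add, body_lin, body_lin]; simp
    have := pushv_clm h4 (ContinuousLinearMap.snd ℝ EL EL) (c := (ch (EK := EL) k').symm)
      (by rw [hb', body_eval h1 h3]; exact mNear_ch_symm ((ch (EK := EL) k').map_source h3))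
    rw [ContinuousLinearMap.coe_snd, lin_snd_pair] at this
    exact (this.trans (pushv_eval h1 h3)).symm
  have hmul : ∀ᶠ x' in nhds x, (s x' η).mul (s' x' η) = pushv (fun z => c z * c' z) (U x' η) := by
    filter_upwards [hs, hs', he, hbU.eventually hc.eventually_mNear,
      hbU.eventually hc'.eventually_mNear] with x' h1 h2 h3 h4 h5
    rw [h1, h2]
    exact mul_push h3.sub_body h4 h5
  have hex := he.self_of_nhds
  rw [logR_pushv hU hbU he (hc.mul hc') hmul, logR_pushv hU hbU he hc hs,
    logR_pushv hU hbU he hc' hs',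
    Pt.Ad, hs.self_of_nhds, eval_pushv hex hc (mNear_adj _)]
  have e : rlogD (EL × EL) EL (0 : EL × EL) (fun z => c z * c' z) =ᶠ[nhds (body (U x η))]
      fun z => rlogD (EL × EL) EL (0 : EL × EL) c z
        + (adj EL (c z)).comp (rlogD (EL × EL) EL (0 : EL × EL) c' z) := by
    filter_upwards [hc, hc'] with z h1 h2
    exact rlogD_mul h1 h2 (mem_ch_source_model 0 z)
  have h3 := ((mNear_adj _).comp hc).smoothNear
  rw [value_congr e]
  have e2 := hex.sub_body.taylor_add (D := oddDim EX F N) le_rfl (smoothNear_rlogD hc)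
    (h3.clm_comp (smoothNear_rlogD hc'))
  have e3 := hex.sub_body.app_taylor_app (D := oddDim EX F N) le_rfl h3 (smoothNear_rlogD hc')
    (extD U x η)
  rw [value, e2, add_app, ← e3]
  rfl

end LogR

/-! ### Naturality of the de Rham vector field -/

section Naturality

variable {EX F EX' F' : Type*}
  [NormedAddCommGroup EX] [NormedSpace ℝ EX] [FiniteDimensional ℝ EX]
  [NormedAddCommGroup F] [NormedSpace ℝ F] [FiniteDimensional ℝ F]
  [NormedAddCommGroup EX'] [NormedSpace ℝ EX'] [FiniteDimensional ℝ EX']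
  [NormedAddCommGroup F'] [NormedSpace ℝ F'] [FiniteDimensional ℝ F'] {N : ℕ}
  {W : Type*} [AddCommGroup W] [Module ℝ W]

lemma Gr.pull_ι (A : EX →ₗ[ℝ] EX') (B : F →ₗ[ℝ] F')
    (m : Module.Dual ℝ EX' × Module.Dual ℝ F' × (Fin N → ℝ)) :
    Gr.pull A B (ExteriorAlgebra.ι ℝ m)
      = ExteriorAlgebra.ι ℝ (m.1 ∘ₗ A, m.2.1 ∘ₗ B, m.2.2) :=
  ExteriorAlgebra.map_apply_ι _ _

lemma pullT_pullT {EX'' F'' : Type*} [NormedAddCommGroup EX''] [NormedSpace ℝ EX'']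
    [NormedAddCommGroup F''] [NormedSpace ℝ F''] (A : EX →ₗ[ℝ] EX') (B : F →ₗ[ℝ] F')
    (A' : EX' →ₗ[ℝ] EX'') (B' : F' →ₗ[ℝ] F'') (u : W ⊗[ℝ] Gr EX'' F'' N) :
    pullT A B (pullT A' B' u) = pullT (A' ∘ₗ A) (B' ∘ₗ B) u := by
  have h : (Gr.pull A B).comp (Gr.pull A' B') = Gr.pull (N := N) (A' ∘ₗ A) (B' ∘ₗ B) := by
    rw [Gr.pull, Gr.pull, ExteriorAlgebra.map_comp_map]
    rfl
  rw [pullT, pullT, pullT, ← h, ← LinearMap.lTensor_comp_apply]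
  rfl

lemma Gr.dx_mul_dx_symm {n : ℕ} (e : Fin n → Module.Dual ℝ EX) (c : Fin n → Fin n → ℝ)
    (hc : ∀ i j, c i j = c j i) :
    ∑ i, ∑ j, c i j • (Gr.dx (F := F) (N := N) (e i) * Gr.dx (e j)) = 0 := by
  have h : ∑ i, ∑ j, c i j • (Gr.dx (F := F) (N := N) (e i) * Gr.dx (e j))
      = -∑ i, ∑ j, c i j • (Gr.dx (F := F) (N := N) (e i) * Gr.dx (e j)) := by
    conv_rhs => rw [Finset.sum_comm]
    simp only [← Finset.sum_neg_distrib]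
    refine Finset.sum_congr rfl fun i _ => Finset.sum_congr rfl fun j _ => ?_
    rw [hc j i, ← smul_neg]
    congr 1
    exact eq_neg_of_add_eq_zero_left (ExteriorAlgebra.ι_add_mul_swap _ _)
  have h2 := eq_neg_iff_add_eq_zero.1 h
  rw [← two_smul ℝ] at h2
  exact (smul_eq_zero.1 h2).resolve_left two_ne_zero

/-- The contribution of the second derivatives to `d` of a pullback vanishes, as they are
symmetric. -/
lemma exists_hasWDeriv_pull {n : ℕ} (b : Module.Basis (Fin n) ℝ EX) {A : Fin n → ℝ → EX →L[ℝ] EX'}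
    {A₀ : EX →L[ℝ] EX'} {A' : EX →L[ℝ] EX →L[ℝ] EX'} (hA₀ : ∀ i, A i 0 = A₀)
    (hA : ∀ i, HasDerivAt (A i) (A' (b i)) 0) (hs : ∀ u v, A' u v = A' v u)
    (ϑ : Gr EX' F' N) :
    ∃ D : Fin n → Gr EX F N,
      (∀ i, HasWDeriv (fun t => Gr.pull (A i t : EX →ₗ[ℝ] EX') (0 : F →ₗ[ℝ] F') ϑ) (D i)) ∧
      ∑ i, Gr.dx (F := F) (N := N) (b.coord i) * D i = 0 := by
  induction ϑ using exterior_left_induction with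
  | h0 r =>
    refine ⟨0, fun i => ?_, by simp⟩
    simp only [AlgHom.commutes]
    exact hasWDeriv_const _
  | hadd x y hx hy =>
    obtain ⟨D, h1, h2⟩ := hx
    obtain ⟨D', h1', h2'⟩ := hy
    refine ⟨D + D', fun i => ?_, ?_⟩
    · simp only [map_add]
      exact (h1 i).add (h1' i)
    · simp only [Pi.add_apply, mul_add, Finset.sum_add_distrib, h2, h2', add_zero]
  | hmul x m hx =>
    obtain ⟨D, h1, h2⟩ := hx
    obtain ⟨a, f, p⟩ := m
    let m₀ : Module.Dual ℝ EX × Module.Dual ℝ F × (Fin N → ℝ) :=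
      (a ∘ₗ (A₀ : EX →ₗ[ℝ] EX'), f ∘ₗ (0 : F →ₗ[ℝ] F'), p)
    let q : Gr EX F N := Gr.pull (A₀ : EX →ₗ[ℝ] EX') (0 : F →ₗ[ℝ] F') x
    refine ⟨fun i => Gr.dx (a ∘ₗ (A' (b i) : EX →ₗ[ℝ] EX')) * q
      + ExteriorAlgebra.ι ℝ m₀ * D i, fun i => ?_, ?_⟩
    · -- the covector `a ∘ A i t` has derivative `a ∘ A' (b i)`
      have hm : HasWDeriv (fun t => ExteriorAlgebra.ι ℝ ((a ∘ₗ (A i t : EX →ₗ[ℝ] EX'),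
          f ∘ₗ (0 : F →ₗ[ℝ] F'), p) : Module.Dual ℝ EX × Module.Dual ℝ F × (Fin N → ℝ)))
          (Gr.dx (a ∘ₗ (A' (b i) : EX →ₗ[ℝ] EX'))) := by
        let T : (EX →L[ℝ] EX') →ₗ[ℝ] Module.Dual ℝ EX :=
          (LinearMap.llcomp ℝ EX EX' ℝ a) ∘ₗ ContinuousLinearMap.coeLM ℝ
        have h3 := ((HasDerivAt.hasWDeriv (hA i)).linear
          (ExteriorAlgebra.ι ℝ ∘ₗ LinearMap.inl ℝ (Module.Dual ℝ EX)
            (Module.Dual ℝ F × (Fin N → ℝ)) ∘ₗ T)).add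
          (hasWDeriv_const (ExteriorAlgebra.ι ℝ ((0, f ∘ₗ (0 : F →ₗ[ℝ] F'), p) :
            Module.Dual ℝ EX × Module.Dual ℝ F × (Fin N → ℝ))))
        rw [add_zero] at h3
        refine h3.congr (Filter.Eventually.of_forall fun t => ?_)
        simp only [LinearMap.comp_apply, LinearMap.inl_apply, ← map_add, Prod.mk_add_mk, add_zero,
          zero_add]
        rfl
      have h4 := hm.bilin (h1 i) (LinearMap.mul ℝ (Gr EX F N))
      simp only [LinearMap.mul_apply', hA₀ i] at h4
      refine h4.congr (Filter.Eventually.of_forall fun t => ?_)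
      simp only [map_mul, Gr.pull_ι]
    · simp only [mul_add, Finset.sum_add_distrib]
      have e1 : ∑ i, Gr.dx (F := F) (N := N) (b.coord i)
          * (Gr.dx (a ∘ₗ (A' (b i) : EX →ₗ[ℝ] EX')) * q) = 0 := by
        have e : ∀ i, Gr.dx (F := F) (N := N) (a ∘ₗ (A' (b i) : EX →ₗ[ℝ] EX'))
            = ∑ j, a (A' (b i) (b j)) • Gr.dx (b.coord j) := by
          intro i
          have e3 : a ∘ₗ (A' (b i) : EX →ₗ[ℝ] EX') = ∑ j, a (A' (b i) (b j)) • b.coord j := by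
            refine b.ext fun k => ?_
            simp [Finsupp.single_apply]
          rw [e3]
          have e4 : ∀ a : Module.Dual ℝ EX, Gr.dx (F := F) (N := N) a
            = (ExteriorAlgebra.ι ℝ ∘ₗ LinearMap.inl ℝ (Module.Dual ℝ EX)
              (Module.Dual ℝ F × (Fin N → ℝ))) a := fun _ => rfl
          simp only [e4, map_sum, map_smul]
        simp only [← mul_assoc, e, Finset.mul_sum, mul_smul_comm, ← Finset.sum_mul]
        rw [Gr.dx_mul_dx_symm _ _ (fun i j => by rw [hs]), zero_mul]
      have e2 : ∀ i, Gr.dx (F := F) (N := N) (b.coord i) * (ExteriorAlgebra.ι ℝ m₀ * D i)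
          = -(ExteriorAlgebra.ι ℝ m₀ * (Gr.dx (b.coord i) * D i)) := by
        intro i
        rw [← mul_assoc, ← mul_assoc, ← neg_mul]
        congr 1
        exact eq_neg_of_add_eq_zero_left (ExteriorAlgebra.ι_add_mul_swap _ _)
      simp only [e1, e2, Finset.sum_neg_distrib, ← Finset.mul_sum, h2, mul_zero, neg_zero, add_zero]

lemma exists_hasWDeriv_pullT {n : ℕ} (b : Module.Basis (Fin n) ℝ EX)
    {A : Fin n → ℝ → EX →L[ℝ] EX'}
    {A₀ : EX →L[ℝ] EX'} {A' : EX →L[ℝ] EX →L[ℝ] EX'} (hA₀ : ∀ i, A i 0 = A₀)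
    (hA : ∀ i, HasDerivAt (A i) (A' (b i)) 0) (hs : ∀ u v, A' u v = A' v u)
    (u : W ⊗[ℝ] Gr EX' F' N) :
    ∃ D : Fin n → W ⊗[ℝ] Gr EX F N,
      (∀ i, HasWDeriv (fun t => pullT (A i t : EX →ₗ[ℝ] EX') (0 : F →ₗ[ℝ] F') u) (D i)) ∧
      ∑ i, LinearMap.lTensor W (LinearMap.mulLeft ℝ (Gr.dx (F := F) (N := N) (b.coord i))) (D i)
        = 0 := by
  induction u using TensorProduct.induction_on with
  | zero => exact ⟨0, fun i => by simpa using hasWDeriv_const _, by simp⟩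
  | add x y hx hy =>
    obtain ⟨D, h1, h2⟩ := hx
    obtain ⟨D', h1', h2'⟩ := hy
    refine ⟨D + D', fun i => ?_, ?_⟩
    · simp only [map_add]
      exact (h1 i).add (h1' i)
    · simp only [Pi.add_apply, map_add, Finset.sum_add_distrib, h2, h2', add_zero]
  | tmul w ϑ =>
    obtain ⟨D, h1, h2⟩ := exists_hasWDeriv_pull (F := F) b hA₀ hA hs ϑ
    refine ⟨fun i => w ⊗ₜ D i, fun i => (h1 i).linear (TensorProduct.mk ℝ W (Gr EX F N) w), ?_⟩
    simp only [LinearMap.lTensor_tmul, LinearMap.mulLeft_apply, ← TensorProduct.tmul_sum, h2,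
      TensorProduct.tmul_zero]

variable [FiniteDimensional ℝ W]

/-- When the linear maps `A i t` along which a curve `u i t` is pulled back have a symmetric
derivative, `d` of the pullback only sees the derivative of `u`. -/
lemma exists_hasWDeriv_pullT_curve {n : ℕ} (b : Module.Basis (Fin n) ℝ EX)
    {A : Fin n → ℝ → EX →L[ℝ] EX'}
    {A₀ : EX →L[ℝ] EX'} {A' : EX →L[ℝ] EX →L[ℝ] EX'} (hA₀ : ∀ i, A i 0 = A₀)
    (hA : ∀ i, HasDerivAt (A i) (A' (b i)) 0) (hs : ∀ u v, A' u v = A' v u)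
    {u : Fin n → ℝ → W ⊗[ℝ] Gr EX' F' N} {u₀ : W ⊗[ℝ] Gr EX' F' N} {u' : Fin n → W ⊗[ℝ] Gr EX' F' N}
    (hu₀ : ∀ i, u i 0 = u₀) (hu : ∀ i, HasWDeriv (u i) (u' i)) :
    ∃ D : Fin n → W ⊗[ℝ] Gr EX F N,
      (∀ i, HasWDeriv (fun t => pullT (A i t : EX →ₗ[ℝ] EX') (0 : F →ₗ[ℝ] F') (u i t)) (D i)) ∧
      ∑ i, LinearMap.lTensor W (LinearMap.mulLeft ℝ (Gr.dx (F := F) (N := N) (b.coord i))) (D i)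
        = ∑ i, LinearMap.lTensor W (LinearMap.mulLeft ℝ (Gr.dx (F := F) (N := N) (b.coord i)))
          (pullT (A₀ : EX →ₗ[ℝ] EX') (0 : F →ₗ[ℝ] F') (u' i)) := by
  let β := Module.finBasis ℝ (W ⊗[ℝ] Gr EX' F' N)
  choose D h1 h2 using fun k => exists_hasWDeriv_pullT (F := F) b hA₀ hA hs (β k)
  have expand : ∀ (T : W ⊗[ℝ] Gr EX' F' N →ₗ[ℝ] W ⊗[ℝ] Gr EX F N) (v : W ⊗[ℝ] Gr EX' F' N),
      T v = ∑ k, β.coord k v • T (β k) := by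
    intro T v
    conv_lhs => rw [← β.sum_repr v]
    rw [map_sum]
    simp only [map_smul, Module.Basis.coord_apply]
  refine ⟨fun i => pullT (A₀ : EX →ₗ[ℝ] EX') (0 : F →ₗ[ℝ] F') (u' i)
    + ∑ k, β.coord k u₀ • D k i, fun i => ?_, ?_⟩
  · have h3 : ∀ k, HasWDeriv (fun t => β.coord k (u i t)
        • pullT (A i t : EX →ₗ[ℝ] EX') (0 : F →ₗ[ℝ] F') (β k))
        (β.coord k (u' i) • pullT (A₀ : EX →ₗ[ℝ] EX') (0 : F →ₗ[ℝ] F') (β k)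
          + β.coord k u₀ • D k i) := by
      intro k
      have h4 := (HasWDeriv.linear (hu i) (β.coord k)).bilin (h1 k i)
        (LinearMap.lsmul ℝ (W ⊗[ℝ] Gr EX F N))
      simp only [hA₀ i, hu₀ i] at h4
      exact h4
    have e : (fun t => pullT (A i t : EX →ₗ[ℝ] EX') (0 : F →ₗ[ℝ] F') (u i t))
        = fun t => ∑ k, β.coord k (u i t)
          • pullT (A i t : EX →ₗ[ℝ] EX') (0 : F →ₗ[ℝ] F') (β k) := funext fun t => expand _ _
    rw [e]
    beta_reduce
    rw [expand (pullT (A₀ : EX →ₗ[ℝ] EX') (0 : F →ₗ[ℝ] F')), ← Finset.sum_add_distrib]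
    intro l
    simp only [map_sum]
    exact HasDerivAt.fun_sum fun k _ => h3 k l
  · simp only [map_add, Finset.sum_add_distrib, map_sum, map_smul]
    rw [Finset.sum_comm (f := fun i k => β.coord k u₀ • LinearMap.lTensor W (LinearMap.mulLeft ℝ
      (Gr.dx (F := F) (N := N) (b.coord i))) (D k i))]
    simp only [← Finset.smul_sum, h2, smul_zero, Finset.sum_const_zero, add_zero]

/-- Contraction of a pulled back covector: `∑ᵢ dxⁱ ∧ A^*(∑ⱼ (A eᵢ)ʲ vⱼ) = A^*(∑ⱼ dxʲ ∧ vⱼ)`. -/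
lemma sum_dx_pullT {n n' : ℕ} (b : Module.Basis (Fin n) ℝ EX) (b' : Module.Basis (Fin n') ℝ EX')
    (A : EX →L[ℝ] EX') (v : Fin n' → W ⊗[ℝ] Gr EX' F' N) :
    ∑ i, LinearMap.lTensor W (LinearMap.mulLeft ℝ (Gr.dx (F := F) (N := N) (b.coord i)))
        (pullT (A : EX →ₗ[ℝ] EX') (0 : F →ₗ[ℝ] F') (∑ j, b'.coord j (A (b i)) • v j))
      = pullT (A : EX →ₗ[ℝ] EX') (0 : F →ₗ[ℝ] F') (∑ j, LinearMap.lTensor W (LinearMap.mulLeft ℝ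
        (Gr.dx (F := F') (N := N) (b'.coord j))) (v j)) := by
  have key : ∀ (j : Fin n') (u : W ⊗[ℝ] Gr EX' F' N),
      ∑ i, b'.coord j (A (b i)) • LinearMap.lTensor W (LinearMap.mulLeft ℝ
        (Gr.dx (F := F) (N := N) (b.coord i))) (pullT (A : EX →ₗ[ℝ] EX') (0 : F →ₗ[ℝ] F') u)
      = pullT (A : EX →ₗ[ℝ] EX') (0 : F →ₗ[ℝ] F') (LinearMap.lTensor W (LinearMap.mulLeft ℝ
        (Gr.dx (F := F') (N := N) (b'.coord j))) u) := by
    intro j u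
    induction u using TensorProduct.induction_on with
    | zero => simp
    | add x y hx hy => simp only [map_add, smul_add, Finset.sum_add_distrib, hx, hy]
    | tmul w ϑ =>
      simp only [pullT, LinearMap.lTensor_tmul, LinearMap.mulLeft_apply, ← TensorProduct.tmul_smul,
        ← TensorProduct.tmul_sum, AlgHom.toLinearMap_apply, map_mul]
      congr 1
      simp only [← smul_mul_assoc, ← Finset.sum_mul]
      congr 1
      rw [Gr.dx, Gr.pull_ι]
      have e3 : b'.coord j ∘ₗ (A : EX →ₗ[ℝ] EX') = ∑ i, b'.coord j (A (b i)) • b.coord i := by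
        refine b.ext fun k => ?_
        simp [Finsupp.single_apply]
      have e4 : ∀ a : Module.Dual ℝ EX, Gr.dx (F := F) (N := N) a
        = (ExteriorAlgebra.ι ℝ ∘ₗ LinearMap.inl ℝ (Module.Dual ℝ EX)
          (Module.Dual ℝ F × (Fin N → ℝ))) a := fun _ => rfl
      simp only [e4, ← map_smul, ← map_sum, ← e3]
      rfl
  simp only [map_sum, map_smul, ← key]
  exact Finset.sum_comm

end Naturality

/-! ### Pullbacks along smooth maps -/

section PullField

variable {EX X F EX' X' : Type*}
  [NormedAddCommGroup EX] [NormedSpace ℝ EX] [FiniteDimensional ℝ EX]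
  [TopologicalSpace X] [ChartedSpace EX X] [IsManifold 𝓘(ℝ, EX) ∞ X]
  [NormedAddCommGroup F] [NormedSpace ℝ F] [FiniteDimensional ℝ F]
  [NormedAddCommGroup EX'] [NormedSpace ℝ EX'] [FiniteDimensional ℝ EX']
  [TopologicalSpace X'] [ChartedSpace EX' X'] [IsManifold 𝓘(ℝ, EX') ∞ X'] {N : ℕ}
  {W : Type*} [AddCommGroup W] [Module ℝ W]
  {f : X → X'}

variable (EX EX') in
/-- The derivative of `f` at `x`. -/
def tangentMapAt (f : X → X') (x : X) : EX →L[ℝ] EX' := mfderiv 𝓘(ℝ, EX) 𝓘(ℝ, EX') f x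

variable (EX F) in
/-- The pullback along `f` of functions on `T[1]X'` to functions on `T[1](X × F[1])`. -/
def pullField (f : X → X') (s : VField X' EX' PUnit.{1} N W) : VField X EX F N W := fun x _ =>
  pullT (tangentMapAt EX EX' f x : EX →ₗ[ℝ] EX') (0 : F →ₗ[ℝ] PUnit.{1}) (s (f x) 0)

variable (EX EX') in
/-- The expression of `f` in the charts at `x` and `f x`. -/
abbrev rep (f : X → X') (x : X) (z : EX) : EX' :=
  ch (EK := EX') (f x) (f ((ch (EK := EX) x).symm z))

lemma smoothNear_rep (hf : ContMDiff 𝓘(ℝ, EX) 𝓘(ℝ, EX') ∞ f) (x : X) :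
    SmoothNear (rep EX EX' f x) (ch x x) := by
  refine MNear.ch_comp ((ContMDiff.mNear hf _).comp (mNear_ch_symm_self x)) ?_
  rw [ch_symm_self]
  exact mem_extChartAt_source _

lemma tangentCoordChange_eq_chD {a b : X} {h : X} :
    (tangentCoordChange 𝓘(ℝ, EX) a b h : EX →L[ℝ] EX) = chD EX EX a b (fun k => k) h := by
  rw [tangentCoordChange_def, modelWithCornersSelf_coe, Set.range_id, fderivWithin_univ]
  rfl

lemma tangentMapAt_eq_chD (hf : ContMDiff 𝓘(ℝ, EX) 𝓘(ℝ, EX') ∞ f) (x : X) :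
    tangentMapAt EX EX' f x = chD EX EX' x (f x) f x := mfderiv_eq_chD (hf x)

lemma localRep_pullField (hf : ContMDiff 𝓘(ℝ, EX) 𝓘(ℝ, EX') ∞ f)
    (s : VField X' EX' PUnit.{1} N W) (x : X) (η : F) :
    ∀ᶠ z in nhds (ch x x), localRep (pullField EX F f s) x z η
      = pullT (fderiv ℝ (rep EX EX' f x) z : EX →ₗ[ℝ] EX') (0 : F →ₗ[ℝ] PUnit.{1})
        (localRep s (f x) (rep EX EX' f x z) 0) := by
  have h1 : ∀ᶠ z in nhds (ch (EK := EX) x x),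
      f ((ch (EK := EX) x).symm z) ∈ (ch (EK := EX') (f x)).source :=
    (tendsto_ch_symm x).eventually (hf.continuous.continuousAt.eventually
      ((isOpen_extChartAt_source (f x)).mem_nhds (mem_extChartAt_source _)))
  filter_upwards [h1, ch_target_mem_nhds (ch_self_mem_target x)] with z hz hzt
  set q := (ch (EK := EX) x).symm z with hq
  have hqs : q ∈ (ch (EK := EX) x).source := (ch (EK := EX) x).map_target hzt
  have hqz : ch (EK := EX) x q = z := (ch (EK := EX) x).right_inv hzt
  have e1 : (ch (EK := EX') (f x)).symm (rep EX EX' f x z) = f q := (ch (f x)).left_inv hz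
  have sq := mem_extChartAt_source (I := 𝓘(ℝ, EX)) q
  have sfq := mem_extChartAt_source (I := 𝓘(ℝ, EX')) (f q)
  have hrep : fderiv ℝ (rep EX EX' f x) z = chD EX EX' x (f x) f q := by rw [chD, hqz]
  have key : (tangentMapAt EX EX' f q).comp (tangentCoordChange 𝓘(ℝ, EX) x q q)
      = (tangentCoordChange 𝓘(ℝ, EX') (f x) (f q) (f q)).comp
        (fderiv ℝ (rep EX EX' f x) z) := by
    rw [tangentMapAt_eq_chD hf, tangentCoordChange_eq_chD, tangentCoordChange_eq_chD, hrep,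
      ← chD_comp (f := fun k : X => k) (g := f) contMDiffAt_id (hf q) hqs sq sfq,
      ← chD_comp (f := f) (g := fun k : X' => k) (hf q) contMDiffAt_id hqs hz sfq]
  have key' : (tangentMapAt EX EX' f q : EX →ₗ[ℝ] EX')
      ∘ₗ (tangentCoordChange 𝓘(ℝ, EX) x q q : EX →ₗ[ℝ] EX)
      = (tangentCoordChange 𝓘(ℝ, EX') (f x) (f q) (f q) : EX' →ₗ[ℝ] EX')
        ∘ₗ (fderiv ℝ (rep EX EX' f x) z : EX →ₗ[ℝ] EX') :=
    congrArg (fun T : EX →L[ℝ] EX' => (T : EX →ₗ[ℝ] EX')) key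
  change pullT (tangentCoordChange 𝓘(ℝ, EX) x q q : EX →L[ℝ] EX).toLinearMap LinearMap.id
    (pullT _ _ (s (f q) 0)) = pullT _ _ (pullT (tangentCoordChange 𝓘(ℝ, EX') (f x)
      ((ch (EK := EX') (f x)).symm (rep EX EX' f x z))
      ((ch (EK := EX') (f x)).symm (rep EX EX' f x z)) : EX' →L[ℝ] EX').toLinearMap LinearMap.id
        (s ((ch (EK := EX') (f x)).symm (rep EX EX' f x z)) 0))
  rw [e1, pullT_pullT, pullT_pullT, key']
  rfl

lemma hasDerivAt_line {V : Type*} [NormedAddCommGroup V] [NormedSpace ℝ V] (a w : V) :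
    HasDerivAt (fun t : ℝ => a + t • w) w 0 := by
  simpa using ((hasDerivAt_id (0 : ℝ)).smul_const w).const_add a

variable [FiniteDimensional ℝ W]

/-- The derivative along the coordinate lines of `X` of the local representative on `X'`. -/
lemma hasWDeriv_localRep_rep (hf : ContMDiff 𝓘(ℝ, EX) 𝓘(ℝ, EX') ∞ f)
    {s : VField X' EX' PUnit.{1} N W} {x : X} (hs : SmoothAt s (f x) 0) (v : EX) :
    HasWDeriv (fun t : ℝ => localRep s (f x) (rep EX EX' f x (ch x x + t • v)) 0)
      (∑ j, (Module.finBasis ℝ EX').coord j (fderiv ℝ (rep EX EX' f x) (ch x x) v) •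
        wderiv fun t : ℝ => localRep s (f x)
          (ch (f x) (f x) + t • Module.finBasis ℝ EX' j) 0) := by
  intro l
  let R : EX' → ℝ := fun z => l (localRep s (f x) z 0)
  have hr0 : rep EX EX' f x (ch x x) = ch (f x) (f x) := by simp only [rep, ch_symm_self]
  have hR : DifferentiableAt ℝ R (ch (f x) (f x)) := by
    have h1 := (hs l).differentiableAt (by simp)
    exact DifferentiableAt.comp (g := fun z : EX' × PUnit.{1} => l (localRep s (f x) z.1 z.2))
      (f := fun z : EX' => (z, (0 : PUnit.{1}))) (ch (f x) (f x)) h1 (by fun_prop)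
  have hj : ∀ j, l (wderiv fun t : ℝ => localRep s (f x)
      (ch (f x) (f x) + t • Module.finBasis ℝ EX' j) 0)
      = fderiv ℝ R (ch (f x) (f x)) (Module.finBasis ℝ EX' j) := by
    intro j
    refine (hs.hasWDeriv (Module.finBasis ℝ EX' j) l).unique ?_
    refine HasFDerivAt.comp_hasDerivAt (l := R) (0 : ℝ) ?_ (hasDerivAt_line _ _)
    simpa using hR.hasFDerivAt
  simp only [map_sum, map_smul, smul_eq_mul, hj]
  have e : ∑ j, (Module.finBasis ℝ EX').coord j (fderiv ℝ (rep EX EX' f x) (ch x x) v) *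
      fderiv ℝ R (ch (f x) (f x)) (Module.finBasis ℝ EX' j)
      = fderiv ℝ R (ch (f x) (f x)) (fderiv ℝ (rep EX EX' f x) (ch x x) v) := by
    conv_rhs => rw [← (Module.finBasis ℝ EX').sum_repr (fderiv ℝ (rep EX EX' f x) (ch x x) v)]
    rw [map_sum]
    simp only [map_smul, smul_eq_mul, Module.Basis.coord_apply]
  rw [e]
  have hd : HasFDerivAt (rep EX EX' f x) (fderiv ℝ (rep EX EX' f x) (ch x x))
      (ch x x + (0 : ℝ) • v) := by
    rw [zero_smul, add_zero]
    exact ((smoothNear_rep hf x).self_of_nhds.differentiableAt (by simp)).hasFDerivAt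
  have h2 := hd.comp_hasDerivAt (0 : ℝ) (hasDerivAt_line (ch (EK := EX) x x) v)
  refine HasFDerivAt.comp_hasDerivAt (l := R) (0 : ℝ) ?_ h2
  simp only [zero_smul, add_zero, hr0]
  exact hR.hasFDerivAt

/-- The pullback is differentiable along coordinate lines and commutes with `d`: in charts, the
second derivatives of `f` cancel by symmetry. -/
lemma lineDiffAt_pullField_and_extD (hf : ContMDiff 𝓘(ℝ, EX) 𝓘(ℝ, EX') ∞ f)
    {s : VField X' EX' PUnit.{1} N W} {x : X} (hs : SmoothAt s (f x) 0) (η : F) :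
    LineDiffAt (pullField EX F f s) x η ∧
      extD (pullField EX F f s) x η = pullField EX F f (extD s) x η := by
  have hr := (smoothNear_rep hf x).self_of_nhds
  have hr0 : rep EX EX' f x (ch x x) = ch (f x) (f x) := by simp only [rep, ch_symm_self]
  have hd2 : DifferentiableAt ℝ (fderiv ℝ (rep EX EX' f x)) (ch x x) :=
    (hr.fderiv_right (m := 1) (by norm_cast)).differentiableAt (by simp)
  have hsym : ∀ u v, fderiv ℝ (fderiv ℝ (rep EX EX' f x)) (ch x x) u v
      = fderiv ℝ (fderiv ℝ (rep EX EX' f x)) (ch x x) v u :=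
    fun u v => (hr.isSymmSndFDerivAt (by
      rw [minSmoothness_of_isRCLikeNormedField]
      exact WithTop.coe_le_coe.2 (le_top : (2 : ℕ∞) ≤ ⊤))) u v
  have hA : ∀ i, HasDerivAt (fun t : ℝ => fderiv ℝ (rep EX EX' f x)
      (ch x x + t • Module.finBasis ℝ EX i))
      (fderiv ℝ (fderiv ℝ (rep EX EX' f x)) (ch x x) (Module.finBasis ℝ EX i)) 0 := by
    intro i
    refine HasFDerivAt.comp_hasDerivAt (l := fderiv ℝ (rep EX EX' f x)) (0 : ℝ) ?_
      (f := fun t : ℝ => ch (EK := EX) x x + t • Module.finBasis ℝ EX i) ?_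
    · simpa using hd2.hasFDerivAt
    · exact hasDerivAt_line _ _
  obtain ⟨D, h1, h2⟩ := exists_hasWDeriv_pullT_curve (F := F) (N := N) (W := W)
    (Module.finBasis ℝ EX) (A₀ := fderiv ℝ (rep EX EX' f x) (ch x x)) (fun i => by simp) hA hsym
    (u₀ := localRep s (f x) (ch (f x) (f x)) 0)
    (fun i => by simp only [zero_smul, add_zero, hr0])
    (fun i => hasWDeriv_localRep_rep hf hs (Module.finBasis ℝ EX i))
  have h3 : ∀ i, HasWDeriv (fun t : ℝ => localRep (pullField EX F f s) x
      (ch x x + t • Module.finBasis ℝ EX i) η) (D i) := fun i => (h1 i).congr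
    ((tendsto_line _ _).eventually (localRep_pullField hf s x η))
  refine ⟨fun i => by rw [(h3 i).wderiv_eq]; exact h3 i, ?_⟩
  have hrf : fderiv ℝ (rep EX EX' f x) (ch x x) = tangentMapAt EX EX' f x := by
    rw [tangentMapAt_eq_chD hf, chD]
  rw [extD]
  simp only [fun i => (h3 i).wderiv_eq]
  rw [h2, sum_dx_pullT (Module.finBasis ℝ EX) (Module.finBasis ℝ EX')
    (fderiv ℝ (rep EX EX' f x) (ch x x)), hrf, pullField, pullField, extD, map_add]
  congr 1
  -- the fiber of the base is trivial, so both contractions are along the zero form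
  have h4 : ∀ (c : Module.Dual ℝ (Module.Dual ℝ EX × Module.Dual ℝ F × (Fin N → ℝ)))
      (c' : Module.Dual ℝ (Module.Dual ℝ EX' × Module.Dual ℝ PUnit.{1} × (Fin N → ℝ)))
      (A : EX →ₗ[ℝ] EX'), c ∘ₗ (A.dualMap.prodMap
        ((0 : F →ₗ[ℝ] PUnit.{1}).dualMap.prodMap LinearMap.id)) = c' →
      ∀ u : W ⊗[ℝ] Gr EX' PUnit.{1} N, LinearMap.lTensor W (Gr.contract c)
        (pullT A (0 : F →ₗ[ℝ] PUnit.{1}) u)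
        = pullT A (0 : F →ₗ[ℝ] PUnit.{1}) (LinearMap.lTensor W (Gr.contract c') u) := by
    rintro c c' A rfl u
    induction u using TensorProduct.induction_on with
    | zero => simp
    | add x y hx hy => simp only [map_add, hx, hy]
    | tmul w a =>
      simp only [pullT, LinearMap.lTensor_tmul]
      congr 1
      exact contr_map _ c a
  refine h4 _ _ _ ?_ _
  ext m
  · simp
  · simp only [LinearMap.comp_apply, LinearMap.inl_apply, LinearMap.inr_apply,
      LinearMap.prodMap_apply, LinearMap.fst_apply, LinearMap.snd_apply, LinearMap.dualMap_apply',
      LinearMap.comp_zero, map_zero]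
    simp
  · simp

end PullField

section PullLogR

variable {EX X F EX' X' : Type*}
  [NormedAddCommGroup EX] [NormedSpace ℝ EX] [FiniteDimensional ℝ EX]
  [TopologicalSpace X] [ChartedSpace EX X] [IsManifold 𝓘(ℝ, EX) ∞ X]
  [NormedAddCommGroup F] [NormedSpace ℝ F] [FiniteDimensional ℝ F]
  [NormedAddCommGroup EX'] [NormedSpace ℝ EX'] [FiniteDimensional ℝ EX']
  [TopologicalSpace X'] [ChartedSpace EX' X'] [IsManifold 𝓘(ℝ, EX') ∞ X'] {N : ℕ}
  {EL L : Type*}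
  [NormedAddCommGroup EL] [NormedSpace ℝ EL] [FiniteDimensional ℝ EL]
  [TopologicalSpace L] [ChartedSpace EL L] [Group L] [LieGroup 𝓘(ℝ, EL) ∞ L]
  {f : X → X'}

variable (EX F) in
/-- The pullback along `f` of manifold valued functions on `T[1]X'`. -/
def pullMField (f : X → X') (s : MField X' EX' PUnit.{1} N L EL) : MField X EX F N L EL :=
  fun x _ => Pt.pull (tangentMapAt EX EX' f x : EX →ₗ[ℝ] EX')
    (0 : F →ₗ[ℝ] PUnit.{1}) (s (f x) 0)

lemma MGoodAt.pullMField (hf : ContMDiff 𝓘(ℝ, EX) 𝓘(ℝ, EX') ∞ f)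
    {s : MField X' EX' PUnit.{1} N L EL} {x : X} (hs : MGoodAt s (f x) 0)
    (hsm : SmoothAt (fun x' w => Pt.eval (ch (EK := EL) (s (f x) 0).1) (s x' w)) (f x) 0) (η : F) :
    MGoodAt (pullMField EX F f s) x η := by
  have hfc : Filter.Tendsto f (nhds x) (nhds (f x)) := hf.continuous.continuousAt
  refine ⟨(hfc.eventually hs.good).mono fun x' h => h.pull _ _, hs.cont.tendsto.comp hfc,
    (lineDiffAt_pullField_and_extD hf hsm η).1.congr ?_⟩
  filter_upwards [hfc.eventually hs.good, hfc.eventually hs.mem_source] with x' h1 h2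
  exact eval_pull _ _ h1 (mNear_ch h2)

/-- The right logarithmic derivative commutes with pullbacks. -/
lemma logR_pullMField (hf : ContMDiff 𝓘(ℝ, EX) 𝓘(ℝ, EX') ∞ f)
    {s : MField X' EX' PUnit.{1} N L EL} {x : X} (hs : MGoodAt s (f x) 0)
    (hsm : SmoothAt (fun x' w => Pt.eval (ch (EK := EL) (s (f x) 0).1) (s x' w)) (f x) 0) (η : F) :
    logR extD (pullMField EX F f s) x η = pullField EX F f (logR extD s) x η := by
  set k := (s (f x) 0).1 with hk
  let U : VField X' EX' PUnit.{1} N EL := fun x' η' => Pt.eval (ch (EK := EL) k) (s x' η')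
  have hU : SmoothAt U (f x) 0 := hsm
  have he : ∀ᶠ x' in nhds (f x), IsEven (U x' 0) := by
    filter_upwards [hs.good, hs.mem_source] with x' h1 h3
    exact eval_isEven h1 h3
  have hb : body (U (f x) 0) = ch k k :=
    body_eval hs.good.self_of_nhds hs.mem_source.self_of_nhds
  have hc : MNear EL EL (ch (EK := EL) k).symm (body (U (f x) 0)) := by
    rw [hb]; exact mNear_ch_symm_self k
  have hpv : ∀ᶠ x' in nhds (f x), s x' 0 = pushv (ch (EK := EL) k).symm (U x' 0) := by
    filter_upwards [hs.good, hs.mem_source] with x' h1 h3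
    exact (pushv_eval h1 h3).symm
  have hfc : Filter.Tendsto f (nhds x) (nhds (f x)) := hf.continuous.continuousAt
  have hbP : ∀ x', body (pullField EX F f U x' η) = body (U (f x') 0) := fun x' =>
    body_pullT _ _ _
  obtain ⟨hl, hd⟩ := lineDiffAt_pullField_and_extD hf hU η
  have hex := he.self_of_nhds
  rw [logR_pushv (X := X) hl (c := (ch (EK := EL) k).symm), hd, pullField, pullField, pullField,
    logR_pushv hU.lineDiffAt hU.tendsto_body he hc hpv, pullT_app,
    pullT_value _ _ hex (smoothNear_rlogD hc)]
  · simp only [hbP]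
    exact hU.tendsto_body.comp hfc
  · filter_upwards [hfc.eventually he] with x' h1
    exact h1.pullT _ _
  · rw [hbP]
    exact hc
  · filter_upwards [hfc.eventually he, hfc.eventually hpv,
      hfc.eventually (hU.tendsto_body.eventually hc.eventually_mNear)] with x' h1 h2 h3
    rw [pullMField, h2, pushv, pull_push _ _ h1.sub_body h3, pushv, map_sub, hbP, pullT_tmul_one]
    rfl

end PullLogR

/-! ### Regularity of internal functions -/

section Regularity

variable {EX X F : Type*} [NormedAddCommGroup EX] [NormedSpace ℝ EX] [FiniteDimensional ℝ EX]
  [TopologicalSpace X] [ChartedSpace EX X] [IsManifold 𝓘(ℝ, EX) ∞ X]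
  [NormedAddCommGroup F] [NormedSpace ℝ F] [FiniteDimensional ℝ F] {N : ℕ}
  {EK K : Type*} [NormedAddCommGroup EK] [NormedSpace ℝ EK] [FiniteDimensional ℝ EK]
  [TopologicalSpace K] [ChartedSpace EK K]
  {deg : Fin N → ℤ} {U : Set X} {s s' : MField X EX F N K EK} {x : X}

lemma scale_neg_one (hdeg : ∀ j, Odd (deg j)) :
    Gr.scale (EX := EX) (F := F) deg (-1) = parity := by
  rw [Gr.scale, parity]
  congr 1
  refine LinearMap.ext fun v => ?_
  refine Prod.ext ?_ (Prod.ext ?_ (funext fun j => ?_))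
  · simp
  · simp
  · simp [(hdeg j).neg_one_zpow]

/-- The displacement of a manifold valued internal function of degree `0` is even: the rescaling
by `-1` of all coordinates is the parity. -/
lemma IsMField.good (hs : IsMField deg U s) (hdeg : ∀ j, Odd (deg j)) (hx : x ∈ U) (η : F) :
    (s x η).Good := by
  intro l
  constructor
  · have h := (hs.2.2.2 (-1) (by norm_num) x hx η).2
    rw [scale_neg_one hdeg] at h
    have e : ((-1 : ℝ) ^ 2) • η = η := by norm_num
    rw [e] at h
    have h2 := comp_lTensor (parity (M := Module.Dual ℝ EX × Module.Dual ℝ F ×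
      (Fin N → ℝ))).toLinearMap l (s x η).2
    rw [h] at h2
    exact mem_evenPart.2 h2.symm
  · have h := hs.1 x hx η
    have h2 := comp_lTensor (ExteriorAlgebra.algebraMapInv
      (R := ℝ) (M := Module.Dual ℝ EX × Module.Dual ℝ F × (Fin N → ℝ))).toLinearMap l (s x η).2
    rw [h, map_zero] at h2
    exact h2.symm

lemma IsMField.mGoodAt (hs : IsMField deg U s) (hdeg : ∀ j, Odd (deg j)) (hU : IsOpen U)
    (hx : x ∈ U) (η : F) : MGoodAt s x η := by
  refine ⟨?_, ?_, (hs.2.2.1 x hx η).lineDiffAt⟩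
  · filter_upwards [hU.mem_nhds hx] with x' hx' using hs.good hdeg hx' η
  · have h1 : ContinuousOn (fun z : X × F => (s z.1 z.2).1) (U ×ˢ Set.univ) := hs.2.1.continuousOn
    have h2 := h1.continuousAt ((hU.prod isOpen_univ).mem_nhds
      (show ((x, η) : X × F) ∈ U ×ˢ Set.univ from ⟨hx, trivial⟩))
    exact ContinuousAt.comp (g := fun z : X × F => (s z.1 z.2).1) (f := fun x' => (x', η)) h2
      (by fun_prop)

lemma logR_congr [Group K] {η : F} (h : ∀ᶠ x' in nhds x, s x' η = s' x' η) :
    logR extD s x η = logR extD s' x η := by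
  rw [logR, logR, h.self_of_nhds]
  congr 1
  refine extD_congr ?_
  filter_upwards [h] with x' hx'
  rw [hx']

end Regularity

/-! ### Change of a quasi trivializer -/

section Algebra

variable {EX F : Type*} [NormedAddCommGroup EX] [NormedSpace ℝ EX] [FiniteDimensional ℝ EX]
  [NormedAddCommGroup F] [NormedSpace ℝ F] [FiniteDimensional ℝ F] {N : ℕ}
  {𝔢 E 𝔤 G : Type*}
  [NormedAddCommGroup 𝔢] [NormedSpace ℝ 𝔢] [FiniteDimensional ℝ 𝔢]
  [TopologicalSpace E] [ChartedSpace 𝔢 E] [Group E] [LieGroup 𝓘(ℝ, 𝔢) ∞ E]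
  [NormedAddCommGroup 𝔤] [NormedSpace ℝ 𝔤] [FiniteDimensional ℝ 𝔤]
  [TopologicalSpace G] [ChartedSpace 𝔤 G] [Group G] [LieGroup 𝓘(ℝ, 𝔤) ∞ G]
  (cm : LieCrossedModule 𝔢 E 𝔤 G)

lemma Pt.mul_eq_of_eq_mul_inv {p q r : Pt E 𝔢 EX F N} (hq : q.Good) (hr : r.Good)
    (h : p = q.mul r.inv) : q = p.mul r := by
  have e : hq.gpt = hq.gpt * hr.gpt⁻¹ * hr.gpt := by group
  rw [h]
  exact congrArg Subtype.val e

namespace LieCrossedModule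

lemma eq_pτ_mul_of_mul_eq {T t : Pt E 𝔢 EX F N} {f f' : Pt G 𝔤 EX F N} (hT : T.Good) (ht : t.Good)
    (hf : f.Good) (hf' : f'.Good)
    (h : (cm.pτ (T.mul t)).mul f = (cm.pτ T).mul f') : f' = (cm.pτ t).mul f := by
  rw [cm.pτ_mul hT ht] at h
  have h1 : (cm.pτ_good hT).gpt * (cm.pτ_good ht).gpt * hf.gpt = (cm.pτ_good hT).gpt * hf'.gpt :=
    Subtype.ext h
  rw [mul_assoc] at h1
  have h2 := mul_left_cancel h1
  exact (congrArg Subtype.val h2).symm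

/-- The change of `Tᵢₖ⁻¹ μ(τ(Tᵢⱼ) f, Tⱼₖ) Tᵢⱼ` when each `T` is replaced by `T t⁻¹`. -/
lemma inv_mul_pμ_mul_change {Tij Tjk Tik tij tjk tik : Pt E 𝔢 EX F N} {f : Pt G 𝔤 EX F N}
    (h1 : Tij.Good) (h2 : Tjk.Good) (h3 : Tik.Good) (h4 : tij.Good) (h5 : tjk.Good)
    (h6 : tik.Good) (hf : f.Good) :
    ((Tik.mul tik.inv).inv.mul (cm.pμ ((cm.pτ Tij).mul f) (Tjk.mul tjk.inv))).mul
        (Tij.mul tij.inv)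
      = ((tik.mul ((Tik.inv.mul (cm.pμ ((cm.pτ Tij).mul f) Tjk)).mul Tij)).mul
          (cm.pμ f tjk.inv)).mul tij.inv := by
  have hg := (cm.pτ_good h1).mul hf
  have hX := cm.pμ_good hf h5.inv
  rw [cm.pμ_mul_right hg h2 h5.inv, cm.pμ_mul_left (cm.pτ_good h1) hf h5.inv, cm.pμ_pτ h1 hX]
  have hA := cm.pμ_good hg h2
  have e : (h3.gpt * h6.gpt⁻¹)⁻¹ * (hA.gpt * (h1.gpt * hX.gpt * h1.gpt⁻¹)) * (h1.gpt * h4.gpt⁻¹)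
      = h6.gpt * (h3.gpt⁻¹ * hA.gpt * h1.gpt) * hX.gpt * h4.gpt⁻¹ := by group
  exact congrArg Subtype.val e

end LieCrossedModule

end Algebra

/-! ### Descent of the equivalence to the base -/

section Descent

variable {𝔢 E 𝔤 G EM M EP P0 EQ P1 : Type*}
  [NormedAddCommGroup 𝔢] [NormedSpace ℝ 𝔢] [FiniteDimensional ℝ 𝔢]
  [TopologicalSpace E] [ChartedSpace 𝔢 E] [Group E] [LieGroup 𝓘(ℝ, 𝔢) ∞ E]
  [NormedAddCommGroup 𝔤] [NormedSpace ℝ 𝔤] [FiniteDimensional ℝ 𝔤]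
  [TopologicalSpace G] [ChartedSpace 𝔤 G] [Group G] [LieGroup 𝓘(ℝ, 𝔤) ∞ G]
  {cm : LieCrossedModule 𝔢 E 𝔤 G}
  [NormedAddCommGroup EM] [NormedSpace ℝ EM] [FiniteDimensional ℝ EM]
  [TopologicalSpace M] [ChartedSpace EM M] [IsManifold 𝓘(ℝ, EM) ∞ M]
  [NormedAddCommGroup EP] [NormedSpace ℝ EP] [FiniteDimensional ℝ EP]
  [TopologicalSpace P0] [ChartedSpace EP P0] [IsManifold 𝓘(ℝ, EP) ∞ P0]
  [NormedAddCommGroup EQ] [NormedSpace ℝ EQ] [FiniteDimensional ℝ EQ]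
  [TopologicalSpace P1] [ChartedSpace EQ P1] [IsManifold 𝓘(ℝ, EQ) ∞ P1]
  {P : PreTwoBundle cm EM M EP P0 EQ P1} {ι : Type*} {N : ℕ} {deg : Fin N → ℤ}

/-- Over a trivializing set, `x ↦ Ψ0 x 1` is a local section of the projection; hence the
derivative of the projection is onto at its points. -/
lemma LocalTriv.exists_surjective_tangentMapAt {U : Set M} (triv : LocalTriv P U) (hU : IsOpen U)
    {x : M} (hx : x ∈ U) :
    ∃ p, P.π p = x ∧ Function.Surjective (tangentMapAt EP EM P.π p) := by
  refine ⟨triv.Ψ0 x 1, triv.π_Ψ x hx 1, ?_⟩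
  have hf : ContMDiffAt 𝓘(ℝ, EM) 𝓘(ℝ, EP) ∞ (fun y => triv.Ψ0 y 1) x := by
    have h1 : ContMDiffAt (𝓘(ℝ, EM).prod 𝓘(ℝ, 𝔤)) 𝓘(ℝ, EP) ∞
        (fun z : M × G => triv.Ψ0 z.1 z.2) (x, 1) :=
      triv.smooth_Ψ0.contMDiffAt ((hU.prod isOpen_univ).mem_nhds ⟨hx, trivial⟩)
    have h2 : ContMDiffAt 𝓘(ℝ, EM) (𝓘(ℝ, EM).prod 𝓘(ℝ, 𝔤)) ∞ (fun y : M => (y, (1 : G))) x :=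
      contMDiffAt_id.prodMk contMDiffAt_const
    exact ContMDiffAt.comp (g := fun z : M × G => triv.Ψ0 z.1 z.2) x h1 h2
  have hs := mem_extChartAt_source (I := 𝓘(ℝ, EM)) x
  have h := chD_comp (c := x) (d := triv.Ψ0 x 1) (e := P.π (triv.Ψ0 x 1)) hf
    (P.smooth_π (triv.Ψ0 x 1)) hs (mem_extChartAt_source _) (mem_extChartAt_source _)
  rw [chD_congr (g := fun y => y) hs ((hU.eventually_mem hx).mono fun y hy => triv.π_Ψ y hy 1),
    triv.π_Ψ x hx 1, chD_id hs] at h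
  rw [tangentMapAt_eq_chD P.smooth_π, triv.π_Ψ x hx 1]
  intro v
  exact ⟨_, (congrArg (fun T : EM →L[ℝ] EM => T v) h).symm⟩

/-- The local data of equivalent paracocycles are equivalent, through the same functions `t`. -/
theorem ParaEquivVia.cocycleEquivVia (hdeg : ∀ j, Odd (deg j)) {C : TrivializingCover P ι N deg}
    {A A' : TwoConnection P N deg} {T T' : ι → ι → MField P0 EP 𝔢 N E 𝔢}
    (hT : IsQuasiTrivializer C T) (hT' : IsQuasiTrivializer C T')
    {c c' : CocycleData 𝔢 E 𝔤 G EM M ι N} (hc : IsAssociated C A T c)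
    (hc' : IsAssociated C A' T' c') {t : ι → ι → MField M EM PUnit.{1} N E 𝔢}
    (ht : ParaEquivVia C A T A' T' t) : CocycleEquivVia C c c' t := by
  -- each equation on the base is checked after pullback to a point `p` where `π` is a submersion
  have hB : Function.Surjective (0 : 𝔢 →ₗ[ℝ] PUnit.{1}) := fun _ => ⟨0, rfl⟩
  have hπ : Continuous P.π := P.smooth_π.continuous
  have hO2 : ∀ i j, IsOpen (C.U i ∩ C.U j) := fun i j => (C.isOpen i).inter (C.isOpen j)
  have gT : ∀ i j p, P.π p ∈ C.U i ∩ C.U j → ∀ η, (T i j p η).Good :=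
    fun i j p hp η => (hT i j).1.good hdeg hp η
  have gT' : ∀ i j p, P.π p ∈ C.U i ∩ C.U j → ∀ η, (T' i j p η).Good :=
    fun i j p hp η => (hT' i j).1.good hdeg hp η
  have gt : ∀ i j x, x ∈ C.U i ∩ C.U j → ∀ w, (t i j x w).Good :=
    fun i j x hx w => (ht.int_t i j).good hdeg hx w
  have gpt : ∀ i j p, P.π p ∈ C.U i ∩ C.U j → ∀ η, (P.pullM (t i j) p η).Good :=
    fun i j p hp η => (gt i j _ hp 0).pull _ _
  have eqT : ∀ i j p, P.π p ∈ C.U i ∩ C.U j → ∀ η,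
      T i j p η = (T' i j p η).mul (P.pullM (t i j) p η) := fun i j p hp η =>
    Pt.mul_eq_of_eq_mul_inv (gT i j p hp η) (gpt i j p hp η) (ht.eq_T i j p hp η)
  have eqom : ∀ i, ∀ x ∈ C.U i, ∀ w, c'.om i x w = c.om i x w := by
    intro i x hx w
    obtain ⟨p, rfl, hA⟩ := (C.triv i).exists_surjective_tangentMapAt (C.isOpen i) hx
    refine pullT_injective (W := 𝔤) (N := N)
      (tangentMapAt EP EM P.π p : EP →ₗ[ℝ] EM) (0 : 𝔢 →ₗ[ℝ] PUnit.{1}) hA hB ?_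
    exact (hc'.eq_om i p hx 0).symm.trans ((ht.eq_om i p hx 0).trans (hc.eq_om i p hx 0))
  refine ⟨ht.int_t, eqom, ?_, ?_, ?_, ?_⟩
  · intro i x hx w
    obtain ⟨p, rfl, hA⟩ := (C.triv i).exists_surjective_tangentMapAt (C.isOpen i) hx
    refine pullT_injective (W := 𝔢) (N := N)
      (tangentMapAt EP EM P.π p : EP →ₗ[ℝ] EM) (0 : 𝔢 →ₗ[ℝ] PUnit.{1}) hA hB ?_
    exact (hc'.eq_Om i p hx 0).symm.trans ((ht.eq_Om i p hx 0).trans (hc.eq_Om i p hx 0))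
  · intro i j x hx w
    obtain ⟨p, rfl, hA⟩ := (C.triv i).exists_surjective_tangentMapAt (C.isOpen i) hx.1
    have gf := (hc.int_f i j).good hdeg hx w
    have gf' := (hc'.int_f i j).good hdeg hx w
    refine pull_injective (K := G) (N := N)
      (tangentMapAt EP EM P.π p : EP →ₗ[ℝ] EM) (0 : 𝔢 →ₗ[ℝ] PUnit.{1}) hA hB ?_
    -- both families express the same `f_b`
    rw [pull_mul _ _ (cm.pτ_good (gt i j _ hx w)) gf, pull_pτ _ _ cm (gt i j _ hx w)]
    have h := (hc.eq_f i j p hx 0).symm.trans (hc'.eq_f i j p hx 0)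
    rw [eqT i j p hx 0] at h
    exact cm.eq_pτ_mul_of_mul_eq (gT' i j p hx 0) (gpt i j p hx 0) (gf.pull _ _) (gf'.pull _ _) h
  · intro i j x hx w
    obtain ⟨p, rfl, hA⟩ := (C.triv i).exists_surjective_tangentMapAt (C.isOpen i) hx.1
    have gtx := gt i j _ hx w
    refine pullT_injective (W := 𝔢) (N := N)
      (tangentMapAt EP EM P.π p : EP →ₗ[ℝ] EM) (0 : 𝔢 →ₗ[ℝ] PUnit.{1}) hA hB ?_
    rw [map_sub, map_sub, pullT_Ad _ _ gtx, pullT_pdμ _ _ cm gtx]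
    have hm := (ht.int_t i j).mGoodAt hdeg (hO2 i j) hx 0
    have hsm := (ht.int_t i j).2.2.1 _ hx 0
    have hlogt : logR extD (P.pullM (t i j)) p 0 = P.pullV (logR extD (t i j)) p 0 :=
      logR_pullMField (F := 𝔢) P.smooth_π hm hsm 0
    have hmt : MGoodAt (P.pullM (t i j)) p 0 :=
      MGoodAt.pullMField (F := 𝔢) P.smooth_π hm hsm 0
    have hmT' := (hT' i j).1.mGoodAt hdeg ((hO2 i j).preimage hπ) hx 0
    -- `dT T⁻¹ = dT' T'⁻¹ + Ad T' (dt t⁻¹)`, since `T = T' π^* t` on an open set around `p`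
    have hlogT : logR extD (T i j) p 0 = logR extD (T' i j) p 0
        + (T' i j p 0).Ad (P.pullV (logR extD (t i j)) p 0) := by
      rw [← hlogt, ← logR_mul hmT' hmt]
      refine logR_congr ?_
      filter_upwards [((hO2 i j).preimage hπ).mem_nhds hx] with q hq using eqT i j q hq 0
    -- both families express the same `F_b`
    have h := (hc.eq_F i j p hx 0).symm.trans (hc'.eq_F i j p hx 0)
    have hom : P.pullV (c.om i) p (0 : 𝔢) = P.pullV (c'.om i) p 0 := by
      rw [PreTwoBundle.pullV, PreTwoBundle.pullV, eqom i _ hx.1]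
    have gT'p := gT' i j p hx 0
    rw [hlogT, eqT i j p hx 0, Pt.Ad_mul gT'p (gpt i j p hx 0),
      cm.pdμ_mul gT'p (gpt i j p hx 0), hom] at h
    have h1 : (T' i j p 0).Ad ((P.pullM (t i j) p 0).Ad (P.pullV (c.F i j) p 0)
        - cm.pdμ (P.pullV (c'.om i) p 0) (P.pullM (t i j) p 0)
        - P.pullV (logR extD (t i j)) p 0) = (T' i j p 0).Ad (P.pullV (c'.F i j) p 0) := by
      rw [Pt.Ad_sub, Pt.Ad_sub]
      have := eq_add_of_sub_eq (eq_add_of_sub_eq h.symm)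
      rw [this]
      abel
    have h2 := congrArg (T' i j p 0).inv.Ad h1
    rw [Pt.Ad_inv_Ad gT'p, Pt.Ad_inv_Ad gT'p] at h2
    exact h2.symm
  · intro i j k x hx w
    obtain ⟨p, rfl, hA⟩ := (C.triv i).exists_surjective_tangentMapAt (C.isOpen i) hx.1.1
    have hjk : P.π p ∈ C.U j ∩ C.U k := ⟨hx.1.2, hx.2⟩
    have hik : P.π p ∈ C.U i ∩ C.U k := ⟨hx.1.1, hx.2⟩
    have gf := (hc.int_f i j).good hdeg hx.1 w
    have gTh := (hc.int_T i j k).good hdeg hx w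
    have gfp : (P.pullM (c.f i j) p (0 : 𝔢)).Good := gf.pull _ _
    have g1 := gt i k _ hik w
    have g2 := (gt j k _ hjk w).inv
    have g3 := (gt i j _ hx.1 w).inv
    refine pull_injective (K := E) (N := N)
      (tangentMapAt EP EM P.π p : EP →ₗ[ℝ] EM) (0 : 𝔢 →ₗ[ℝ] PUnit.{1}) hA hB ?_
    rw [pull_mul _ _ ((g1.mul gTh).mul (cm.pμ_good gf g2)) g3,
      pull_mul _ _ (g1.mul gTh) (cm.pμ_good gf g2), pull_mul _ _ g1 gTh, pull_pμ _ _ cm gf g2,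
      pull_inv _ _ (gt j k _ hjk w), pull_inv _ _ (gt i j _ hx.1 w)]
    have h := hc.eq_T i j k p hx 0
    have h' := hc'.eq_T i j k p hx 0
    have hfb : fb (C.coord i) (C.coord j) p 0 = _ := hc.eq_f i j p hx.1 0
    rw [hfb] at h h'
    rw [ht.eq_T i j p hx.1 0, ht.eq_T j k p hjk 0, ht.eq_T i k p hik 0,
      cm.inv_mul_pμ_mul_change (gT i j p hx.1 0) (gT j k p hjk 0) (gT i k p hik 0)
        (gpt i j p hx.1 0) (gpt j k p hjk 0) (gpt i k p hik 0) gfp, h] at h'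
    exact h'.symm

end Descent

end TwoBundle

end

theorem mainTheorem5
    {𝔢 E 𝔤 G EM M EP P0 EQ P1 : Type*}
    [NormedAddCommGroup 𝔢] [NormedSpace ℝ 𝔢] [FiniteDimensional ℝ 𝔢]
    [TopologicalSpace E] [ChartedSpace 𝔢 E] [Group E] [LieGroup 𝓘(ℝ, 𝔢) ∞ E]
    [NormedAddCommGroup 𝔤] [NormedSpace ℝ 𝔤] [FiniteDimensional ℝ 𝔤]
    [TopologicalSpace G] [ChartedSpace 𝔤 G] [Group G] [LieGroup 𝓘(ℝ, 𝔤) ∞ G]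
    (cm : TwoBundle.LieCrossedModule 𝔢 E 𝔤 G)
    [NormedAddCommGroup EM] [NormedSpace ℝ EM] [FiniteDimensional ℝ EM]
    [TopologicalSpace M] [ChartedSpace EM M] [IsManifold 𝓘(ℝ, EM) ∞ M]
    [NormedAddCommGroup EP] [NormedSpace ℝ EP] [FiniteDimensional ℝ EP]
    [TopologicalSpace P0] [ChartedSpace EP P0] [IsManifold 𝓘(ℝ, EP) ∞ P0]
    [NormedAddCommGroup EQ] [NormedSpace ℝ EQ] [FiniteDimensional ℝ EQ]
    [TopologicalSpace P1] [ChartedSpace EQ P1] [IsManifold 𝓘(ℝ, EQ) ∞ P1]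
    (P : TwoBundle.PrincipalTwoBundle EM M EP P0 EQ P1 cm)
    (N : ℕ) (deg : Fin N → ℤ) (hdeg : ∀ j, Odd (deg j)) {ι : Type*}
    (C : TwoBundle.TrivializingCover P.toPreTwoBundle ι N deg)
    (A A' : TwoBundle.TwoConnection P.toPreTwoBundle N deg)
    (T T' : ι → ι → TwoBundle.MField P0 EP 𝔢 N E 𝔢)
    (hA : TwoBundle.IsParacocycle C A T) (hA' : TwoBundle.IsParacocycle C A' T')
    (c c' : TwoBundle.CocycleData 𝔢 E 𝔤 G EM M ι N)
    (hc : TwoBundle.IsAssociated C A T c) (hc' : TwoBundle.IsAssociated C A' T' c')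
    (hequiv : TwoBundle.ParaEquiv C A T A' T') :
    TwoBundle.CocycleEquiv C c c' ∧
      ∀ t : ι → ι → TwoBundle.MField M EM PUnit.{1} N E 𝔢,
        TwoBundle.ParaEquivVia C A T A' T' t → TwoBundle.CocycleEquivVia C c c' t := by
  have key : ∀ t, TwoBundle.ParaEquivVia C A T A' T' t → TwoBundle.CocycleEquivVia C c c' t :=
    fun _ ht => ht.cocycleEquivVia hdeg hA.quasiTrivializer hA'.quasiTrivializer hc hc'
  exact ⟨hequiv.imp key, key⟩
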